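/- Let $K$ be a field of characteristic zero. For $n\ge 0$ let $P_n=K[x_1,\dots,x_n]$, and let $A_n$ be the $n$-th Weyl algebra, i.e. the associative unital $K$-algebra with generators $x_1,\dots,x_n,\partial_1,\dots,\partial_n$ and defining relations $[x_i,x_j]=0$, $[\partial_i,\partial_j]=0$, $[\partial_i,x_j]=\delta_{ij}$. Equip $P_{2n}=K[x_1,\dots,x_{2n}]$ with its canonical Poisson bracket $$\{f,g\}=\sum_{i=1}^n\left(\frac{\partial f}{\partial x_{n+i}}\frac{\partial g}{\partial x_i}-\frac{\partial f}{\partial x_i}\frac{\partial g}{\partial x_{n+i}}\right),$$ so that $\{x_i,x_j\}=0=\{x_{n+i},x_{n+j}\}$ and $\{x_{n+i},x_j\}=\delta_{ij}$ for $1\le i,j\le n$. Consider the following statements over $K$. * $\mathrm{JC}_n$ (Jacobian Conjecture): every $K$-algebra endomorphism $\sigma$ of $P_n$ with $\det\left(\partial\sigma(x_i)/\partial x_j\right)\in K\setminus\{0\}$ is an automorphism. * $\mathrm{DC}_n$ (Conjecture of Dixmier): every $K$-algebra endomorphism of $A_n$ is an automorphism. * $\mathrm{PC}_{2n}$ (Poisson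 Conjecture): every Poisson endomorphism of $P_{2n}$ (a $K$-algebra endomorphism preserving $\{\cdot,\cdot\}$) is a Poisson automorphism. **Theorem.** 1. For every $n$, $\mathrm{JC}_{2n}\Rightarrow \mathrm{PC}_{2n}$. 2. For every $n$, $\mathrm{DC}_{2n}\Rightarrow \mathrm{PC}_{2n}$. 3. For every $n$, $\mathrm{PC}_{2n}\Rightarrow \mathrm{JC}_{n}$. 4. The Jacobian Conjecture ($\mathrm{JC}_n$ for all $n$) and the Poisson Conjecture ($\mathrm{PC}_{2n}$ for all $n$) are equivalent. 5. The Jacobian Conjecture, the Conjecture of Dixmier ($\mathrm{DC}_n$ for all $n$) and the Poisson Conjecture are equivalent. -/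

import Mathlib

open MvPolynomial

/-- The Jacobian matrix `(∂ σ(xᵢ) / ∂ xⱼ)` of an endomorphism `σ` of `K[x₁, …, xₙ]`. -/
noncomputable def jacobianMatrix {K : Type*} [Field K] {n : ℕ}
    (σ : MvPolynomial (Fin n) K →ₐ[K] MvPolynomial (Fin n) K) :
    Matrix (Fin n) (Fin n) (MvPolynomial (Fin n) K) :=
  Matrix.of fun i j => pderiv j (σ (X i))

/-- A Jacobian map: the determinant of the Jacobian matrix is a nonzero scalar. -/
def IsJacobianMap {K : Type*} [Field K] {n : ℕ}
    (σ : MvPolynomial (Fin n) K →ₐ[K] MvPolynomial (Fin n) K) : Prop :=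
  ∃ c : K, c ≠ 0 ∧ (jacobianMatrix σ).det = C c

/-- The Jacobian Conjecture `JC_n` over `K`: every Jacobian map of `K[x₁, …, xₙ]` is an
automorphism, i.e. an invertible element of the monoid of `K`-algebra endomorphisms. -/
def JacobianConjecture (K : Type*) [Field K] (n : ℕ) : Prop :=
  ∀ σ : MvPolynomial (Fin n) K →ₐ[K] MvPolynomial (Fin n) K, IsJacobianMap σ → IsUnit σ

/-- The defining relations of the Weyl algebra, on free generators
`xᵢ` (`Sum.inl i`) and `∂ᵢ` (`Sum.inr i`):
`[xᵢ, xⱼ] = 0`, `[∂ᵢ, ∂ⱼ] = 0`, `[∂ᵢ, xⱼ] = δᵢⱼ`. -/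
inductive WeylRel (K : Type*) [CommRing K] (n : ℕ) :
    FreeAlgebra K (Fin n ⊕ Fin n) → FreeAlgebra K (Fin n ⊕ Fin n) → Prop
  | x_x (i j : Fin n) : WeylRel K n
      (FreeAlgebra.ι K (Sum.inl i) * FreeAlgebra.ι K (Sum.inl j)
        - FreeAlgebra.ι K (Sum.inl j) * FreeAlgebra.ι K (Sum.inl i)) 0
  | d_d (i j : Fin n) : WeylRel K n
      (FreeAlgebra.ι K (Sum.inr i) * FreeAlgebra.ι K (Sum.inr j)
        - FreeAlgebra.ι K (Sum.inr j) * FreeAlgebra.ι K (Sum.inr i)) 0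
  | d_x (i j : Fin n) : WeylRel K n
      (FreeAlgebra.ι K (Sum.inr i) * FreeAlgebra.ι K (Sum.inl j)
        - FreeAlgebra.ι K (Sum.inl j) * FreeAlgebra.ι K (Sum.inr i)) (if i = j then 1 else 0)

/-- The Weyl algebra `A_n` over `K`, by generators and relations. -/
abbrev WeylAlgebra (K : Type*) [CommRing K] (n : ℕ) : Type _ :=
  RingQuot (WeylRel K n)

/-- The Conjecture of Dixmier `DC_n` over `K`: every `K`-algebra endomorphism of `A_n` is an
automorphism. -/
def DixmierConjecture (K : Type*) [Field K] (n : ℕ) : Prop :=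
  ∀ σ : WeylAlgebra K n →ₐ[K] WeylAlgebra K n, IsUnit σ

/-- The canonical Poisson bracket on the polynomial algebra `P_{2n}`, whose variables are
`xᵢ = X (Sum.inl i)` and `x_{n+i} = X (Sum.inr i)`: the biderivation with
`{xᵢ, xⱼ} = 0`, `{x_{n+i}, x_{n+j}} = 0`, `{x_{n+i}, xⱼ} = δᵢⱼ`. -/
noncomputable def poissonBracket {K : Type*} [Field K] {n : ℕ}
    (f g : MvPolynomial (Fin n ⊕ Fin n) K) : MvPolynomial (Fin n ⊕ Fin n) K :=
  ∑ i : Fin n, (pderiv (Sum.inr i) f * pderiv (Sum.inl i) g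
    - pderiv (Sum.inl i) f * pderiv (Sum.inr i) g)

/-- The monoid of Poisson endomorphisms of `P_{2n}`: the `K`-algebra endomorphisms that preserve
the Poisson bracket. Its invertible elements are the Poisson automorphisms. -/
def poissonEnd (K : Type*) [Field K] (n : ℕ) :
    Submonoid (MvPolynomial (Fin n ⊕ Fin n) K →ₐ[K] MvPolynomial (Fin n ⊕ Fin n) K) where
  carrier := {σ | ∀ f g, σ (poissonBracket f g) = poissonBracket (σ f) (σ g)}
  one_mem' := fun _ _ => rfl
  mul_mem' := by
    intro σ τ hσ hτ f g
    change σ (τ (poissonBracket f g)) = poissonBracket (σ (τ f)) (σ (τ g))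
    rw [hτ f g, hσ (τ f) (τ g)]

/-- The Poisson Conjecture `PC_{2n}` over `K` (the argument is `n`, half the number of variables):
every Poisson endomorphism of `P_{2n}` is a Poisson automorphism. -/
def PoissonConjecture (K : Type*) [Field K] (n : ℕ) : Prop :=
  ∀ σ : poissonEnd K n, IsUnit σ

/-! ### Polynomial endomorphisms, Jacobian matrices and dual derivations -/

section PolynomialAlgebra

/-! Some of the implications are direct constructions. A Poisson endomorphism has a Jacobian matrix
J with J Ω Jᵀ = Ω for the invertible symplectic matrix Ω, so (det J)² = 1 and JC_{2n} applies.
Conversely, a Jacobian map σ of P_n comes with commuting derivations ∂/∂σ(x_i) dual to the σ(x_i).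
Sending the momenta x_{n+i} to the symbols of these derivations extends σ to a Poisson endomorphism
of P_{2n}; sending ∂_i to the derivations themselves extends it to an endomorphism of A_n.
Bijectivity of the extension forces σ to be onto, whence PC_{2n} ⇒ JC_n and DC_n ⇒ JC_n. The
implication DC_{2n} ⇒ PC_{2n} passes through JC_{2n}.

The substance is JC ⇒ DC, by reduction modulo a large prime. Endomorphisms of A_n are injective
because A_n is simple, so only surjectivity is at stake. Its failure is witnessed, up to a fixed
degree, by a linear functional involving finitely many scalars. Together with the coefficients of
the endomorphism they generate a ring of finite type over ℤ, which maps to ℤ_p for arbitrarily large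
p (`exists_hom_to_padicInt`). Over F_p the Weyl algebra is free of rank p^{2n} over its centre, the
polynomial ring in the p-th powers of the generators. The reduced endomorphism preserves the centre
(`WeylAlgebra.exists_frobCenter_algHom`). As it lifts to ℤ_p, it also preserves the Poisson bracket
that commutators of lifts, divided by p, induce there (`WeylAlgebra.poissonBracket_of_lift`). The
induced map σ of the centre therefore has Jacobian determinant of square 1. If σ is onto, so is the
reduced endomorphism, and preimages of generators have the same degrees for both.

It remains to transfer JC from K to F_p with uniform degree bounds
(`JacobianConjecture.exists_bounded_preimage`). This is a compactness argument: counterexamples for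
infinitely many p specialise to one over a finite extension of K. It rests on Weil restriction,
which multiplies the number of variables and so uses JC in all dimensions, and on a bound for the
degree of an inverse in terms of the degree and the number of variables
(`MvPolynomial.totalDegree_le_inverseDegreeBound`). -/

theorem MvPolynomial.algHom_surjective_of_X_mem_range {R ι A : Type*} [CommSemiring R]
    [Semiring A] [Algebra R A] (σ : A →ₐ[R] MvPolynomial ι R) (h : ∀ i, X i ∈ σ.range) :
    Function.Surjective σ := by
  rw [← AlgHom.range_eq_top, eq_top_iff, ← MvPolynomial.adjoin_range_X]
  exact Algebra.adjoin_le (by rintro _ ⟨i, rfl⟩; exact h i)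

theorem AlgHom.isUnit_of_bijective {R A : Type*} [CommSemiring R] [Semiring A] [Algebra R A]
    (σ : A →ₐ[R] A) (h : Function.Bijective σ) : IsUnit σ := by
  let e := AlgEquiv.ofBijective σ h
  refine ⟨⟨σ, e.symm, ?_, ?_⟩, rfl⟩
  · ext x; exact e.apply_symm_apply x
  · ext x; exact e.symm_apply_apply x

theorem AlgHom.bijective_of_isUnit {R A : Type*} [CommSemiring R] [Semiring A] [Algebra R A]
    (σ : A →ₐ[R] A) (h : IsUnit σ) : Function.Bijective σ := by
  obtain ⟨u, rfl⟩ := h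
  refine Function.bijective_iff_has_inverse.2 ⟨(↑u⁻¹ : A →ₐ[R] A), fun x => ?_, fun x => ?_⟩
  · exact DFunLike.congr_fun u.inv_mul x
  · exact DFunLike.congr_fun u.mul_inv x

/-- The kernels of the powers of `f` stabilise, say at n. An element of the kernel of `f` is `(f ^
n) b`; then b is killed by `f ^ (n + 1)`, hence already by `f ^ n`. -/
theorem RingHom.injective_of_surjective_endo {A : Type*} [CommRing A] [IsNoetherianRing A]
    (f : A →+* A) (h : Function.Surjective f) : Function.Injective f := by
  let c : ℕ →o Ideal A := ⟨fun n => RingHom.ker (f ^ n), monotone_nat_of_le_succ fun n x hx => by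
    rw [RingHom.mem_ker] at hx ⊢
    rw [pow_succ', RingHom.coe_mul, Function.comp_apply, hx, map_zero]⟩
  obtain ⟨n, hn⟩ := monotone_stabilizes_iff_noetherian.2 (inferInstanceAs (IsNoetherian A A)) c
  rw [injective_iff_map_eq_zero]
  intro a ha
  have hs : Function.Surjective (f ^ n : A →+* A) := by
    rw [RingHom.coe_pow]
    exact h.iterate n
  obtain ⟨b, rfl⟩ := hs a
  have : b ∈ c (n + 1) := by
    change (f ^ (n + 1)) b = 0
    rw [pow_succ', RingHom.coe_mul, Function.comp_apply, ha]
  rw [← hn (n + 1) (by omega)] at this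
  exact this

theorem MvPolynomial.isUnit_algHom_of_surjective {K ι : Type*} [Field K] [Finite ι]
    (σ : MvPolynomial ι K →ₐ[K] MvPolynomial ι K) (h : Function.Surjective σ) : IsUnit σ :=
  AlgHom.isUnit_of_bijective σ ⟨RingHom.injective_of_surjective_endo σ.toRingHom h, h⟩

/-- The Jacobian matrix of an endomorphism of a polynomial ring in arbitrary variables. -/
noncomputable def MvPolynomial.jacobian {R ι : Type*} [CommRing R]
    (σ : MvPolynomial ι R →ₐ[R] MvPolynomial ι R) : Matrix ι ι (MvPolynomial ι R) :=
  Matrix.of fun i j => pderiv j (σ (X i))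

theorem MvPolynomial.jacobian_apply {R ι : Type*} [CommRing R]
    (σ : MvPolynomial ι R →ₐ[R] MvPolynomial ι R) (i j : ι) :
    jacobian σ i j = pderiv j (σ (X i)) := rfl

/-- Units of a polynomial ring over a field are nonzero constants, so a unit determinant is the
Jacobian condition up to renaming variables. Later arguments use index types such as `Fin n ⊕ Fin n`
and `ι × Fin r`. -/
theorem JacobianConjecture.surjective {K ι : Type*} [Field K] [Fintype ι] [DecidableEq ι]
    {n : ℕ} (hn : Fintype.card ι = n)
    (h : JacobianConjecture K n) (σ : MvPolynomial ι K →ₐ[K] MvPolynomial ι K)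
    (hσ : IsUnit (jacobian σ).det) : Function.Surjective σ := by
  subst hn
  let e := Fintype.equivFin ι
  let E := renameEquiv K e
  let τ : MvPolynomial (Fin (Fintype.card ι)) K →ₐ[K] MvPolynomial (Fin (Fintype.card ι)) K :=
    (E.toAlgHom.comp σ).comp E.symm.toAlgHom
  have hJ : jacobianMatrix τ =
      ((jacobian σ).map (E : MvPolynomial ι K →+* _)).submatrix e.symm e.symm := by
    ext1 i j
    have hτ : τ (X i) = rename e (σ (X (e.symm i))) := by
      simp [τ, E]
    have := pderiv_rename (R := K) e.injective (e.symm j) (σ (X (e.symm i)))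
    simp only [Equiv.apply_symm_apply] at this
    simp only [jacobianMatrix, Matrix.of_apply, hτ, this, Matrix.submatrix_apply, Matrix.map_apply,
      jacobian]
    rfl
  have hu : IsUnit (jacobianMatrix τ).det := by
    rw [hJ, Matrix.det_submatrix_equiv_self, ← RingHom.mapMatrix_apply, ← RingHom.map_det]
    exact hσ.map _
  obtain ⟨c, hc, hc'⟩ := MvPolynomial.isUnit_iff_eq_C_of_isReduced.1 hu
  have hτ : IsUnit τ := h τ ⟨c, hc.ne_zero, hc'⟩
  have hb := AlgHom.bijective_of_isUnit τ hτ
  intro P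
  obtain ⟨Q, hQ⟩ := hb.2 (E P)
  exact ⟨E.symm Q, E.injective hQ⟩

theorem MvPolynomial.derivation_apply_eq_sum {R ι : Type*} [CommRing R] [Fintype ι]
    (D : Derivation R (MvPolynomial ι R) (MvPolynomial ι R)) (P : MvPolynomial ι R) :
    D P = ∑ j, pderiv j P * D (X j) := by
  classical
  induction P using MvPolynomial.induction_on with
  | C a => simp [derivation_C]
  | add p q hp hq => simp [hp, hq, add_mul, Finset.sum_add_distrib]
  | mul_X p i hp =>
    simp only [Derivation.leibniz, hp, smul_eq_mul, add_mul, Finset.sum_add_distrib,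
      Finset.mul_sum]
    congr 1
    · rw [Finset.sum_eq_single i]
      · simp
      · intro j _ hj; simp [pderiv_X_of_ne hj.symm]
      · simp
    · exact Finset.sum_congr rfl fun _ _ => by ring

theorem MvPolynomial.pderiv_comm {R ι : Type*} [CommRing R] (i j : ι) (P : MvPolynomial ι R) :
    pderiv i (pderiv j P) = pderiv j (pderiv i P) := by
  classical
  have : ⁅pderiv (R := R) i, pderiv (R := R) j⁆ = 0 := by
    refine derivation_ext fun k => ?_
    rw [Derivation.commutator_apply]
    simp only [pderiv_X, Pi.single_apply]
    split_ifs <;> simp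
  have := congrArg (fun D => D P) this
  simpa [Derivation.commutator_apply, sub_eq_zero] using this

theorem MvPolynomial.pderiv_algHom_apply {R ι κ : Type*} [CommRing R] [Fintype ι]
    (σ : MvPolynomial ι R →ₐ[R] MvPolynomial κ R) (k : κ) (P : MvPolynomial ι R) :
    pderiv k (σ P) = ∑ j, σ (pderiv j P) * pderiv k (σ (X j)) := by
  classical
  induction P using MvPolynomial.induction_on with
  | C a => simp [MvPolynomial.algHom_C]
  | add p q hp hq => simp [hp, hq, add_mul, Finset.sum_add_distrib]
  | mul_X p i hp =>
    simp only [map_mul, pderiv_mul, hp, map_add, add_mul, Finset.sum_add_distrib, Finset.sum_mul]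
    congr 1
    · exact Finset.sum_congr rfl fun _ _ => by ring
    · rw [Finset.sum_eq_single i]
      · simp
      · intro j _ hj; simp [pderiv_X_of_ne hj.symm]
      · simp

/-- The derivation `∂/∂Fᵢ` attached to an inverse `N` of the Jacobian matrix of `F`. -/
noncomputable def MvPolynomial.dualDerivation {K ι : Type*} [CommRing K]
    (N : Matrix ι ι (MvPolynomial ι K)) (i : ι) :
    Derivation K (MvPolynomial ι K) (MvPolynomial ι K) :=
  mkDerivation K fun j => N j i

theorem MvPolynomial.dualDerivation_apply {K ι : Type*} [CommRing K] [Fintype ι]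
    (N : Matrix ι ι (MvPolynomial ι K)) (i : ι) (P : MvPolynomial ι K) :
    dualDerivation N i P = ∑ j, N j i * pderiv j P := by
  rw [derivation_apply_eq_sum]
  exact Finset.sum_congr rfl fun j _ => by rw [dualDerivation, mkDerivation_X, mul_comm]

section DualDerivations

variable {K ι : Type*} [CommRing K] [Fintype ι] [DecidableEq ι]
  {F : ι → MvPolynomial ι K} {N : Matrix ι ι (MvPolynomial ι K)}

/-- By the chain rule, the invertible Jacobian matrix kills the vector of the values `D (X j)`.
Derivations may thus be compared on the F_l alone; this is how the dual derivations are seen to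
commute. -/
theorem MvPolynomial.derivation_eq_zero_of_jacobian
    (hN : Matrix.of (fun i j => pderiv j (F i)) * N = 1)
    (D : Derivation K (MvPolynomial ι K) (MvPolynomial ι K)) (hD : ∀ l, D (F l) = 0) : D = 0 := by
  have h1 : (Matrix.of (fun i j => pderiv j (F i))).mulVec (fun j => D (X j)) = 0 := by
    ext1 l
    simp only [Matrix.mulVec, dotProduct, Matrix.of_apply, Pi.zero_apply]
    rw [← derivation_apply_eq_sum, hD]
  have h2 : (fun j => D (X j)) = 0 := by
    have := congrArg N.mulVec h1
    rwa [Matrix.mulVec_mulVec, mul_eq_one_comm.1 hN, Matrix.one_mulVec,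
      Matrix.mulVec_zero] at this
  exact derivation_ext fun i => congrFun h2 i

theorem MvPolynomial.dualDerivation_apply_self
    (hN : Matrix.of (fun i j => pderiv j (F i)) * N = 1) (i l : ι) :
    dualDerivation N i (F l) = if i = l then 1 else 0 := by
  have := congrFun (congrFun hN l) i
  rw [Matrix.mul_apply, Matrix.one_apply] at this
  rw [dualDerivation_apply, if_congr eq_comm rfl rfl, ← this]
  exact Finset.sum_congr rfl fun j _ => by rw [Matrix.of_apply, mul_comm]

theorem MvPolynomial.dualDerivation_commute
    (hN : Matrix.of (fun i j => pderiv j (F i)) * N = 1) (i l : ι) (P : MvPolynomial ι K) :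
    dualDerivation N i (dualDerivation N l P) = dualDerivation N l (dualDerivation N i P) := by
  have h : ⁅dualDerivation N i, dualDerivation N l⁆ = 0 := by
    refine derivation_eq_zero_of_jacobian hN _ fun k => ?_
    rw [Derivation.commutator_apply, dualDerivation_apply_self hN, dualDerivation_apply_self hN]
    split_ifs <;> simp
  have := congrArg (fun D => D P) h
  simpa [Derivation.commutator_apply, sub_eq_zero] using this

theorem MvPolynomial.dualDerivation_entry_comm
    (hN : Matrix.of (fun i j => pderiv j (F i)) * N = 1) (i l j : ι) :
    dualDerivation N i (N j l) = dualDerivation N l (N j i) := by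
  have := dualDerivation_commute hN i l (X j)
  simpa [dualDerivation] using this

end DualDerivations

/-- Evaluation of polynomials at pairwise commuting elements of a noncommutative algebra. -/
theorem MvPolynomial.exists_algHom_of_commute {R A ι : Type*} [CommRing R] [Ring A] [Algebra R A]
    (g : ι → A) (hg : ∀ i j, g i * g j = g j * g i) :
    ∃ f : MvPolynomial ι R →ₐ[R] A, ∀ i, f (X i) = g i := by
  have := Algebra.isMulCommutative_adjoin R (s := Set.range g) (by
    rintro _ ⟨i, rfl⟩ _ ⟨j, rfl⟩; exact hg i j)
  let _ : CommRing (Algebra.adjoin R (Set.range g)) :=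
    { (inferInstance : Ring (Algebra.adjoin R (Set.range g))) with mul_comm := this.is_comm.comm }
  refine ⟨(Algebra.adjoin R (Set.range g)).val.comp
    (aeval (R := R) fun i => (⟨g i, Algebra.subset_adjoin ⟨i, rfl⟩⟩ : Algebra.adjoin R (Set.range g))),
    fun i => ?_⟩
  simp

end PolynomialAlgebra

/-! ### The Weyl algebra: universal property, symbols, change of scalars -/

section WeylAlgebraBasics

/-- The standard symplectic form on the index set `Fin n ⊕ Fin n`. -/
def weylForm (R : Type*) [CommRing R] {n : ℕ} : Fin n ⊕ Fin n → Fin n ⊕ Fin n → R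
  | .inl _, .inl _ => 0
  | .inr _, .inr _ => 0
  | .inr i, .inl j => if i = j then 1 else 0
  | .inl i, .inr j => if i = j then -1 else 0

theorem weylForm_swap (R : Type*) [CommRing R] {n : ℕ} (a b : Fin n ⊕ Fin n) :
    weylForm R b a = - weylForm R a b := by
  rcases a with i | i <;> rcases b with j | j <;> simp only [weylForm, neg_zero, eq_comm] <;>
    split_ifs <;> simp

theorem map_weylForm {R S : Type*} [CommRing R] [CommRing S] (f : R →+* S) {n : ℕ}
    (a b : Fin n ⊕ Fin n) : f (weylForm R a b) = weylForm S a b := by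
  rcases a with i | i <;> rcases b with j | j <;> simp [weylForm, apply_ite f]

/-- A family of elements satisfying the defining relations of the Weyl algebra. -/
def IsWeylSystem (R : Type*) {A : Type*} [CommRing R] [Ring A] [Algebra R A] {n : ℕ}
    (g : Fin n ⊕ Fin n → A) : Prop :=
  ∀ a b, g a * g b - g b * g a = algebraMap R A (weylForm R a b)

namespace WeylAlgebra

variable {R : Type*} [CommRing R] {n : ℕ}

/-- The generators of the Weyl algebra: `xᵢ` is `gen (inl i)` and `∂ᵢ` is `gen (inr i)`. -/
noncomputable def gen (R : Type*) [CommRing R] {n : ℕ} (a : Fin n ⊕ Fin n) : WeylAlgebra R n :=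
  RingQuot.mkAlgHom R (WeylRel R n) (FreeAlgebra.ι R a)

theorem gen_isWeylSystem : IsWeylSystem R (gen R : Fin n ⊕ Fin n → WeylAlgebra R n) := by
  have key : ∀ i j : Fin n, gen R (Sum.inr i) * gen R (Sum.inl j)
      - gen R (Sum.inl j) * gen R (Sum.inr i)
      = algebraMap R (WeylAlgebra R n) (if i = j then 1 else 0) := by
    intro i j
    have h := RingQuot.mkAlgHom_rel R (WeylRel.d_x (K := R) i j)
    simp only [map_sub, map_mul] at h
    rw [gen, gen, h]
    split_ifs <;> simp
  rintro (i | i) (j | j)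
  · have h := RingQuot.mkAlgHom_rel R (WeylRel.x_x (K := R) i j)
    simpa [weylForm, gen] using h
  · have h := key j i
    rw [← neg_sub, h]
    simp only [weylForm, eq_comm]
    split_ifs <;> simp
  · exact key i j
  · have h := RingQuot.mkAlgHom_rel R (WeylRel.d_d (K := R) i j)
    simpa [weylForm, gen] using h

theorem exists_lift {A : Type*} [Ring A] [Algebra R A] {g : Fin n ⊕ Fin n → A}
    (hg : IsWeylSystem R g) : ∃ f : WeylAlgebra R n →ₐ[R] A, ∀ a, f (gen R a) = g a := by
  refine ⟨RingQuot.liftAlgHom R ⟨FreeAlgebra.lift R g, ?_⟩, fun a => ?_⟩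
  · intro u v h
    rcases h with ⟨i, j⟩ | ⟨i, j⟩ | ⟨i, j⟩
    · simpa [weylForm] using hg (.inl i) (.inl j)
    · simpa [weylForm] using hg (.inr i) (.inr j)
    · have := hg (.inr i) (.inl j)
      simp only [weylForm] at this
      simp only [map_sub, map_mul, FreeAlgebra.lift_ι_apply, this]
      split_ifs <;> simp
  · rw [gen, RingQuot.liftAlgHom_mkAlgHom_apply, FreeAlgebra.lift_ι_apply]

theorem adjoin_range_gen : Algebra.adjoin R (Set.range (gen R (n := n))) = ⊤ := by
  have h : (RingQuot.mkAlgHom R (WeylRel R n)).range = ⊤ :=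
    (AlgHom.range_eq_top _).2 (RingQuot.mkAlgHom_surjective R _)
  rw [← h, ← Algebra.map_top, ← FreeAlgebra.adjoin_range_ι, AlgHom.map_adjoin, ← Set.range_comp]
  rfl

/-- Elements of the Weyl algebra are built from scalars by addition and left multiplication
by generators. -/
theorem induction_left {C : WeylAlgebra R n → Prop}
    (h1 : C 1) (hadd : ∀ a b, C a → C b → C (a + b)) (hsmul : ∀ (r : R) a, C a → C (r • a))
    (hmul : ∀ i a, C a → C (gen R i * a)) (a : WeylAlgebra R n) : C a := by
  have ha : a ∈ Algebra.adjoin R (Set.range (gen R (n := n))) := by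
    rw [adjoin_range_gen]; trivial
  suffices ∀ b, C b → C (a * b) by simpa using this 1 h1
  induction ha using Algebra.adjoin_induction with
  | mem x hx => obtain ⟨i, rfl⟩ := hx; exact hmul i
  | algebraMap r => intro b hb; rw [← Algebra.smul_def]; exact hsmul r b hb
  | add x y _ _ hx hy => intro b hb; rw [add_mul]; exact hadd _ _ (hx b hb) (hy b hb)
  | mul x y _ _ hx hy => intro b hb; rw [mul_assoc]; exact hx _ (hy _ hb)

/-- The operators on `R[x, y]` through which the generators act: `xᵢ` by multiplication and `∂ᵢ`
by `∂/∂xᵢ + yᵢ`. -/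
noncomputable def symbolOp (R : Type*) [CommRing R] {n : ℕ} :
    Fin n ⊕ Fin n → Module.End R (MvPolynomial (Fin n ⊕ Fin n) R)
  | .inl i => LinearMap.mulLeft R (X (.inl i))
  | .inr i => (pderiv (.inl i)).toLinearMap + LinearMap.mulLeft R (X (.inr i))

/-- The summand y_i records the powers of ∂_i, so that acting on 1 recovers every coefficient over
any ring. The action on R[x] alone would lose them in characteristic p, where ∂_i^p acts as zero. -/
theorem symbolOp_isWeylSystem : IsWeylSystem R (symbolOp R (n := n)) := by
  have key : ∀ i j : Fin n, symbolOp R (.inr i) * symbolOp R (.inl j)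
      - symbolOp R (.inl j) * symbolOp R (.inr i)
      = algebraMap R (Module.End R (MvPolynomial (Fin n ⊕ Fin n) R)) (if i = j then 1 else 0) := by
    intro i j
    refine LinearMap.ext fun P => ?_
    simp only [symbolOp, LinearMap.sub_apply, Module.End.mul_apply, LinearMap.add_apply,
      LinearMap.mulLeft_apply, Derivation.coeFn_coe, pderiv_mul, Module.algebraMap_end_apply,
      pderiv_X, Pi.single_apply, Sum.inl.injEq]
    by_cases h : i = j
    · simp only [h, if_true, one_smul]; ring
    · simp only [h, Ne.symm h, if_false, zero_smul]; ring
  rintro (i | i) (j | j)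
  · refine LinearMap.ext fun P => ?_
    simp only [symbolOp, LinearMap.sub_apply, Module.End.mul_apply, LinearMap.mulLeft_apply,
      weylForm, map_zero, LinearMap.zero_apply]
    ring
  · rw [← neg_sub, key]
    simp only [weylForm, eq_comm]
    split_ifs <;> simp
  · exact key i j
  · refine LinearMap.ext fun P => ?_
    have hc : pderiv (Sum.inl i) (pderiv (Sum.inl j) P)
        = pderiv (Sum.inl j) (pderiv (Sum.inl i) P) := pderiv_comm _ _ _
    simp only [symbolOp, LinearMap.sub_apply, Module.End.mul_apply, LinearMap.add_apply,
      LinearMap.mulLeft_apply, Derivation.coeFn_coe, pderiv_mul, weylForm, map_zero,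
      LinearMap.zero_apply, map_add, hc, ne_eq, reduceCtorEq, not_false_eq_true,
      pderiv_X_of_ne]
    ring

/-- The action of the Weyl algebra on `R[x, y]`. -/
noncomputable def symbolRep (R : Type*) [CommRing R] (n : ℕ) :
    WeylAlgebra R n →ₐ[R] Module.End R (MvPolynomial (Fin n ⊕ Fin n) R) :=
  (exists_lift (symbolOp_isWeylSystem (R := R) (n := n))).choose

theorem symbolRep_gen (a : Fin n ⊕ Fin n) : symbolRep R n (gen R a) = symbolOp R a :=
  (exists_lift (symbolOp_isWeylSystem (R := R) (n := n))).choose_spec a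

/-- The symbol of an element of the Weyl algebra, with the `∂`s written on the right. -/
noncomputable def symbolLin (R : Type*) [CommRing R] (n : ℕ) :
    WeylAlgebra R n →ₗ[R] MvPolynomial (Fin n ⊕ Fin n) R :=
  (LinearMap.applyₗ (1 : MvPolynomial (Fin n ⊕ Fin n) R)).comp (symbolRep R n).toLinearMap

theorem symbolLin_apply (a : WeylAlgebra R n) : symbolLin R n a = symbolRep R n a 1 := rfl

/-- Since ∂_i sends 1 to y_i, this linearity over R[y] turns right multiplication by ∂_i into
multiplication of the symbol by y_i. -/
theorem symbolRep_mul_y (a : WeylAlgebra R n) (i : Fin n) (P : MvPolynomial (Fin n ⊕ Fin n) R) :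
    symbolRep R n a (X (.inr i) * P) = X (.inr i) * symbolRep R n a P := by
  induction a using induction_left generalizing P with
  | h1 => simp
  | hadd a b ha hb => simp [ha, hb, mul_add]
  | hsmul r a ha => simp [ha]
  | hmul j a ha =>
    rw [_root_.map_mul (symbolRep R n), Module.End.mul_apply, ha, symbolRep_gen,
      Module.End.mul_apply]
    rcases j with j | j
    · simp only [symbolOp, LinearMap.mulLeft_apply]; ring
    · simp only [symbolOp, LinearMap.mulLeft_apply, LinearMap.add_apply, Derivation.coeFn_coe,
        pderiv_mul, ne_eq, reduceCtorEq, not_false_eq_true, pderiv_X_of_ne]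
      ring

theorem symbolLin_x_mul (i : Fin n) (a : WeylAlgebra R n) :
    symbolLin R n (gen R (.inl i) * a) = X (.inl i) * symbolLin R n a := by
  simp [symbolLin_apply, symbolRep_gen, symbolOp]

theorem symbolLin_d_mul (i : Fin n) (a : WeylAlgebra R n) :
    symbolLin R n (gen R (.inr i) * a)
      = pderiv (.inl i) (symbolLin R n a) + X (.inr i) * symbolLin R n a := by
  simp [symbolLin_apply, symbolRep_gen, symbolOp]

theorem symbolLin_mul_d (i : Fin n) (a : WeylAlgebra R n) :
    symbolLin R n (a * gen R (.inr i)) = X (.inr i) * symbolLin R n a := by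
  have h : symbolRep R n (gen R (.inr i)) 1 = X (.inr i) * 1 := by
    simp [symbolRep_gen, symbolOp]
  rw [symbolLin_apply, map_mul, Module.End.mul_apply, h, symbolRep_mul_y, symbolLin_apply]

/-- Quantization: a linear map inverse to the symbol. -/
theorem exists_quantization (R : Type*) [CommRing R] (n : ℕ) :
    ∃ q : MvPolynomial (Fin n ⊕ Fin n) R →ₗ[R] WeylAlgebra R n, q 1 = 1 ∧
      (∀ i P, q (X (.inl i) * P) = gen R (.inl i) * q P) ∧
      (∀ i P, q (X (.inr i) * P) = q P * gen R (.inr i)) := by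
  obtain ⟨f, hf⟩ := exists_algHom_of_commute (R := R)
    (Sum.elim (fun i => LinearMap.mulLeft R (gen R (Sum.inl i : Fin n ⊕ Fin n)))
      (fun i => LinearMap.mulRight R (gen R (Sum.inr i : Fin n ⊕ Fin n)))) (by
    rintro (i | i) (j | j)
    · have h := gen_isWeylSystem (R := R) (n := n) (.inl i) (.inl j)
      simp only [weylForm, map_zero, sub_eq_zero] at h
      refine LinearMap.ext fun a => ?_
      simp [← mul_assoc, h]
    · refine LinearMap.ext fun a => ?_
      simp [mul_assoc]
    · refine LinearMap.ext fun a => ?_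
      simp [mul_assoc]
    · have h := gen_isWeylSystem (R := R) (n := n) (.inr i) (.inr j)
      simp only [weylForm, map_zero, sub_eq_zero] at h
      refine LinearMap.ext fun a => ?_
      simp [mul_assoc, h])
  refine ⟨(LinearMap.applyₗ (1 : WeylAlgebra R n)).comp f.toLinearMap, by simp, ?_, ?_⟩
  · intro i P; simp [hf]
  · intro i P; simp [hf]

/-- The symbol map as a linear equivalence. -/
theorem exists_symbol_equiv (R : Type*) [CommRing R] (n : ℕ) :
    ∃ e : WeylAlgebra R n ≃ₗ[R] MvPolynomial (Fin n ⊕ Fin n) R, ∀ a, e a = symbolLin R n a := by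
  obtain ⟨q, q1, qx, qy⟩ := exists_quantization R n
  -- Normal ordering: moving ∂_i past the x's costs one derivative. It is what makes the image of
  -- `q` stable under left multiplication by ∂_i, as `hq2` requires.
  have hd : ∀ (i : Fin n) P, gen R (.inr i) * q P = q (pderiv (.inl i) P + X (.inr i) * P) := by
    intro i P
    induction P using MvPolynomial.induction_on with
    | C a =>
      have h : q (C a) = algebraMap R _ a := by
        rw [← mul_one (C a), ← MvPolynomial.smul_eq_C_mul, map_smul, q1,
          Algebra.algebraMap_eq_smul_one]
      rw [pderiv_C, zero_add, qy, h, Algebra.commutes]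
    | add P Q hP hQ => rw [map_add, mul_add, hP, hQ, ← map_add]; congr 1; rw [map_add]; ring
    | mul_X P j hP =>
      rcases j with j | j
      · have h := gen_isWeylSystem (R := R) (n := n) (.inr i) (.inl j)
        rw [sub_eq_iff_eq_add] at h
        rw [mul_comm P, qx, ← mul_assoc, h, add_mul, mul_assoc, hP, ← qx, ← Algebra.smul_def,
          ← map_smul, ← map_add]
        congr 1
        simp only [weylForm, pderiv_mul, pderiv_X, Pi.single_apply, Sum.inl.injEq]
        by_cases h : i = j
        · simp only [h, if_true, one_smul]; ring
        · simp only [h, Ne.symm h, if_false, zero_smul]; ring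
      · rw [mul_comm P, qy, ← mul_assoc, hP, ← qy]
        congr 1
        simp only [pderiv_mul, ne_eq, reduceCtorEq, not_false_eq_true, pderiv_X_of_ne]
        ring
  have hq1 : ∀ P, symbolLin R n (q P) = P := by
    intro P
    induction P using MvPolynomial.induction_on with
    | C a =>
      rw [← mul_one (C a), ← MvPolynomial.smul_eq_C_mul, map_smul, q1, map_smul]
      simp [symbolLin_apply]
    | add P Q hP hQ => simp [hP, hQ]
    | mul_X P j hP =>
      rw [mul_comm P]
      rcases j with j | j
      · rw [qx, symbolLin_x_mul, hP]
      · rw [qy, symbolLin_mul_d, hP]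
  have hq2 : ∀ a, q (symbolLin R n a) = a := by
    intro a
    induction a using induction_left with
    | h1 => simp [symbolLin_apply, q1]
    | hadd a b ha hb => simp [ha, hb]
    | hsmul r a ha => simp [ha]
    | hmul j a ha =>
      rcases j with j | j
      · rw [symbolLin_x_mul, qx, ha]
      · rw [symbolLin_d_mul, ← hd, ha]
  exact ⟨{ symbolLin R n with invFun := q, left_inv := hq2, right_inv := hq1 }, fun _ => rfl⟩

/-- The symbol map as a linear equivalence: `x^α ∂^β ↦ x^α y^β`. -/
noncomputable def symbol (R : Type*) [CommRing R] (n : ℕ) :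
    WeylAlgebra R n ≃ₗ[R] MvPolynomial (Fin n ⊕ Fin n) R :=
  (exists_symbol_equiv R n).choose

theorem symbol_apply (a : WeylAlgebra R n) : symbol R n a = symbolLin R n a :=
  (exists_symbol_equiv R n).choose_spec a

@[simp] theorem symbol_one : symbol R n 1 = 1 := by
  simp [symbol_apply, symbolLin_apply]

@[simp] theorem symbol_x_mul (i : Fin n) (a : WeylAlgebra R n) :
    symbol R n (gen R (.inl i) * a) = X (.inl i) * symbol R n a := by
  simp [symbol_apply, symbolLin_x_mul]

theorem symbol_d_mul (i : Fin n) (a : WeylAlgebra R n) :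
    symbol R n (gen R (.inr i) * a) = pderiv (.inl i) (symbol R n a) + X (.inr i) * symbol R n a := by
  simp [symbol_apply, symbolLin_d_mul]

@[simp] theorem symbol_mul_d (i : Fin n) (a : WeylAlgebra R n) :
    symbol R n (a * gen R (.inr i)) = X (.inr i) * symbol R n a := by
  simp [symbol_apply, symbolLin_mul_d]

@[simp] theorem symbol_algebraMap (r : R) : symbol R n (algebraMap R _ r) = C r := by
  rw [Algebra.algebraMap_eq_smul_one, map_smul, symbol_one, MvPolynomial.smul_eq_C_mul, mul_one]

@[simp] theorem symbol_gen (a : Fin n ⊕ Fin n) : symbol R n (gen R a) = X a := by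
  rcases a with i | i
  · simpa using symbol_x_mul (R := R) i 1
  · simpa using symbol_mul_d (R := R) i 1

/-- Induction along symbols: left multiplication by `x`s, right multiplication by `∂`s. -/
theorem induction_symbol {C : WeylAlgebra R n → Prop}
    (h1 : ∀ r : R, C (algebraMap R _ r)) (hadd : ∀ a b, C a → C b → C (a + b))
    (hx : ∀ i a, C a → C (gen R (.inl i) * a)) (hd : ∀ i a, C a → C (a * gen R (.inr i)))
    (a : WeylAlgebra R n) : C a := by
  obtain ⟨P, rfl⟩ := (symbol R n).symm.surjective a
  induction P using MvPolynomial.induction_on with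
  | C r =>
    rw [← symbol_algebraMap, LinearEquiv.symm_apply_apply]; exact h1 r
  | add P Q hP hQ => rw [map_add]; exact hadd _ _ hP hQ
  | mul_X P j hP =>
    rw [mul_comm]
    rcases j with j | j
    · have : (symbol R n).symm (X (.inl j) * P) = gen R (.inl j) * (symbol R n).symm P := by
        rw [LinearEquiv.symm_apply_eq, symbol_x_mul, LinearEquiv.apply_symm_apply]
      rw [this]; exact hx _ _ hP
    · have : (symbol R n).symm (X (.inr j) * P) = (symbol R n).symm P * gen R (.inr j) := by
        rw [LinearEquiv.symm_apply_eq, symbol_mul_d, LinearEquiv.apply_symm_apply]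
      rw [this]; exact hd _ _ hP

theorem symbol_mul_x (i : Fin n) (a : WeylAlgebra R n) :
    symbol R n (a * gen R (.inl i)) = pderiv (.inr i) (symbol R n a) + X (.inl i) * symbol R n a := by
  induction a using induction_symbol with
  | h1 r => simp [← Algebra.smul_def, MvPolynomial.smul_eq_C_mul, mul_comm]
  | hadd a b ha hb => simp only [add_mul, map_add, ha, hb]; ring
  | hx j a ha =>
    rw [mul_assoc, symbol_x_mul, ha, symbol_x_mul, pderiv_mul, pderiv_X_of_ne (by simp)]
    ring
  | hd j a ha =>
    have h := gen_isWeylSystem (R := R) (n := n) (.inr j) (.inl i)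
    rw [sub_eq_iff_eq_add] at h
    rw [mul_assoc, h, mul_add, ← mul_assoc, map_add, symbol_mul_d, ha, symbol_mul_d,
      ← Algebra.commutes, ← Algebra.smul_def, map_smul]
    simp only [weylForm, pderiv_mul, pderiv_X, Pi.single_apply, Sum.inr.injEq]
    by_cases h : i = j
    · simp only [h, if_true, one_smul]; ring
    · simp only [Ne.symm h, if_false, zero_smul]; ring

/-- Commutators with generators act on symbols as partial derivatives. -/
theorem symbol_commutator_d (i : Fin n) (a : WeylAlgebra R n) :
    symbol R n (gen R (.inr i) * a - a * gen R (.inr i)) = pderiv (.inl i) (symbol R n a) := by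
  rw [map_sub, symbol_d_mul, symbol_mul_d]; ring

theorem symbol_commutator_x (i : Fin n) (a : WeylAlgebra R n) :
    symbol R n (a * gen R (.inl i) - gen R (.inl i) * a) = pderiv (.inr i) (symbol R n a) := by
  rw [map_sub, symbol_mul_x, symbol_x_mul]; ring

section Map

variable {S : Type*} [CommRing S]

theorem exists_map (f : R →+* S) (n : ℕ) : ∃ F : WeylAlgebra R n →+* WeylAlgebra S n,
    (∀ r, F (algebraMap R _ r) = algebraMap S _ (f r)) ∧ ∀ a, F (gen R a) = gen S a := by
  let _ : Algebra R (WeylAlgebra S n) :=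
    ((algebraMap S (WeylAlgebra S n)).comp f).toAlgebra' fun r a => Algebra.commutes (f r) a
  obtain ⟨F, hF⟩ := exists_lift (R := R) (g := (gen S : _ → WeylAlgebra S n)) (by
    intro a b
    rw [gen_isWeylSystem, ← map_weylForm f]
    rfl)
  exact ⟨F.toRingHom, fun r => F.commutes r, hF⟩

/-- Functoriality of the Weyl algebra in the scalars. -/
noncomputable def map (f : R →+* S) (n : ℕ) : WeylAlgebra R n →+* WeylAlgebra S n :=
  (exists_map f n).choose

@[simp] theorem map_algebraMap (f : R →+* S) (r : R) :
    map f n (algebraMap R _ r) = algebraMap S _ (f r) := (exists_map f n).choose_spec.1 r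

@[simp] theorem map_gen (f : R →+* S) (a : Fin n ⊕ Fin n) : map f n (gen R a) = gen S a :=
  (exists_map f n).choose_spec.2 a

theorem symbol_map (f : R →+* S) (a : WeylAlgebra R n) :
    symbol S n (map f n a) = MvPolynomial.map f (symbol R n a) := by
  induction a using induction_symbol with
  | h1 r => simp
  | hadd a b ha hb => simp [ha, hb]
  | hx i a ha => simp [ha]
  | hd i a ha => simp [ha]

theorem map_injective (f : R →+* S) (hf : Function.Injective f) :
    Function.Injective (map f n) := fun a b h => by
  apply (symbol R n).injective
  apply MvPolynomial.map_injective f hf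
  rw [← symbol_map, ← symbol_map, h]

theorem map_surjective (f : R →+* S) (hf : Function.Surjective f) :
    Function.Surjective (map f n) := fun b => by
  obtain ⟨P, hP⟩ := MvPolynomial.map_surjective f hf (symbol S n b)
  refine ⟨(symbol R n).symm P, (symbol S n).injective ?_⟩
  rw [symbol_map, LinearEquiv.apply_symm_apply, hP]

end Map

end WeylAlgebra
end WeylAlgebraBasics

/-! ### The degree filtration on symbols; absence of zero divisors and simplicity -/

section Degree

theorem MvPolynomial.totalDegree_le_iff_coeff {R ι : Type*} [CommSemiring R]
    (P : MvPolynomial ι R) (N : ℕ) :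
    P.totalDegree ≤ N ↔ ∀ m : ι →₀ ℕ, N < m.degree → coeff m P = 0 := by
  constructor
  · intro h m hm
    exact coeff_eq_zero_of_totalDegree_lt (by
      rw [← Finsupp.degree_apply]; omega)
  · intro h
    refine Finset.sup_le fun m hm => ?_
    by_contra hlt
    exact (mem_support_iff.1 hm) (h m (by
      rw [Finsupp.degree_apply]; simpa [Finsupp.sum] using hlt))

theorem MvPolynomial.totalDegree_pderiv_le {R ι : Type*} [CommSemiring R] (i : ι)
    (P : MvPolynomial ι R) (N : ℕ) (h : P.totalDegree ≤ N + 1) :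
    (pderiv i P).totalDegree ≤ N := by
  rw [totalDegree_le_iff_coeff] at h ⊢
  intro m hm
  rw [coeff_pderiv, h, zero_mul]
  simpa using hm

theorem MvPolynomial.eq_C_of_pderiv_eq_zero {R ι : Type*} [CommRing R] [IsDomain R] [CharZero R]
    (P : MvPolynomial ι R) (h : ∀ i, pderiv i P = 0) : ∃ c, P = C c := by
  classical
  refine ⟨coeff 0 P, MvPolynomial.ext _ _ fun m => ?_⟩
  rw [coeff_C]
  split_ifs with hm
  · rw [hm]
  · obtain ⟨i, hi⟩ : ∃ i, m i ≠ 0 := by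
      by_contra hcon
      push Not at hcon
      exact hm (Finsupp.ext fun i => (hcon i).symm)
    have hle : Finsupp.single i 1 ≤ m := by
      rw [Finsupp.single_le_iff]; omega
    have := congrArg (coeff (m - Finsupp.single i 1)) (h i)
    rw [coeff_pderiv, tsub_add_cancel_of_le hle, coeff_zero, mul_eq_zero] at this
    rcases this with h1 | h1
    · exact h1
    · exact absurd h1 (Nat.cast_add_one_ne_zero _)

/-- All monomials of `P` have degree less than `N`. -/
def MvPolynomial.DegLT {R ι : Type*} [CommSemiring R] (N : ℕ) (P : MvPolynomial ι R) : Prop :=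
  ∀ m : ι →₀ ℕ, N ≤ m.degree → coeff m P = 0

namespace MvPolynomial.DegLT

variable {R ι : Type*} [CommRing R] {N M : ℕ} {P Q : MvPolynomial ι R}

theorem of_totalDegree_le (h : P.totalDegree ≤ N) : DegLT (N + 1) P :=
  fun m hm => (totalDegree_le_iff_coeff P N).1 h m hm

theorem mono (h : DegLT N P) (hNM : N ≤ M) : DegLT M P := fun m hm => h m (hNM.trans hm)

theorem add (hP : DegLT N P) (hQ : DegLT N Q) : DegLT N (P + Q) := fun m hm => by
  rw [coeff_add, hP m hm, hQ m hm, add_zero]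

theorem totalDegree_le (h : DegLT (N + 1) P) : P.totalDegree ≤ N :=
  (totalDegree_le_iff_coeff P N).2 fun m hm => h m hm

theorem X_mul (i : ι) (h : DegLT N P) : DegLT (N + 1) (X i * P) := by
  classical
  intro m hm
  rw [coeff_X_mul']
  split_ifs with hi
  · refine h _ ?_
    have hle : Finsupp.single i 1 ≤ m := by
      rw [Finsupp.single_le_iff]
      exact Nat.one_le_iff_ne_zero.2 (Finsupp.mem_support_iff.1 hi)
    have := congrArg Finsupp.degree (tsub_add_cancel_of_le hle)
    rw [map_add, Finsupp.degree_single] at this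
    omega
  · rfl

theorem pderiv (i : ι) (h : DegLT (N + 1) P) : DegLT N (pderiv i P) := by
  intro m hm
  rw [coeff_pderiv, h, zero_mul]
  simpa using hm

theorem monomial_mul (m : ι →₀ ℕ) (r : R) (h : DegLT N P) :
    DegLT (m.degree + N) (monomial m r * P) := by
  classical
  intro k hk
  rw [coeff_monomial_mul']
  split_ifs with hle
  · rw [h _, mul_zero]
    have := congrArg Finsupp.degree (tsub_add_cancel_of_le hle)
    rw [map_add] at this
    omega
  · rfl

end MvPolynomial.DegLT

namespace WeylAlgebra

section SymbolProduct

variable {R : Type*} [CommRing R] {n : ℕ}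

theorem symbol_symm_X_inl_mul (i : Fin n) (P : MvPolynomial (Fin n ⊕ Fin n) R) :
    (symbol R n).symm (X (.inl i) * P) = gen R (.inl i) * (symbol R n).symm P := by
  rw [LinearEquiv.symm_apply_eq, symbol_x_mul, LinearEquiv.apply_symm_apply]

theorem symbol_symm_X_inr_mul (i : Fin n) (P : MvPolynomial (Fin n ⊕ Fin n) R) :
    (symbol R n).symm (X (.inr i) * P) = (symbol R n).symm P * gen R (.inr i) := by
  rw [LinearEquiv.symm_apply_eq, symbol_mul_d, LinearEquiv.apply_symm_apply]

/-- Peel one variable off the monomial. An x_i comes out on the left without error; a ∂_i is passed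
on to `b`, which raises the degree of its symbol by at most one and leaves a derivative as error. -/
theorem symbol_monomial_mul_sub (m : (Fin n ⊕ Fin n) →₀ ℕ) (r : R) (E : ℕ) (b : WeylAlgebra R n)
    (hb : DegLT (E + 1) (symbol R n b)) :
    DegLT (m.degree + E)
      (symbol R n ((symbol R n).symm (monomial m r) * b) - monomial m r * symbol R n b) := by
  induction hk : m.degree generalizing m E b with
  | zero =>
    obtain rfl : m = 0 := (Finsupp.degree_eq_zero_iff m).1 hk
    have : (symbol R n).symm (monomial 0 r) = algebraMap R _ r := by
      rw [LinearEquiv.symm_apply_eq, symbol_algebraMap]; rfl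
    rw [this, ← Algebra.smul_def, map_smul, MvPolynomial.smul_eq_C_mul]
    intro k _
    rw [show (monomial (0 : (Fin n ⊕ Fin n) →₀ ℕ)) r = C r from rfl, sub_self, coeff_zero]
  | succ k ih =>
    obtain ⟨i, hi⟩ : ∃ i, m i ≠ 0 := by
      by_contra hcon
      push Not at hcon
      have : m = 0 := Finsupp.ext hcon
      simp [this] at hk
    have hle : Finsupp.single i 1 ≤ m := by
      rw [Finsupp.single_le_iff]; omega
    set m' := m - Finsupp.single i 1 with hm'
    have hm : m = Finsupp.single i 1 + m' := (add_tsub_cancel_of_le hle).symm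
    have hk' : m'.degree = k := by
      rw [hm, map_add, Finsupp.degree_single] at hk; omega
    have hmon : monomial m r = X i * monomial m' r := by
      rw [hm, X, monomial_mul, one_mul]
    rw [hmon]
    rcases i with i | i
    · rw [symbol_symm_X_inl_mul, mul_assoc (gen R _), symbol_x_mul, mul_assoc, ← mul_sub]
      have := (ih m' E b hb hk').X_mul (.inl i)
      exact this.mono (by omega)
    · rw [symbol_symm_X_inr_mul, mul_assoc]
      have hb' : DegLT (E + 1 + 1) (symbol R n (gen R (.inr i) * b)) := by
        rw [symbol_d_mul]
        exact ((hb.pderiv _).mono (by omega)).add (hb.X_mul _)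
      have h1 := ih m' (E + 1) _ hb' hk'
      have h2 : DegLT (k + (E + 1)) (monomial m' r * pderiv (.inl i) (symbol R n b)) := by
        have := (hb.pderiv (.inl i)).monomial_mul m' r
        exact this.mono (by omega)
      have h3 := (h1.add h2).mono (show k + (E + 1) ≤ k + 1 + E by omega)
      rw [symbol_d_mul] at h3
      convert h3 using 1
      ring

/-- The symbol of a product is the product of the symbols up to terms of lower degree. -/
theorem symbol_mul_sub {D E : ℕ} {a b : WeylAlgebra R n} (ha : (symbol R n a).totalDegree ≤ D)
    (hb : (symbol R n b).totalDegree ≤ E) :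
    DegLT (D + E) (symbol R n (a * b) - symbol R n a * symbol R n b) := by
  have hsum : symbol R n (a * b) - symbol R n a * symbol R n b
      = ∑ m ∈ (symbol R n a).support,
        (symbol R n ((symbol R n).symm (monomial m (coeff m (symbol R n a))) * b)
          - monomial m (coeff m (symbol R n a)) * symbol R n b) := by
    rw [Finset.sum_sub_distrib, ← Finset.sum_mul, support_sum_monomial_coeff, ← map_sum,
      ← Finset.sum_mul, ← map_sum, support_sum_monomial_coeff, LinearEquiv.symm_apply_apply]
  rw [hsum]
  intro k hk
  rw [coeff_sum]
  refine Finset.sum_eq_zero fun m hm => ?_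
  refine symbol_monomial_mul_sub m _ E b (DegLT.of_totalDegree_le hb) k (le_trans ?_ hk)
  have := le_totalDegree hm
  rw [Finsupp.degree_apply]
  simp only [Finsupp.sum] at this
  omega

/-- The error in `symbol_mul_sub` lies strictly below the top degree of the product of the symbols.
Strictness is stated with `DegLT` so that in degree 0 it still says something, namely that the error
vanishes. -/
theorem totalDegree_symbol_mul [IsDomain R] {a b : WeylAlgebra R n} (ha : a ≠ 0) (hb : b ≠ 0) :
    (symbol R n (a * b)).totalDegree
      = (symbol R n a).totalDegree + (symbol R n b).totalDegree := by
  have ha' : symbol R n a ≠ 0 := by simpa using ha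
  have hb' : symbol R n b ≠ 0 := by simpa using hb
  have hd := totalDegree_mul_of_isDomain ha' hb'
  have hlow := symbol_mul_sub (le_refl (symbol R n a).totalDegree)
    (le_refl (symbol R n b).totalDegree)
  rw [← hd] at hlow ⊢
  set P := symbol R n a * symbol R n b
  obtain ⟨Q, hQ⟩ : ∃ Q, Q = symbol R n (a * b) - P := ⟨_, rfl⟩
  rw [← hQ] at hlow
  rw [show symbol R n (a * b) = P + Q by rw [hQ]; ring]
  rcases Nat.eq_zero_or_pos P.totalDegree with h0 | h0
  · have : Q = 0 := MvPolynomial.ext _ _ fun m => hlow m (by omega)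
    rw [this, add_zero]
  · obtain ⟨N, hN⟩ := Nat.exists_eq_succ_of_ne_zero h0.ne'
    rw [totalDegree_add_eq_left_of_totalDegree_lt]
    rw [hN] at hlow ⊢
    exact Nat.lt_succ_of_le hlow.totalDegree_le

theorem mul_ne_zero [IsDomain R] {a b : WeylAlgebra R n} (ha : a ≠ 0) (hb : b ≠ 0) :
    a * b ≠ 0 := by
  intro hab
  have ha' : symbol R n a ≠ 0 := by simpa using ha
  have hb' : symbol R n b ≠ 0 := by simpa using hb
  have hd := totalDegree_mul_of_isDomain ha' hb'
  have hlow := symbol_mul_sub (le_refl (symbol R n a).totalDegree)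
    (le_refl (symbol R n b).totalDegree)
  rw [hab, map_zero, zero_sub, ← hd] at hlow
  have hP := _root_.mul_ne_zero ha' hb'
  obtain ⟨m, hm, hmd⟩ := Finset.exists_mem_eq_sup _ (support_nonempty.2 hP) fun m => m.degree
  refine (mem_support_iff.1 hm) ?_
  have := hlow m (le_of_eq ?_)
  · simpa using this
  · rw [← hmd]
    rfl

theorem totalDegree_symbol_pow [IsDomain R] (a : WeylAlgebra R n) (k : ℕ) (hk : k ≠ 0) :
    (symbol R n (a ^ k)).totalDegree = k * (symbol R n a).totalDegree := by
  by_cases ha : a = 0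
  · simp [ha, hk]
  have key : ∀ k : ℕ, a ^ k ≠ 0 ∧
      (symbol R n (a ^ k)).totalDegree = k * (symbol R n a).totalDegree := by
    intro k
    induction k with
    | zero =>
      refine ⟨?_, by simp⟩
      rw [pow_zero]
      intro h
      have := symbol_one (R := R) (n := n)
      rw [h, map_zero] at this
      exact zero_ne_one this
    | succ k ih =>
      refine ⟨by rw [pow_succ]; exact mul_ne_zero ih.1 ha, ?_⟩
      rw [pow_succ, totalDegree_symbol_mul ih.1 ha, ih.2]; ring
  exact (key k).2

end SymbolProduct
/-- The Weyl algebra in characteristic zero is simple: nonzero homomorphisms are injective. -/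
theorem algHom_injective {K A : Type*} [Field K] [CharZero K] [Ring A] [Nontrivial A] [Algebra K A]
    {n : ℕ} (f : WeylAlgebra K n →ₐ[K] A) : Function.Injective f := by
  rw [injective_iff_map_eq_zero]
  -- Commutators with generators stay in the kernel and differentiate the symbol, lowering its
  -- degree. The induction ends at scalars, on which `f` is injective.
  have key : ∀ N, ∀ a : WeylAlgebra K n, (symbol K n a).totalDegree ≤ N → f a = 0 → a = 0 := by
    have fin : ∀ a : WeylAlgebra K n, (∀ i, pderiv i (symbol K n a) = 0) → f a = 0 → a = 0 := by
      intro a ha hfa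
      obtain ⟨c, hc⟩ := eq_C_of_pderiv_eq_zero _ ha
      rw [← symbol_algebraMap] at hc
      have hac := (symbol K n).injective hc
      rw [hac, AlgHom.commutes, FaithfulSMul.algebraMap_eq_zero_iff] at hfa
      rw [hac, hfa, map_zero]
    intro N
    induction N with
    | zero =>
      intro a ha hfa
      refine fin a (fun i => ?_) hfa
      rw [(totalDegree_eq_zero_iff_eq_C).1 (Nat.le_zero.1 ha), pderiv_C]
    | succ N ih =>
      intro a ha hfa
      refine fin a (fun i => ?_) hfa
      rcases i with i | i
      · rw [← symbol_commutator_d, ih (gen K (.inr i) * a - a * gen K (.inr i)), map_zero]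
        · rw [symbol_commutator_d]
          exact totalDegree_pderiv_le _ _ _ ha
        · simp [hfa]
      · rw [← symbol_commutator_x, ih (a * gen K (.inl i) - gen K (.inl i) * a), map_zero]
        · rw [symbol_commutator_x]
          exact totalDegree_pderiv_le _ _ _ ha
        · simp [hfa]
  exact fun a => key _ a le_rfl

end WeylAlgebra
end Degree

/-! ### Poisson endomorphisms: JC_{2n} ⇒ PC_{2n} and PC_{2n} ⇒ JC_n -/

section Poisson

variable {K : Type*} [Field K] {n : ℕ}

theorem poissonBracket_eq_sum (f g : MvPolynomial (Fin n ⊕ Fin n) K) :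
    poissonBracket f g = ∑ a, ∑ b, C (weylForm K a b) * pderiv a f * pderiv b g := by
  simp only [poissonBracket, Fintype.sum_sum_type, weylForm, map_zero, zero_mul,
    Finset.sum_const_zero, zero_add, add_zero, apply_ite C, ite_mul, map_one, map_neg, one_mul,
    neg_mul, Finset.sum_ite_eq, Finset.mem_univ, if_true]
  rw [Finset.sum_sub_distrib, Finset.sum_neg_distrib]
  ring

theorem poissonBracket_X_X (a b : Fin n ⊕ Fin n) :
    poissonBracket (X a) (X b) = C (weylForm K a b) := by
  rw [poissonBracket_eq_sum, Finset.sum_eq_single a, Finset.sum_eq_single b]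
  · simp
  · intro c _ hc; simp [pderiv_X_of_ne hc.symm]
  · simp
  · intro c _ hc
    refine Finset.sum_eq_zero fun d _ => ?_
    simp [pderiv_X_of_ne hc.symm]
  · simp

theorem poissonBracket_add_right (f g h : MvPolynomial (Fin n ⊕ Fin n) K) :
    poissonBracket f (g + h) = poissonBracket f g + poissonBracket f h := by
  simp only [poissonBracket, map_add, mul_add, ← Finset.sum_add_distrib]
  exact Finset.sum_congr rfl fun _ _ => by ring

theorem poissonBracket_mul_right (f g h : MvPolynomial (Fin n ⊕ Fin n) K) :
    poissonBracket f (g * h) = poissonBracket f g * h + g * poissonBracket f h := by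
  simp only [poissonBracket, pderiv_mul, Finset.sum_mul, Finset.mul_sum, ← Finset.sum_add_distrib]
  exact Finset.sum_congr rfl fun _ _ => by ring

theorem poissonBracket_swap (f g : MvPolynomial (Fin n ⊕ Fin n) K) :
    poissonBracket g f = - poissonBracket f g := by
  simp only [poissonBracket, ← Finset.sum_neg_distrib]
  exact Finset.sum_congr rfl fun _ _ => by ring

theorem poissonBracket_C_right (f : MvPolynomial (Fin n ⊕ Fin n) K) (c : K) :
    poissonBracket f (C c) = 0 := by
  simp [poissonBracket]

theorem poissonBracket_algHom_right
    (σ : MvPolynomial (Fin n ⊕ Fin n) K →ₐ[K] MvPolynomial (Fin n ⊕ Fin n) K)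
    (P g : MvPolynomial (Fin n ⊕ Fin n) K) :
    poissonBracket P (σ g) = ∑ b, σ (pderiv b g) * poissonBracket P (σ (X b)) := by
  simp only [poissonBracket, pderiv_algHom_apply σ _ g, Finset.mul_sum, ← Finset.sum_sub_distrib]
  rw [Finset.sum_comm]
  exact Finset.sum_congr rfl fun b _ => Finset.sum_congr rfl fun i _ => by ring

theorem poissonBracket_algHom
    (σ : MvPolynomial (Fin n ⊕ Fin n) K →ₐ[K] MvPolynomial (Fin n ⊕ Fin n) K)
    (f g : MvPolynomial (Fin n ⊕ Fin n) K) :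
    poissonBracket (σ f) (σ g)
      = ∑ a, ∑ b, σ (pderiv a f) * σ (pderiv b g) * poissonBracket (σ (X a)) (σ (X b)) := by
  rw [poissonBracket_algHom_right, Finset.sum_comm]
  refine Finset.sum_congr rfl fun b _ => ?_
  rw [poissonBracket_swap, poissonBracket_algHom_right, ← Finset.sum_neg_distrib, Finset.mul_sum]
  refine Finset.sum_congr rfl fun a _ => ?_
  rw [poissonBracket_swap (σ (X a))]; ring

theorem mem_poissonEnd_of_generators
    (σ : MvPolynomial (Fin n ⊕ Fin n) K →ₐ[K] MvPolynomial (Fin n ⊕ Fin n) K)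
    (h : ∀ a b, poissonBracket (σ (X a)) (σ (X b)) = C (weylForm K a b)) : σ ∈ poissonEnd K n := by
  intro f g
  rw [poissonBracket_algHom, poissonBracket_eq_sum]
  simp only [map_sum, map_mul, h, MvPolynomial.algHom_C]
  refine Finset.sum_congr rfl fun a _ => Finset.sum_congr rfl fun b _ => ?_
  rw [MvPolynomial.algebraMap_eq]; ring

/-- The hypothesis says J Ω Jᵀ = Ω with Ω the invertible matrix of the bracket; take determinants.
The sign is left open, since a unit is all that is needed. -/
theorem det_jacobian_sq_eq_one
    (σ : MvPolynomial (Fin n ⊕ Fin n) K →ₐ[K] MvPolynomial (Fin n ⊕ Fin n) K)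
    (h : ∀ a b, poissonBracket (σ (X a)) (σ (X b)) = C (weylForm K a b)) :
    (jacobian σ).det ^ 2 = 1 := by
  let Ω : Matrix (Fin n ⊕ Fin n) (Fin n ⊕ Fin n) (MvPolynomial (Fin n ⊕ Fin n) K) :=
    Matrix.of fun a b => C (weylForm K a b)
  have hΩ : Ω = Matrix.fromBlocks 0 (-1) 1 0 := by
    ext1 a b
    rcases a with i | i <;> rcases b with j | j <;>
      simp [Ω, weylForm, Matrix.one_apply, apply_ite C]
    split_ifs <;> simp
  have hu : IsUnit Ω.det := by
    have hsq : Ω * (-Ω) = 1 := by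
      rw [hΩ, mul_neg, Matrix.fromBlocks_multiply]
      simp [Matrix.fromBlocks_neg, Matrix.fromBlocks_one]
    exact (Matrix.isUnit_iff_isUnit_det _).1 (IsUnit.of_mul_eq_one _ hsq)
  have hJ : jacobian σ * Ω * (jacobian σ).transpose = Ω := by
    ext1 a b
    refine Eq.trans ?_ (h a b)
    rw [poissonBracket_eq_sum]
    simp only [Matrix.mul_apply, Matrix.transpose_apply, Finset.sum_mul]
    rw [Finset.sum_comm]
    refine Finset.sum_congr rfl fun c _ => Finset.sum_congr rfl fun d _ => ?_
    simp only [jacobian, Matrix.of_apply, Ω]; ring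
  have := congrArg Matrix.det hJ
  rw [Matrix.det_mul, Matrix.det_mul, Matrix.det_transpose] at this
  apply hu.mul_right_cancel
  linear_combination this

theorem PoissonConjecture.of_jacobianConjecture (h : JacobianConjecture K (2 * n)) :
    PoissonConjecture K n := by
  intro σ
  have hgen : ∀ a b, poissonBracket (σ.1 (X a)) (σ.1 (X b)) = C (weylForm K a b) := by
    intro a b
    rw [← σ.2 (X a) (X b), poissonBracket_X_X, MvPolynomial.algHom_C, MvPolynomial.algebraMap_eq]
  have hs : Function.Surjective σ.1 := by
    refine h.surjective (by simp [two_mul]) σ.1 ?_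
    exact IsUnit.of_pow_eq_one (det_jacobian_sq_eq_one σ.1 hgen) two_ne_zero
  obtain ⟨u, hu⟩ := MvPolynomial.isUnit_algHom_of_surjective σ.1 hs
  have hinj := (AlgHom.bijective_of_isUnit σ.1 ⟨u, hu⟩).1
  have hinv : ∀ f, σ.1 ((↑u⁻¹ : _ →ₐ[K] _) f) = f := fun f => by
    rw [← hu]; exact DFunLike.congr_fun u.mul_inv f
  have hmem : (↑u⁻¹ : _ →ₐ[K] _) ∈ poissonEnd K n := by
    intro f g
    apply hinj
    rw [hinv, σ.2, hinv, hinv]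
  refine ⟨⟨σ, ⟨_, hmem⟩, Subtype.ext ?_, Subtype.ext ?_⟩, rfl⟩
  · change σ.1 * _ = 1
    rw [← hu]; exact u.mul_inv
  · change _ * σ.1 = 1
    rw [← hu]; exact u.inv_mul

theorem IsJacobianMap.exists_inverse_matrix
    {σ : MvPolynomial (Fin n) K →ₐ[K] MvPolynomial (Fin n) K} (hσ : IsJacobianMap σ) :
    ∃ N, Matrix.of (fun i j => pderiv j (σ (X i))) * N = 1 := by
  obtain ⟨c, hc, h⟩ := hσ
  have hu : IsUnit (jacobianMatrix σ).det := by
    rw [h]; exact (isUnit_iff_ne_zero.2 hc).map C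
  exact ⟨(jacobianMatrix σ)⁻¹, Matrix.mul_nonsing_inv _ hu⟩

/-- Cotangent lift: x_i goes to σ(x_i), and the momentum x_{n+i} to the symbol of ∂/∂σ(x_i), a
linear form in the momenta. The lift is Poisson, and restricting it to the zero section gives back
σ. -/
theorem JacobianConjecture.of_poissonConjecture (h : PoissonConjecture K n) :
    JacobianConjecture K n := by
  intro σ hσ
  obtain ⟨N, hN⟩ := hσ.exists_inverse_matrix
  let r : MvPolynomial (Fin n) K →ₐ[K] MvPolynomial (Fin n ⊕ Fin n) K := rename Sum.inl
  have hinl : ∀ (j : Fin n) P, pderiv (Sum.inl j) (r P) = r (pderiv j P) := fun j P =>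
    pderiv_rename Sum.inl_injective j P
  have hinr : ∀ (j : Fin n) P, pderiv (Sum.inr j) (r P) = 0 := by
    intro j P
    refine pderiv_eq_zero_of_notMem_vars fun hmem => ?_
    classical
    have := vars_rename Sum.inl P hmem
    simp at this
  let τ : MvPolynomial (Fin n ⊕ Fin n) K →ₐ[K] MvPolynomial (Fin n ⊕ Fin n) K :=
    aeval (Sum.elim (fun i => r (σ (X i))) fun i => ∑ j, r (N j i) * X (Sum.inr j))
  have hτl : ∀ i, τ (X (.inl i)) = r (σ (X i)) := fun i => by simp [τ]
  have hτr : ∀ i, τ (X (.inr i)) = ∑ j, r (N j i) * X (Sum.inr j) := fun i => by simp [τ]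
  have hdr : ∀ k i, pderiv (Sum.inr k) (τ (X (.inr i))) = r (N k i) := by
    intro k i
    rw [hτr, map_sum, Finset.sum_eq_single k]
    · simp [hinr]
    · intro j _ hj
      simp [hinr, pderiv_X_of_ne (Sum.inr_injective.ne hj)]
    · simp
  have hdl : ∀ k i, pderiv (Sum.inl k) (τ (X (.inr i)))
      = ∑ j, r (pderiv k (N j i)) * X (Sum.inr j) := by
    intro k i
    rw [hτr, map_sum]
    refine Finset.sum_congr rfl fun j _ => ?_
    simp [hinl, mul_comm]
  have key : ∀ i l, poissonBracket (τ (X (.inr i))) (τ (X (.inl l)))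
      = C (weylForm K (.inr i) (.inl l)) := by
    intro i l
    have h1 := congrArg r (dualDerivation_apply_self hN i l)
    rw [dualDerivation_apply, map_sum] at h1
    simp only [poissonBracket, hdr, hτl, hinl, hinr, mul_zero, sub_zero, ← map_mul, h1, weylForm]
    split_ifs <;> simp
  have hmem : τ ∈ poissonEnd K n := by
    refine mem_poissonEnd_of_generators τ ?_
    rintro (i | i) (l | l)
    · simp [poissonBracket, hτl, hinr, weylForm]
    · rw [poissonBracket_swap, key, weylForm_swap, map_neg, neg_neg]
    · exact key i l
    · simp only [poissonBracket, hdr, hdl, Finset.mul_sum, Finset.sum_mul,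
        ← Finset.sum_sub_distrib, weylForm, map_zero]
      rw [Finset.sum_comm]
      -- The bracket of two lifted momenta is linear in the x_{n+j}; its j-th coefficient is a
      -- component of the commutator of two dual derivations.
      refine Finset.sum_eq_zero fun j _ => ?_
      have h1 := congrArg r (dualDerivation_entry_comm hN i l j)
      rw [dualDerivation_apply, dualDerivation_apply, map_sum, map_sum, ← sub_eq_zero,
        ← Finset.sum_sub_distrib] at h1
      rw [← zero_mul (X (Sum.inr j)), ← h1, Finset.sum_mul]
      refine Finset.sum_congr rfl fun k _ => ?_
      rw [map_mul, map_mul]; ring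
  have hτu : IsUnit τ := (h ⟨τ, hmem⟩).map (poissonEnd K n).subtype
  have hsurj := (AlgHom.bijective_of_isUnit τ hτu).2
  refine MvPolynomial.isUnit_algHom_of_surjective σ
    (MvPolynomial.algHom_surjective_of_X_mem_range σ fun i => ?_)
  obtain ⟨Q, hQ⟩ := hsurj (X (.inl i))
  -- Restriction to the zero section, where all momenta vanish; it intertwines τ and σ, so it
  -- carries a preimage under τ to one under σ.
  let s : MvPolynomial (Fin n ⊕ Fin n) K →ₐ[K] MvPolynomial (Fin n) K :=
    aeval (Sum.elim X fun _ => 0)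
  have hsr : ∀ P, s (r P) = P := by
    intro P
    have : s.comp r = AlgHom.id K _ := by ext i; simp [s, r]
    exact DFunLike.congr_fun this P
  have hcomp : s.comp τ = σ.comp s := by
    refine algHom_ext fun i => ?_
    rcases i with i | i
    · rw [AlgHom.comp_apply, hτl, hsr]; simp [s]
    · rw [AlgHom.comp_apply, hτr]; simp [s]
  refine ⟨s Q, ?_⟩
  have := DFunLike.congr_fun hcomp Q
  simp only [AlgHom.comp_apply, hQ] at this
  change σ (s Q) = _
  rw [← this]; simp [s]

end Poisson

/-! ### DC_n ⇒ JC_n -/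

section DixmierToJacobian

variable {K : Type*} [Field K] {n : ℕ}

namespace WeylAlgebra

/-- The operators through which the Weyl algebra acts on polynomials. -/
noncomputable def diffOp (K : Type*) [Field K] {n : ℕ} :
    Fin n ⊕ Fin n → Module.End K (MvPolynomial (Fin n) K)
  | .inl i => LinearMap.mulLeft K (X i)
  | .inr i => (pderiv i).toLinearMap

theorem diffOp_isWeylSystem : IsWeylSystem K (diffOp K (n := n)) := by
  have key : ∀ i j : Fin n, diffOp K (.inr i) * diffOp K (.inl j)
      - diffOp K (.inl j) * diffOp K (.inr i)
      = algebraMap K (Module.End K (MvPolynomial (Fin n) K)) (if i = j then 1 else 0) := by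
    intro i j
    refine LinearMap.ext fun P => ?_
    simp only [diffOp, LinearMap.sub_apply, Module.End.mul_apply,
      LinearMap.mulLeft_apply, Derivation.coeFn_coe, pderiv_mul, Module.algebraMap_end_apply,
      pderiv_X, Pi.single_apply]
    by_cases h : i = j
    · simp only [h, if_true, one_smul]; ring
    · simp only [h, Ne.symm h, if_false, zero_smul]; ring
  rintro (i | i) (j | j)
  · refine LinearMap.ext fun P => ?_
    simp only [diffOp, LinearMap.sub_apply, Module.End.mul_apply, LinearMap.mulLeft_apply,
      weylForm, map_zero, LinearMap.zero_apply]
    ring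
  · rw [← neg_sub, key]
    simp only [weylForm, eq_comm]
    split_ifs <;> simp
  · exact key i j
  · refine LinearMap.ext fun P => ?_
    simp [diffOp, weylForm, pderiv_comm i j P]

/-- In characteristic zero the Weyl algebra acts faithfully on polynomials, by differential
operators. -/
theorem exists_faithful_rep (K : Type*) [Field K] [CharZero K] (n : ℕ) :
    ∃ ρ : WeylAlgebra K n →ₐ[K] Module.End K (MvPolynomial (Fin n) K),
      Function.Injective ρ ∧ ∀ a, ρ (gen K a) = diffOp K a := by
  obtain ⟨ρ, hρ⟩ := exists_lift (diffOp_isWeylSystem (K := K) (n := n))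
  exact ⟨ρ, algHom_injective ρ, hρ⟩

end WeylAlgebra

open WeylAlgebra in
-- The σ(x_i) and the derivations ∂/∂σ(x_i) satisfy the Weyl relations, as the faithful action on
-- polynomials shows, and so define an endomorphism Φ of A_n. A preimage under Φ of a polynomial
-- turns out to be a polynomial, which makes σ onto.
theorem JacobianConjecture.of_dixmierConjecture [CharZero K] (h : DixmierConjecture K n) :
    JacobianConjecture K n := by
  intro σ hσ
  obtain ⟨N, hN⟩ := hσ.exists_inverse_matrix
  obtain ⟨ρ, hρi, hρ⟩ := exists_faithful_rep K n
  obtain ⟨j, hj⟩ := exists_algHom_of_commute (R := K)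
    (fun i => gen K (Sum.inl i : Fin n ⊕ Fin n)) (fun a b => by
      have := gen_isWeylSystem (R := K) (.inl a : Fin n ⊕ Fin n) (.inl b)
      simpa [weylForm, sub_eq_zero] using this)
  have hρj : ∀ P Q, ρ (j P) Q = P * Q := by
    intro P
    have : ρ.comp j = Algebra.lmul K (MvPolynomial (Fin n) K) := by
      refine algHom_ext fun i => ?_
      rw [AlgHom.comp_apply, hj, hρ]
      rfl
    intro Q
    exact congrArg (fun f => f Q) (DFunLike.congr_fun this P)
  let g : Fin n ⊕ Fin n → WeylAlgebra K n :=
    Sum.elim (fun i => j (σ (X i))) fun i => ∑ k, j (N k i) * gen K (.inr k)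
  have hgr : ∀ i Q, ρ (g (.inr i)) Q = dualDerivation N i Q := by
    intro i Q
    simp [g, dualDerivation_apply, hρj, hρ, diffOp]
  have hgl : ∀ i Q, ρ (g (.inl i)) Q = σ (X i) * Q := fun i Q => hρj _ _
  have key : ∀ i l, g (.inr i) * g (.inl l) - g (.inl l) * g (.inr i)
      = algebraMap K _ (if i = l then 1 else 0) := by
    intro i l
    apply hρi
    refine LinearMap.ext fun Q => ?_
    have h1 := dualDerivation_apply_self hN i l
    simp only [map_sub, map_mul, LinearMap.sub_apply, Module.End.mul_apply, hgr, hgl,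
      Derivation.leibniz, smul_eq_mul, h1]
    split_ifs <;> simp
  have hg : IsWeylSystem K g := by
    rintro (i | i) (l | l)
    · simp only [g, Sum.elim_inl, ← map_mul, weylForm, map_zero, mul_comm, sub_self]
    · rw [← neg_sub, key]
      simp only [weylForm, eq_comm]
      split_ifs <;> simp
    · exact key i l
    · apply hρi
      refine LinearMap.ext fun Q => ?_
      simp [hgr, dualDerivation_commute hN i l Q, weylForm]
  obtain ⟨Φ, hΦ⟩ := exists_lift hg
  have hb := AlgHom.bijective_of_isUnit Φ (h Φ)
  have hΦj : ∀ P, Φ (j P) = j (σ P) := by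
    have : Φ.comp j = j.comp σ := algHom_ext fun i => by
      rw [AlgHom.comp_apply, AlgHom.comp_apply, hj, hΦ]; rfl
    exact fun P => DFunLike.congr_fun this P
  refine MvPolynomial.isUnit_algHom_of_surjective σ fun Q => ?_
  obtain ⟨a, ha⟩ := hb.2 (j Q)
  -- After applying Φ, both factors are polynomials and commute; injectivity of Φ brings this back.
  have hcomm : ∀ i, a * gen K (.inl i) = gen K (.inl i) * a := by
    intro i
    apply hb.1
    rw [map_mul, map_mul, ha, ← hj, hΦj, ← map_mul, ← map_mul, mul_comm]
  -- An operator commuting with all multiplications is multiplication by its value at 1.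
  have hmul : ∀ P, ρ a P = ρ a 1 * P := by
    intro P
    induction P using MvPolynomial.induction_on with
    | C c => rw [← mul_one (C c), ← MvPolynomial.smul_eq_C_mul, map_smul, mul_smul_comm, mul_one]
    | add P Q hP hQ => rw [map_add, hP, hQ, mul_add]
    | mul_X P i hP =>
      have h1 := congrArg (fun b => ρ b P) (hcomm i)
      simp only [map_mul, Module.End.mul_apply, hρ, diffOp, LinearMap.mulLeft_apply, hP] at h1
      rw [mul_comm P, h1]; ring
  have haj : a = j (ρ a 1) := hρi (LinearMap.ext fun P => by rw [hρj, hmul])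
  refine ⟨ρ a 1, ?_⟩
  have h2 : j (σ (ρ a 1)) = j Q := by rw [← hΦj, ← haj, ha]
  have := congrArg (fun b => ρ b 1) h2
  simpa [hρj] using this

end DixmierToJacobian

/-! ### Bounding the degree of the inverse of a polynomial automorphism -/

section InverseDegree

/-- A bound for the degree of the inverse of an automorphism of degree at most `d` of a
polynomial ring in `m` variables over a field. -/
def inverseDegreeBound (d m : ℕ) : ℕ := m * ((d * (m + 1) + m + 2) ^ m + 1)

theorem MvPolynomial.totalDegree_algHom_monomial_le {R ι κ : Type*} [CommRing R] [Fintype ι]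
    (σ : MvPolynomial ι R →ₐ[R] MvPolynomial κ R) {d : ℕ} (hd : ∀ i, (σ (X i)).totalDegree ≤ d)
    (m : ι →₀ ℕ) (r : R) : (σ (monomial m r)).totalDegree ≤ d * m.degree := by
  rw [monomial_eq, map_mul, MvPolynomial.algHom_C, MvPolynomial.algebraMap_eq]
  refine (totalDegree_mul _ _).trans ?_
  rw [totalDegree_C, zero_add, Finsupp.prod_fintype _ _ (by simp), map_prod]
  refine (totalDegree_finsetProd _ _).trans ?_
  rw [Finsupp.degree_eq_sum, Finset.mul_sum]
  refine Finset.sum_le_sum fun i _ => ?_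
  rw [map_pow]
  refine (totalDegree_pow _ _).trans ?_
  rw [mul_comm]
  exact Nat.mul_le_mul_right _ (hd i)

/-- Uniqueness of digits in base `G`: the terms with k ≥ 1 add up to a multiple of `G`, which if
nonzero has degree at least that of `G`, too large to cancel `P 0`. -/
theorem MvPolynomial.eq_zero_of_sum_mul_pow_eq_zero {K ι : Type*} [Field K]
    {G : MvPolynomial ι K} {E : ℕ} {P : ℕ → MvPolynomial ι K}
    (hP : ∀ k, (P k).totalDegree < G.totalDegree)
    (h : ∑ k ∈ Finset.range E, P k * G ^ k = 0) : ∀ k < E, P k = 0 := by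
  have hG : G ≠ 0 := by
    rintro rfl
    simpa using hP 0
  induction E generalizing P with
  | zero => intro k hk; omega
  | succ E ih =>
    rw [Finset.sum_range_succ', pow_zero, mul_one] at h
    have h1 : ∑ k ∈ Finset.range E, P (k + 1) * G ^ (k + 1)
        = G * ∑ k ∈ Finset.range E, P (k + 1) * G ^ k := by
      rw [Finset.mul_sum]
      exact Finset.sum_congr rfl fun k _ => by ring
    rw [h1] at h
    have h2 : ∑ k ∈ Finset.range E, P (k + 1) * G ^ k = 0 := by
      by_contra hne
      have h3 := totalDegree_mul_of_isDomain hG hne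
      rw [eq_neg_of_add_eq_zero_left h, totalDegree_neg] at h3
      have := hP 0
      omega
    rw [h2, mul_zero, zero_add] at h
    intro k hk
    rcases k with _ | k
    · exact h
    · exact ih (fun k => hP (k + 1)) h2 k (by omega)

/-- Dimension count. If deg G > mE, the E^{m+1} products x^α G^k with all exponents below E are
linearly independent. Their images σ(x^α) x_i^k are independent too, but have degree at most T, so
fewer than E^{m+1} coefficients are available. Any bound depending only on `d` and m serves, so
sharpness is not sought. -/
theorem MvPolynomial.totalDegree_le_inverseDegreeBound {K ι : Type*} [Field K] [Fintype ι]
    (σ : MvPolynomial ι K →ₐ[K] MvPolynomial ι K) (hσ : Function.Injective σ) {d : ℕ}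
    (hd : ∀ i, (σ (X i)).totalDegree ≤ d) {i : ι} {G : MvPolynomial ι K} (hG : σ G = X i) :
    G.totalDegree ≤ inverseDegreeBound d (Fintype.card ι) := by
  classical
  set m := Fintype.card ι with hm
  -- E is chosen so that (T + 1)^m ≤ (E - 1) E^m < E^{m+1}, using T + 1 ≤ (d(m+1) + m + 2) E.
  obtain ⟨E, hE⟩ : ∃ E, E = (d * (m + 1) + m + 2) ^ m + 1 := ⟨_, rfl⟩
  rw [inverseDegreeBound, ← hE]
  by_contra hlt
  push Not at hlt
  let T := d * (m * E) + E
  let e : (ι → ℕ) → (ι →₀ ℕ) := fun f => Finsupp.equivFunOnFinite.symm f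
  let cf : MvPolynomial ι K →ₗ[K] ((ι → Fin (T + 1)) → K) :=
    LinearMap.pi fun f => lcoeff K (e fun i => (f i : ℕ))
  have hcf : ∀ P, P.totalDegree ≤ T → cf P = 0 → P = 0 := by
    intro P hP h0
    ext k
    rw [coeff_zero]
    by_contra hk
    have hk' := le_totalDegree (mem_support_iff.2 hk)
    have hki : ∀ i, k i < T + 1 := by
      intro i
      have h1 : k i ≤ k.degree := Finsupp.le_degree i k
      rw [Finsupp.degree_apply] at h1
      simp only [Finsupp.sum] at hk'
      omega
    have := congrFun h0 fun i => ⟨k i, hki i⟩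
    apply hk
    simpa [cf, e] using this
  let u : (ι → Fin E) → (ι →₀ ℕ) := fun f => e fun i => (f i : ℕ)
  have hu : Function.Injective u := by
    intro f g hfg
    have := Finsupp.equivFunOnFinite.symm.injective hfg
    exact _root_.funext fun i => Fin.ext (congrFun this i)
  have hudeg : ∀ f, (u f).degree ≤ m * E := by
    intro f
    rw [Finsupp.degree_eq_sum, hm, ← smul_eq_mul]
    refine (Finset.sum_le_card_nsmul _ _ E fun i _ => (f i).2.le)
  let v : (ι → Fin E) × Fin E → MvPolynomial ι K := fun p => monomial (u p.1) 1 * G ^ (p.2 : ℕ)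
  have hv : ∀ p, (σ (v p)).totalDegree ≤ T := by
    intro p
    simp only [v, map_mul, map_pow, hG]
    refine (totalDegree_mul _ _).trans (add_le_add ?_ ?_)
    · exact (totalDegree_algHom_monomial_le σ hd _ _).trans (Nat.mul_le_mul_left _ (hudeg _))
    · rw [totalDegree_X_pow]; exact p.2.2.le
  have hli : LinearIndependent K fun p => cf (σ (v p)) := by
    rw [Fintype.linearIndependent_iff]
    intro g hg p
    have h1 : cf (σ (∑ p, g p • v p)) = 0 := by
      rw [← hg, map_sum, map_sum]
      exact Finset.sum_congr rfl fun p _ => by rw [map_smul, map_smul]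
    have h2 : σ (∑ p, g p • v p) = 0 := by
      refine hcf _ ?_ h1
      rw [map_sum]
      refine totalDegree_finsetSum_le fun p _ => ?_
      rw [map_smul]
      exact (totalDegree_smul_le _ _).trans (hv p)
    have h3 : ∑ p, g p • v p = 0 := hσ (by rw [h2, map_zero])
    -- The coefficient of G^k in the relation. Its degree is at most mE, hence below that of G by
    -- `hlt`.
    let P : ℕ → MvPolynomial ι K := fun k =>
      if hk : k < E then ∑ f, monomial (u f) (g (f, ⟨k, hk⟩)) else 0
    have h4 : ∑ k ∈ Finset.range E, P k * G ^ k = 0 := by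
      rw [Finset.sum_range, ← h3, Fintype.sum_prod_type_right]
      refine Finset.sum_congr rfl fun k _ => ?_
      simp only [P, k.2, dif_pos, Finset.sum_mul, v]
      refine Finset.sum_congr rfl fun f _ => ?_
      rw [← smul_mul_assoc, smul_monomial, smul_eq_mul, mul_one]
    have h5 := eq_zero_of_sum_mul_pow_eq_zero (fun k => ?_) h4 p.2 p.2.2
    · simp only [P, p.2.2, dif_pos] at h5
      have := congrArg (coeff (u p.1)) h5
      rw [coeff_sum, coeff_zero, Finset.sum_eq_single p.1] at this
      · simpa using this
      · intro f _ hf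
        rw [coeff_monomial, if_neg (hu.ne hf)]
      · simp
    · simp only [P]
      split_ifs with hk
      · refine lt_of_le_of_lt (totalDegree_finsetSum_le fun f _ => ?_) hlt
        refine (totalDegree_monomial_le _ _).trans ?_
        have := hudeg f
        rwa [Finsupp.degree_apply] at this
      · rw [totalDegree_zero]; omega
  have hcard := hli.fintype_card_le_finrank
  simp only [Fintype.card_prod, Fintype.card_fun, Fintype.card_fin, Module.finrank_fintype_fun_eq_card,
    ← hm] at hcard
  have hE1 : 1 ≤ E := by omega
  have hT : T + 1 ≤ (d * (m + 1) + m + 2) * E := by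
    simp only [T]; nlinarith
  have h6 : (T + 1) ^ m ≤ (d * (m + 1) + m + 2) ^ m * E ^ m := by
    rw [← mul_pow]; exact Nat.pow_le_pow_left hT m
  have h7 : 0 < E ^ m := by positivity
  have h8 : E ^ m * E ≤ (E - 1) * E ^ m := by
    refine hcard.trans (h6.trans (le_of_eq ?_))
    congr 1; omega
  have h9 : (E - 1) * E ^ m < E ^ m * E := by
    rw [mul_comm]
    exact Nat.mul_lt_mul_of_pos_left (by omega) h7
  omega

end InverseDegree

/-! ### Descent of JC to finite extensions by Weil restriction -/

section WeilRestriction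

/-- Apply an additive map to all coefficients of a polynomial. -/
noncomputable def MvPolynomial.coeffMap {R S ι : Type*} [CommRing R] [CommRing S] (f : R →+ S)
    (P : MvPolynomial ι R) : MvPolynomial ι S :=
  ∑ m ∈ P.support, monomial m (f (coeff m P))

@[simp] theorem MvPolynomial.coeff_coeffMap {R S ι : Type*} [CommRing R] [CommRing S]
    (f : R →+ S) (P : MvPolynomial ι R) (m : ι →₀ ℕ) :
    coeff m (coeffMap f P) = f (coeff m P) := by
  classical
  rw [coeffMap, coeff_sum]
  simp only [coeff_monomial]
  rw [Finset.sum_ite_eq' P.support m]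
  split_ifs with h
  · rfl
  · rw [notMem_support_iff.1 h, map_zero]

/-- Base change of an endomorphism of a polynomial ring along a ring homomorphism. -/
noncomputable def MvPolynomial.baseChange {R S ι : Type*} [CommRing R] [CommRing S] (f : R →+* S)
    (σ : MvPolynomial ι R →ₐ[R] MvPolynomial ι R) : MvPolynomial ι S →ₐ[S] MvPolynomial ι S :=
  aeval fun i => map f (σ (X i))

section BaseChange

variable {R S ι : Type*} [CommRing R] [CommRing S] (f : R →+* S)
  (σ : MvPolynomial ι R →ₐ[R] MvPolynomial ι R)

@[simp] theorem MvPolynomial.baseChange_X (i : ι) :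
    baseChange f σ (X i) = MvPolynomial.map f (σ (X i)) := by
  simp [baseChange]

theorem MvPolynomial.baseChange_map (P : MvPolynomial ι R) :
    baseChange f σ (MvPolynomial.map f P) = MvPolynomial.map f (σ P) := by
  induction P using MvPolynomial.induction_on with
  | C a => simp [MvPolynomial.algHom_C]
  | add p q hp hq => simp [hp, hq]
  | mul_X p i hp => simp [hp]

theorem MvPolynomial.jacobian_baseChange :
    jacobian (baseChange f σ) = (jacobian σ).map (MvPolynomial.map f) := by
  ext1 i j
  simp only [jacobian, Matrix.of_apply, Matrix.map_apply, baseChange_X]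
  rw [pderiv_map]

theorem MvPolynomial.det_jacobian_baseChange [Fintype ι] [DecidableEq ι] :
    (jacobian (baseChange f σ)).det = MvPolynomial.map f (jacobian σ).det := by
  rw [jacobian_baseChange, RingHom.map_det]; rfl

theorem MvPolynomial.baseChange_surjective (h : Function.Surjective σ) :
    Function.Surjective (baseChange f σ) := by
  refine algHom_surjective_of_X_mem_range _ fun i => ?_
  obtain ⟨Q, hQ⟩ := h (X i)
  exact ⟨MvPolynomial.map f Q, by
    change baseChange f σ _ = _
    rw [baseChange_map, hQ, map_X]⟩

end BaseChange

/-- A k-linear retraction Ω → k, applied to coefficients, commutes with σ because σ is defined over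
k. It therefore turns a preimage of X_i over Ω into one over k. -/
theorem MvPolynomial.surjective_of_baseChange {k Ω ι : Type*} [Field k] [Field Ω] (f : k →+* Ω)
    (σ : MvPolynomial ι k →ₐ[k] MvPolynomial ι k) (h : Function.Surjective (baseChange f σ)) :
    Function.Surjective σ := by
  algebraize [f]
  obtain ⟨p, hp⟩ := LinearMap.exists_leftInverse_of_injective (Algebra.linearMap k Ω)
    (LinearMap.ker_eq_bot.2 (algebraMap k Ω).injective)
  have hp' : ∀ c, p (f c) = c := fun c => DFunLike.congr_fun hp c
  let q : MvPolynomial ι Ω → MvPolynomial ι k := coeffMap p.toAddMonoidHom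
  have hadd : ∀ P Q, q (P + Q) = q P + q Q := fun P Q => by
    ext m; simp [q]
  have hmap : ∀ P, q (MvPolynomial.map f P) = P := fun P => by
    ext m; simp [q, coeff_map, hp']
  have hmul : ∀ (c : Ω) P, q (C c * MvPolynomial.map f P) = C (p c) * P := by
    intro c P
    ext m
    have h1 : c * f (coeff m P) = coeff m P • c := by rw [Algebra.smul_def, mul_comm]; rfl
    rw [coeff_coeffMap, coeff_C_mul, coeff_C_mul, coeff_map, h1]
    exact (p.map_smul _ _).trans (mul_comm _ _)
  have hq : ∀ H, q (baseChange f σ H) = σ (q H) := by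
    intro H
    induction H using MvPolynomial.induction_on' with
    | monomial m c =>
      have h0 : (monomial m c : MvPolynomial ι Ω) = C c * MvPolynomial.map f (monomial m 1) := by
        rw [map_monomial, map_one, C_mul_monomial, mul_one]
      rw [h0, map_mul, MvPolynomial.algHom_C, MvPolynomial.algebraMap_eq, baseChange_map, hmul,
        hmul, map_mul, MvPolynomial.algHom_C, MvPolynomial.algebraMap_eq]
    | add P Q hP hQ => rw [map_add, hadd, hP, hQ, hadd, map_add]
  refine algHom_surjective_of_X_mem_range _ fun i => ?_
  obtain ⟨H, hH⟩ := h (X i)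
  refine ⟨q H, ?_⟩
  change σ (q H) = _
  rw [← hq, hH, ← hmap (X i), map_X]

/-- The matrix of the e_t(b_s) is invertible, since the square of its determinant is the
discriminant of a separable extension; `ν` is its inverse. -/
theorem Algebra.exists_embeddings_dual (K k Ω : Type*) [Field K] [CharZero K] [Field k]
    [Algebra K k] [FiniteDimensional K k] [Field Ω] [IsAlgClosed Ω] [Algebra K Ω] {r : ℕ}
    (b : Module.Basis (Fin r) K k) :
    ∃ (e : Fin r ≃ (k →ₐ[K] Ω)) (ν : Fin r → Fin r → Ω),
      (∀ t u, ∑ s, e t (b s) * ν u s = if t = u then 1 else 0) ∧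
      (∀ s s', ∑ t, ν t s * e t (b s') = if s' = s then 1 else 0) := by
  have hr : Fintype.card (Fin r) = Fintype.card (k →ₐ[K] Ω) := by
    rw [AlgHom.card, Module.finrank_eq_card_basis b]
  let e : Fin r ≃ (k →ₐ[K] Ω) := Fintype.equivOfCardEq hr
  let M := Algebra.embeddingsMatrixReindex K Ω b e
  have hdet : M.det ≠ 0 := by
    intro h0
    have h1 := Algebra.discr_eq_det_embeddingsMatrixReindex_pow_two K Ω b e
    change _ = M.det ^ 2 at h1
    rw [h0, zero_pow two_ne_zero, FaithfulSMul.algebraMap_eq_zero_iff] at h1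
    exact Algebra.discr_not_zero_of_basis K b h1
  have hM : ∀ s t, M s t = e t (b s) := fun s t => rfl
  refine ⟨e, fun t s => M⁻¹ t s, fun t u => ?_, fun s s' => ?_⟩
  · have := congrFun (congrFun (Matrix.nonsing_inv_mul M (isUnit_iff_ne_zero.2 hdet)) u) t
    rw [Matrix.mul_apply, Matrix.one_apply] at this
    rw [if_congr eq_comm rfl rfl, ← this]
    exact Finset.sum_congr rfl fun s _ => by rw [hM, mul_comm]
  · have := congrFun (congrFun (Matrix.mul_nonsing_inv M (isUnit_iff_ne_zero.2 hdet)) s') s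
    rw [Matrix.mul_apply, Matrix.one_apply] at this
    rw [← this]
    exact Finset.sum_congr rfl fun s _ => by rw [hM, mul_comm]

section

variable {K k ι : Type*} [Field K] [Field k] [Algebra K k] {r : ℕ} (b : Module.Basis (Fin r) K k)

/-- The `s`-th coordinate of a polynomial over `k` with respect to a `K`-basis of `k`. -/
noncomputable def MvPolynomial.coordPoly (s : Fin r) (P : MvPolynomial ι k) : MvPolynomial ι K :=
  coeffMap (b.coord s).toAddMonoidHom P

theorem MvPolynomial.sum_coordPoly (P : MvPolynomial ι k) :
    ∑ s, C (b s) * MvPolynomial.map (algebraMap K k) (coordPoly b s P) = P := by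
  ext m
  rw [coeff_sum]
  conv_rhs => rw [← b.sum_repr (coeff m P)]
  refine Finset.sum_congr rfl fun s _ => ?_
  simp [coordPoly, coeff_map, Algebra.smul_def, mul_comm]

theorem MvPolynomial.eq_of_sum_basis_eq {P Q : Fin r → MvPolynomial ι K}
    (h : ∑ s, C (b s) * MvPolynomial.map (algebraMap K k) (P s)
      = ∑ s, C (b s) * MvPolynomial.map (algebraMap K k) (Q s)) : P = Q := by
  refine _root_.funext fun s => MvPolynomial.ext _ _ fun m => ?_
  have h1 := congrArg (fun F => b.repr (coeff m F) s) h
  simp only [coeff_sum, coeff_C_mul, coeff_map] at h1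
  have h2 : ∀ c : Fin r → K, ∑ s, b s * algebraMap K k (c s) = ∑ s, c s • b s := fun c =>
    Finset.sum_congr rfl fun s _ => by rw [Algebra.smul_def, mul_comm]
  rw [h2, h2, b.repr_sum_self, b.repr_sum_self] at h1
  exact h1

/-- The substitution `Xᵢ ↦ ∑ₛ bₛ X_{i,s}`. -/
noncomputable def MvPolynomial.weilHom :
    MvPolynomial ι k →ₐ[k] MvPolynomial (ι × Fin r) k :=
  aeval fun i => ∑ s, C (b s) * X (i, s)

theorem MvPolynomial.weilHom_X (i : ι) :
    weilHom b (X i) = ∑ s, C (b s) * X (i, s) := by simp [weilHom]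

/-- The Weil restriction of an endomorphism of a polynomial ring. -/
noncomputable def MvPolynomial.weilRestriction
    (σ : MvPolynomial ι k →ₐ[k] MvPolynomial ι k) :
    MvPolynomial (ι × Fin r) K →ₐ[K] MvPolynomial (ι × Fin r) K :=
  aeval fun v => coordPoly b v.2 (weilHom b (σ (X v.1)))

theorem MvPolynomial.weilRestriction_X (σ : MvPolynomial ι k →ₐ[k] MvPolynomial ι k)
    (i : ι) (s : Fin r) :
    weilRestriction b σ (X (i, s)) = coordPoly b s (weilHom b (σ (X i))) := by
  simp [weilRestriction]

theorem MvPolynomial.pderiv_weilHom [Fintype ι] (j : ι) (t : Fin r) (P : MvPolynomial ι k) :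
    pderiv (j, t) (weilHom b P) = C (b t) * weilHom b (pderiv j P) := by
  classical
  have hX : ∀ i, pderiv (j, t) (weilHom b (X i)) = if i = j then C (b t) else 0 := by
    intro i
    rw [weilHom_X, map_sum]
    simp only [pderiv_C_mul, pderiv_X, Pi.single_apply, Prod.mk.injEq]
    split_ifs with h
    · simp [h]
    · simp [h]
  rw [pderiv_algHom_apply]
  simp only [hX, mul_ite, mul_zero, Finset.sum_ite_eq', Finset.mem_univ, if_true]
  ring

/-- Each entry of J becomes the block of multiplication by that entry in the basis `b`. Blocks
multiply like entries, so the blocks of J⁻¹ give an inverse. -/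
theorem MvPolynomial.isUnit_det_jacobian_weilRestriction [Fintype ι] [DecidableEq ι]
    (σ : MvPolynomial ι k →ₐ[k] MvPolynomial ι k) (h : IsUnit (jacobian σ).det) :
    IsUnit (jacobian (weilRestriction b σ)).det := by
  obtain ⟨J, hJ⟩ : ∃ J, J = jacobian σ := ⟨_, rfl⟩
  rw [← hJ] at h
  obtain ⟨Jt, hJt⟩ : ∃ Jt, Jt = jacobian (weilRestriction b σ) := ⟨_, rfl⟩
  rw [← hJt]
  have hN : J * J⁻¹ = 1 := Matrix.mul_nonsing_inv _ h
  let ψ := MvPolynomial.map (σ := ι × Fin r) (algebraMap K k)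
  obtain ⟨N, hN'⟩ : ∃ N : Matrix (ι × Fin r) (ι × Fin r) (MvPolynomial (ι × Fin r) K),
      ∀ p q, N p q = coordPoly b p.2 (C (b q.2) * weilHom b (J⁻¹ p.1 q.1)) :=
    ⟨Matrix.of fun p q => coordPoly b p.2 (C (b q.2) * weilHom b (J⁻¹ p.1 q.1)), fun _ _ => rfl⟩
  have hJs : ∀ i j t, ∑ s, C (b s) * ψ (Jt (i, s) (j, t))
      = C (b t) * weilHom b (J i j) := by
    intro i j t
    have h1 := congrArg (pderiv (j, t)) (sum_coordPoly (K := K) b (weilHom b (σ (X i))))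
    rw [pderiv_weilHom, map_sum] at h1
    rw [hJ, jacobian_apply, ← h1]
    refine Finset.sum_congr rfl fun s _ => ?_
    rw [pderiv_C_mul, pderiv_map, hJt, jacobian_apply, weilRestriction_X]
  have hNs : ∀ j l u, ∑ t, C (b t) * ψ (N (j, t) (l, u)) = C (b u) * weilHom b (J⁻¹ j l) :=
    fun j l u => by
      simp only [hN']
      exact sum_coordPoly b _
  -- Equality over K is tested after recombining the coordinates of each column with the basis
  -- elements b_s.
  have hmul : Jt * N = 1 := by
    ext1 p q
    obtain ⟨i, s⟩ := p
    obtain ⟨l, u⟩ := q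
    have := eq_of_sum_basis_eq b (P := fun s => (Jt * N) (i, s) (l, u))
      (Q := fun s => (1 : Matrix (ι × Fin r) (ι × Fin r) (MvPolynomial (ι × Fin r) K)) (i, s) (l, u))
      ?_
    · exact congrFun this s
    · calc ∑ s, C (b s) * ψ ((Jt * N) (i, s) (l, u))
          = ∑ j, ∑ t, (∑ s, C (b s) * ψ (Jt (i, s) (j, t)))
              * ψ (N (j, t) (l, u)) := by
            simp only [Matrix.mul_apply, map_sum, map_mul, Finset.mul_sum, Finset.sum_mul,
              Fintype.sum_prod_type]
            rw [Finset.sum_comm]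
            refine Finset.sum_congr rfl fun j _ => ?_
            rw [Finset.sum_comm]
            exact Finset.sum_congr rfl fun t _ => Finset.sum_congr rfl fun s _ => by ring
        _ = ∑ j, weilHom b (J i j) * ∑ t, C (b t) * ψ (N (j, t) (l, u)) := by
            simp only [hJs, Finset.mul_sum]
            exact Finset.sum_congr rfl fun j _ => Finset.sum_congr rfl fun t _ => by ring
        _ = C (b u) * weilHom b ((J * J⁻¹) i l) := by
            simp only [hNs, Matrix.mul_apply, map_sum, map_mul, Finset.mul_sum]
            exact Finset.sum_congr rfl fun j _ => by ring
        _ = _ := by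
            rw [hN]
            simp only [Matrix.one_apply, Prod.mk.injEq]
            by_cases hil : i = l
            · simp [hil]
            · simp [hil]
  exact (Matrix.isUnit_iff_isUnit_det _).1 (IsUnit.of_mul_eq_one _ hmul)

end

/-- If the Jacobian conjecture holds in all dimensions over `K`, it holds over finite extensions
of `K`. -/
theorem JacobianConjecture.surjective_of_finite {K k ι : Type*} [Field K] [CharZero K] [Field k]
    [Algebra K k] [FiniteDimensional K k] [Fintype ι] [DecidableEq ι]
    (hJC : ∀ m, JacobianConjecture K m) (σ : MvPolynomial ι k →ₐ[k] MvPolynomial ι k)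
    (hσ : IsUnit (jacobian σ).det) : Function.Surjective σ := by
  let b := Module.finBasis K k
  let Ω := AlgebraicClosure k
  obtain ⟨e, ν, hν, hν'⟩ := Algebra.exists_embeddings_dual K k Ω b
  let t₀ := e.symm (IsScalarTower.toAlgHom K k Ω)
  have ht₀ : e t₀ = IsScalarTower.toAlgHom K k Ω := e.apply_symm_apply _
  have hs : Function.Surjective (weilRestriction b σ) :=
    (hJC _).surjective rfl _ (isUnit_det_jacobian_weilRestriction b σ hσ)
  let τ := baseChange (algebraMap K Ω) (weilRestriction b σ)
  have hτ : Function.Surjective τ := baseChange_surjective _ _ hs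
  -- In the coordinates Y_{j,t}, one family for each embedding e_t of k into Ω, the Weil restriction
  -- becomes the product of the conjugates of σ.
  let Y : ι → Fin (Module.finrank K k) → MvPolynomial (ι × Fin (Module.finrank K k)) Ω :=
    fun j t => ∑ s, C (e t (b s)) * X (j, s)
  -- Restriction to the factor of the canonical embedding, where the conjugate of σ is σ over Ω: by
  -- duality every Y_{j,t} with t ≠ t₀ goes to 0.
  let ρ : MvPolynomial (ι × Fin (Module.finrank K k)) Ω →ₐ[Ω] MvPolynomial ι Ω :=
    aeval fun v => C (ν t₀ v.2) * X v.1
  have hρY : ∀ j t, ρ (Y j t) = if t = t₀ then X j else 0 := by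
    intro j t
    simp only [Y, ρ, map_sum, map_mul, MvPolynomial.algHom_C, MvPolynomial.algebraMap_eq, aeval_X]
    simp only [← mul_assoc, ← C_mul, ← Finset.sum_mul, ← map_sum, hν]
    split_ifs <;> simp
  have hmapY : ∀ t P, MvPolynomial.map (e t : k →+* Ω) (weilHom b P)
      = aeval (Y · t) (MvPolynomial.map (e t : k →+* Ω) P) := by
    intro t P
    induction P using MvPolynomial.induction_on with
    | C a => simp [MvPolynomial.algHom_C]
    | add p q hp hq => simp [hp, hq]
    | mul_X p i hp => simp [hp, weilHom_X, Y]
  have hτY : ∀ j t, τ (Y j t) = aeval (Y · t) (MvPolynomial.map (e t : k →+* Ω) (σ (X j))) := by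
    intro j t
    rw [← hmapY, ← sum_coordPoly (K := K) b (weilHom b (σ (X j)))]
    simp only [Y, τ, map_sum, map_mul, MvPolynomial.algHom_C, MvPolynomial.algebraMap_eq,
      baseChange_X, weilRestriction_X, map_C, MvPolynomial.map_map]
    refine Finset.sum_congr rfl fun s _ => ?_
    congr 2
    congr 1
    exact (AlgHom.comp_algebraMap (e t)).symm
  let σΩ := baseChange (algebraMap k Ω) σ
  have hmem : ∀ j t, ρ (τ (Y j t)) ∈ σΩ.range := by
    intro j t
    rw [hτY, ← AlgHom.comp_apply]
    by_cases ht : t = t₀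
    · have h1 : ρ.comp (aeval (Y · t)) = AlgHom.id Ω _ := algHom_ext fun i => by
        simp [hρY, ht]
      rw [h1, ht, ht₀]
      exact ⟨X j, baseChange_X _ _ _⟩
    · have h1 : ρ.comp (aeval (Y · t)) = (Algebra.ofId Ω _).comp (aeval fun _ => 0) :=
        algHom_ext fun i => by simp [hρY, ht]
      rw [h1]
      exact σΩ.range.algebraMap_mem _
  have hXY : ∀ j s, (X (j, s) : MvPolynomial (ι × Fin (Module.finrank K k)) Ω)
      = ∑ t, C (ν t s) * Y j t := by
    intro j s
    simp only [Y, Finset.mul_sum]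
    rw [Finset.sum_comm]
    simp only [← mul_assoc, ← C_mul, ← Finset.sum_mul, ← map_sum, hν']
    simp [apply_ite C]
  have hrange : (ρ.comp τ).range ≤ σΩ.range := by
    rw [← Algebra.map_top, ← adjoin_range_X, AlgHom.map_adjoin]
    refine Algebra.adjoin_le ?_
    rintro _ ⟨_, ⟨⟨j, s⟩, rfl⟩, rfl⟩
    change ρ (τ _) ∈ σΩ.range
    rw [hXY, map_sum, map_sum]
    refine Subalgebra.sum_mem _ fun t _ => ?_
    rw [map_mul, map_mul, MvPolynomial.algHom_C, MvPolynomial.algebraMap_eq, MvPolynomial.algHom_C]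
    exact Subalgebra.mul_mem _ (σΩ.range.algebraMap_mem _) (hmem j t)
  refine surjective_of_baseChange (algebraMap k Ω) σ
    (algHom_surjective_of_X_mem_range _ fun i => hrange ?_)
  obtain ⟨Q, hQ⟩ := hτ (Y i t₀)
  refine ⟨Q, ?_⟩
  change ρ (τ Q) = _
  rw [hQ, hρY, if_pos rfl]

end WeilRestriction

/-! ### Specialising rings of finite type over ℤ to finite extensions and to ℤ_p -/

section Specialization

universe u v

open scoped TensorProduct in
-- K is flat over ℤ and ℤ embeds in S, so K ⊗ S is nonzero; by Zariski's lemma its residue field at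
-- a maximal ideal is finite over K.
theorem exists_hom_to_finite_extension (K : Type u) [Field K] [CharZero K] (S : Type v) [CommRing S]
    [Algebra.FiniteType ℤ S] [CharZero S] :
    ∃ (k : Type (max u v)) (_ : Field k) (_ : Algebra K k), FiniteDimensional K k ∧ Nonempty (S →+* k) := by
  have hinj : Function.Injective (Algebra.TensorProduct.includeLeft : K →ₐ[ℤ] K ⊗[ℤ] S) := by
    apply Algebra.TensorProduct.includeLeft_injective
    exact (algebraMap ℤ S).injective_int
  have : Nontrivial (K ⊗[ℤ] S) := hinj.nontrivial
  obtain ⟨m, hm⟩ := Ideal.exists_maximal (K ⊗[ℤ] S)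
  let _ : Field ((K ⊗[ℤ] S) ⧸ m) := Ideal.Quotient.field m
  have : Algebra.FiniteType K ((K ⊗[ℤ] S) ⧸ m) :=
    Algebra.FiniteType.of_surjective (Ideal.Quotient.mkₐ K m) (Ideal.Quotient.mkₐ_surjective K m)
  refine ⟨(K ⊗[ℤ] S) ⧸ m, inferInstance, inferInstance, ?_, ⟨?_⟩⟩
  · exact finite_of_finite_type_of_isJacobsonRing K _
  · exact (Ideal.Quotient.mk m).comp
      (Algebra.TensorProduct.includeRight : S →ₐ[ℤ] K ⊗[ℤ] S).toRingHom

open Polynomial in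
/-- The values of a nonconstant integer polynomial have arbitrarily large prime divisors. -/
theorem Polynomial.exists_prime_gt_dvd_eval (f : ℤ[X]) (hf : 0 < f.natDegree) (N : ℕ) :
    ∃ p : ℕ, p.Prime ∧ N < p ∧ ∃ t : ℤ, (p : ℤ) ∣ f.eval t := by
  by_cases h0 : f.eval 0 = 0
  · obtain ⟨p, hp, hpp⟩ := Nat.exists_infinite_primes (N + 1)
    exact ⟨p, hpp, hp, 0, by rw [h0]; exact dvd_zero _⟩
  have hfin : ∀ c : ℤ, {t : ℤ | f.eval t = c}.Finite := by
    intro c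
    have hne : f - C c ≠ 0 := by
      intro h
      rw [sub_eq_zero.1 h, natDegree_C] at hf
      exact lt_irrefl _ hf
    refine (f - C c).roots.toFinset.finite_toSet.subset fun t ht => ?_
    simp only [Finset.mem_coe, Multiset.mem_toFinset, mem_roots hne, IsRoot.def, eval_sub, eval_C]
    exact sub_eq_zero.2 ht
  set c := f.eval 0 with hc
  -- At multiples of f(0)·N! the value of f is f(0) times an integer w ≡ 1 modulo N!, and prime
  -- divisors of w exceed N.
  set M : ℤ := c * (N.factorial : ℤ) with hM
  have hM0 : M ≠ 0 := mul_ne_zero h0 (by exact_mod_cast N.factorial_ne_zero)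
  have hinf : (Set.range fun s : ℤ => M * s).Infinite :=
    Set.infinite_range_of_injective (mul_right_injective₀ hM0)
  -- Avoiding the values ±c guarantees w ≠ ±1, so that w has a prime divisor.
  obtain ⟨_, ⟨s, rfl⟩, hs⟩ := hinf.exists_notMem_finite ((hfin c).union (hfin (-c)))
  simp only [Set.mem_union, Set.mem_ofPred_eq, not_or] at hs
  obtain ⟨u, hu⟩ : M * s ∣ f.eval (M * s) - c := by
    have := f.sub_dvd_eval_sub (M * s) 0
    rwa [sub_zero] at this
  have hval : f.eval (M * s) = c * (1 + (N.factorial : ℤ) * (s * u)) := by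
    rw [sub_eq_iff_eq_add] at hu
    rw [hu, hM]; ring
  set w := 1 + (N.factorial : ℤ) * (s * u) with hw
  have hw1 : w.natAbs ≠ 1 := by
    intro h
    rcases Int.natAbs_eq w with h' | h'
    · exact hs.1 (by rw [hval, h', h]; simp)
    · exact hs.2 (by rw [hval, h', h]; simp)
  obtain ⟨p, hp, hpw⟩ := Nat.exists_prime_and_dvd hw1
  have hpw' : (p : ℤ) ∣ w := Int.natCast_dvd.2 hpw
  refine ⟨p, hp, ?_, M * s, by rw [hval]; exact hpw'.mul_left _⟩
  by_contra hle
  push Not at hle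
  have h1 : (p : ℤ) ∣ (N.factorial : ℤ) * (s * u) :=
    (Int.natCast_dvd_natCast.2 ((Nat.Prime.dvd_factorial hp).2 hle)).mul_right _
  have h2 : (p : ℤ) ∣ 1 := by
    have := dvd_sub hpw' h1
    rwa [hw, add_sub_cancel_right] at this
  exact hp.one_lt.ne' (by simpa using Int.natAbs_dvd_natAbs.2 h2)

open Polynomial in
-- Clear denominators in a Bézout identity for f and f′, getting a nonzero integer constant. A prime
-- that divides g(t) but not this constant cannot divide g′(t), and Hensel's lemma lifts t to a
-- root.
theorem Polynomial.exists_padic_root (f : ℚ[X]) (hf : 0 < f.natDegree) (hs : f.Separable) (N : ℕ) :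
    ∃ (p : ℕ) (_ : Fact p.Prime), N < p ∧ ∃ t : ℚ_[p], aeval t f = 0 := by
  have clear : ∀ a : ℚ[X], ∃ (c : ℤ) (A : ℤ[X]), c ≠ 0 ∧ A.map (Int.castRingHom ℚ) = C (c : ℚ) * a := by
    intro a
    obtain ⟨c, hcm, hc⟩ := IsLocalization.integerNormalization_spec (nonZeroDivisors ℤ) a
    refine ⟨c, IsLocalization.integerNormalization (nonZeroDivisors ℤ) a,
      nonZeroDivisors.ne_zero hcm, ?_⟩
    refine hc.trans ?_
    rw [← Polynomial.smul_eq_C_mul]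
    exact (Int.cast_smul_eq_zsmul ℚ c a).symm
  obtain ⟨a, b, hab⟩ := hs
  obtain ⟨γ, g, hγ, hg⟩ := clear f
  obtain ⟨α, A, hα, hA⟩ := clear a
  obtain ⟨β, B, hβ, hB⟩ := clear b
  have hid : C β * A * g + C α * B * derivative g = C (α * β * γ) := by
    apply Polynomial.map_injective (Int.castRingHom ℚ) Int.cast_injective
    simp only [Polynomial.map_add, Polynomial.map_mul, Polynomial.map_C, ← derivative_map, hg, hA,
      hB, derivative_C_mul, Int.coe_castRingHom, C_mul]
    linear_combination (C (α : ℚ) * C (β : ℚ) * C (γ : ℚ)) * hab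
  have hgdeg : 0 < g.natDegree := by
    rw [← natDegree_map_eq_of_injective (f := Int.castRingHom ℚ) Int.cast_injective g, hg,
      natDegree_C_mul (by exact_mod_cast hγ)]
    exact hf
  obtain ⟨p, hp, hpN, t, ht⟩ := g.exists_prime_gt_dvd_eval hgdeg (max N (α * β * γ).natAbs)
  have : Fact p.Prime := ⟨hp⟩
  have hD : ¬ (p : ℤ) ∣ α * β * γ := by
    intro h
    have h1 := Nat.le_of_dvd (Int.natAbs_pos.2 (mul_ne_zero (mul_ne_zero hα hβ) hγ))
      (Int.natCast_dvd.1 h)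
    exact absurd h1 (not_le.2 ((le_max_right _ _).trans_lt hpN))
  have hd : ¬ (p : ℤ) ∣ (derivative g).eval t := by
    intro h
    apply hD
    have := congrArg (eval t) hid
    simp only [eval_add, eval_mul, eval_C] at this
    rw [← this]
    exact dvd_add (ht.mul_left _) (h.mul_left _)
  have hev : ∀ q : ℤ[X], q.aeval (t : ℤ_[p]) = ((q.eval t : ℤ) : ℤ_[p]) := by
    intro q
    have := aeval_algebraMap_apply ℤ_[p] t q
    simpa using this
  obtain ⟨z, hz, -⟩ := hensels_lemma (p := p) (F := g) (a := (t : ℤ_[p])) (by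
    rw [hev, hev]
    have h1 : ‖((eval t (derivative g) : ℤ) : ℤ_[p])‖ = 1 :=
      le_antisymm (PadicInt.norm_le_one _)
        (not_lt.1 fun h => hd (PadicInt.norm_int_lt_one_iff_dvd _ |>.1 h))
    rw [h1, one_pow]
    exact PadicInt.norm_int_lt_one_iff_dvd _ |>.2 ht)
  refine ⟨p, this, (le_max_left _ _).trans_lt hpN, (z : ℚ_[p]), ?_⟩
  have h1 : aeval (z : ℚ_[p]) (g.map (Int.castRingHom ℚ)) = 0 := by
    have h2 := aeval_algebraMap_apply ℚ_[p] z g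
    rw [hz, map_zero] at h2
    rw [← h2]
    exact aeval_map_algebraMap ℚ _ g
  rw [hg, map_mul, aeval_C, mul_eq_zero] at h1
  rcases h1 with h1 | h1
  · simp [hγ] at h1
  · exact h1

/-- S maps to a number field k, and k embeds in ℚ_p when the minimal polynomial of a primitive
element has a root there. For p prime to the denominators of the finitely many generators, the image
lies in ℤ_p. -/
theorem exists_hom_to_padicInt (S : Type*) [CommRing S] [Algebra.FiniteType ℤ S] [CharZero S]
    (N : ℕ) : ∃ (p : ℕ) (_ : Fact p.Prime), N < p ∧ Nonempty (S →+* ℤ_[p]) := by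
  obtain ⟨k, _, _, hfd, ⟨f⟩⟩ := exists_hom_to_finite_extension ℚ S
  obtain ⟨s, hs⟩ := Algebra.FiniteType.out (R := ℤ) (A := S)
  have hint : ∀ x : S, ∃ c : ℤ, c ≠ 0 ∧ IsIntegral ℤ (c • f x) := by
    intro x
    have h1 : IsAlgebraic ℚ (f x) := Algebra.IsAlgebraic.isAlgebraic _
    have h2 : IsAlgebraic ℤ (f x) := (IsFractionRing.isAlgebraic_iff ℤ ℚ k).2 h1
    obtain ⟨c, hc, hc'⟩ := h2.exists_integral_multiple
    exact ⟨c, hc, hc'⟩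
  choose c hc hci using hint
  let pb := Field.powerBasisOfFiniteOfSeparable ℚ k
  -- Taking p larger than the product of the c x makes every denominator a p-adic unit.
  obtain ⟨p, hp, hpN, t, ht⟩ := (minpoly ℚ pb.gen).exists_padic_root
    (minpoly.natDegree_pos (Algebra.IsIntegral.isIntegral _))
    (Algebra.IsSeparable.isSeparable ℚ pb.gen) (max N (∏ x ∈ s, c x).natAbs)
  let φ : k →+* ℚ_[p] := (pb.lift t ht).toRingHom
  have hmem : ∀ x : S, φ (f x) ∈ PadicInt.subring p := by
    intro x
    have hx : x ∈ Algebra.adjoin ℤ (s : Set S) := by rw [hs]; trivial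
    induction hx using Algebra.adjoin_induction with
    | mem x hx =>
      have h1 : IsIntegral ℤ (φ (c x • f x)) := (hci x).map (φ.toIntAlgHom)
      obtain ⟨y, hy⟩ := (IsIntegrallyClosed.isIntegral_iff (R := ℤ_[p])).1 h1.tower_top
      have h2 : ‖φ (c x • f x)‖ ≤ 1 := by rw [← hy]; exact y.2
      have h3 : ‖((c x : ℤ) : ℚ_[p])‖ = 1 := by
        refine le_antisymm (Padic.norm_int_le_one _) (not_lt.1 fun h => ?_)
        have h4 := Padic.norm_intCast_lt_one_iff.1 h
        have h5 : (p : ℤ) ∣ ∏ x ∈ s, c x := h4.trans (Finset.dvd_prod_of_mem c hx)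
        have h6 := Nat.le_of_dvd (Int.natAbs_pos.2 (Finset.prod_ne_zero_iff.2 fun x _ => hc x))
          (Int.natCast_dvd.1 h5)
        exact absurd h6 (not_le.2 ((le_max_right _ _).trans_lt hpN))
      rw [zsmul_eq_mul, map_mul, map_intCast, norm_mul, h3, one_mul] at h2
      exact h2
    | algebraMap r =>
      rw [eq_intCast, map_intCast, map_intCast]
      exact intCast_mem _ r
    | add x y _ _ hx hy => rw [map_add, map_add]; exact add_mem hx hy
    | mul x y _ _ hx hy => rw [map_mul, map_mul]; exact mul_mem hx hy
  exact ⟨p, hp, (le_max_left _ _).trans_lt hpN, ⟨(φ.comp f).codRestrict (PadicInt.subring p) hmem⟩⟩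

end Specialization

/-! ### Compactness: transferring JC to large primes with bounded degrees -/

section BoundedInverse

theorem finiteType_int_adjoin {A : Type*} [CommRing A] (s : Finset A) :
    @Algebra.FiniteType ℤ (Algebra.adjoin ℤ (s : Set A)) _ _ (Ring.toIntAlgebra _) := by
  have h : Algebra.FiniteType ℤ (Algebra.adjoin ℤ (s : Set A)) :=
    (Subalgebra.fg_iff_finiteType _).1 ⟨s, rfl⟩
  convert h

/-- The exponents of degree at most `d`. -/
noncomputable def MvPolynomial.exponentsLE (ι : Type*) [Finite ι] (d : ℕ) : Finset (ι →₀ ℕ) :=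
  (Finsupp.finite_of_degree_le (σ := ι) d).toFinset

theorem MvPolynomial.mem_exponentsLE {ι : Type*} [Finite ι] {d : ℕ} {m : ι →₀ ℕ} :
    m ∈ exponentsLE ι d ↔ m.degree ≤ d := by
  simp [exponentsLE]

/-- The linear functional on polynomials with values `V m` on the monomials in `T`. -/
noncomputable def MvPolynomial.pairing {R ι : Type*} [CommRing R] (T : Finset (ι →₀ ℕ))
    (V : (ι →₀ ℕ) → R) : MvPolynomial ι R →ₗ[R] R :=
  ∑ m ∈ T, V m • lcoeff R m

theorem MvPolynomial.pairing_apply {R ι : Type*} [CommRing R] (T : Finset (ι →₀ ℕ))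
    (V : (ι →₀ ℕ) → R) (P : MvPolynomial ι R) : pairing T V P = ∑ m ∈ T, V m * coeff m P := by
  simp [pairing]

theorem MvPolynomial.pairing_map {R S ι : Type*} [CommRing R] [CommRing S] (f : R →+* S)
    (T : Finset (ι →₀ ℕ)) {V : (ι →₀ ℕ) → R} {W : (ι →₀ ℕ) → S} (hW : ∀ m ∈ T, W m = f (V m))
    (P : MvPolynomial ι R) :
    pairing T W (MvPolynomial.map f P) = f (pairing T V P) := by
  rw [pairing_apply, pairing_apply, map_sum]
  exact Finset.sum_congr rfl fun m hm => by rw [coeff_map, hW m hm, map_mul]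

/-- A vector outside a subspace of polynomials is separated from it by a functional supported on
a given set of monomials. -/
theorem MvPolynomial.exists_pairing_of_notMem {L ι : Type*} [Field L]
    (M : Submodule L (MvPolynomial ι L)) {Q : MvPolynomial ι L} (hQ : Q ∉ M)
    (T : Finset (ι →₀ ℕ)) (hT : Q.support ⊆ T) :
    ∃ V : (ι →₀ ℕ) → L, pairing T V Q = 1 ∧ ∀ P ∈ M, P.support ⊆ T → pairing T V P = 0 := by
  obtain ⟨f, hfQ, hfM⟩ := Submodule.exists_dual_map_eq_bot_of_notMem hQ inferInstance
  have key : ∀ P : MvPolynomial ι L, P.support ⊆ T →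
      pairing T (fun m => (f Q)⁻¹ * f (monomial m 1)) P = (f Q)⁻¹ * f P := by
    intro P hP
    rw [pairing_apply]
    conv_rhs => rw [← support_sum_monomial_coeff P, map_sum, Finset.mul_sum]
    rw [← Finset.sum_subset hP fun m _ hm => by rw [notMem_support_iff.1 hm, mul_zero]]
    refine Finset.sum_congr rfl fun m _ => ?_
    rw [← mul_one (coeff m P), ← smul_eq_mul (coeff m P), ← smul_monomial, map_smul, smul_eq_mul,
      smul_eq_mul]
    ring
  refine ⟨fun m => (f Q)⁻¹ * f (monomial m 1), ?_, fun P hP hPT => ?_⟩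
  · rw [key Q hT, inv_mul_cancel₀ hfQ]
  · rw [key P hPT]
    have : f P ∈ Submodule.map f M := ⟨P, hP, rfl⟩
    rw [hfM, Submodule.mem_bot] at this
    rw [this, mul_zero]

theorem MvPolynomial.support_subset_exponentsLE {R ι : Type*} [CommRing R] [Finite ι]
    {P : MvPolynomial ι R} {d : ℕ} (h : P.totalDegree ≤ d) : P.support ⊆ exponentsLE ι d := by
  intro m hm
  rw [mem_exponentsLE, Finsupp.degree_apply]
  exact (le_totalDegree hm).trans h

/-- Suppose it fails at primes p_N > N. The maps σ_N, with functionals separating X_i from the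
images of polynomials of degree at most B, assemble over a ring S of finite type inside the product
of the fields. S has characteristic zero, so everything specialises to a finite extension of K.
There JC yields a preimage of X_i of degree at most B, which the specialised functional forbids. -/
theorem JacobianConjecture.exists_bounded_preimage {K ι : Type*} [Field K] [CharZero K] [Fintype ι]
    [DecidableEq ι] (hJC : ∀ m, JacobianConjecture K m) (d : ℕ) (i : ι) :
    ∃ N : ℕ, ∀ (p : ℕ) [Fact p.Prime], N < p →
      ∀ σ : MvPolynomial ι (ZMod p) →ₐ[ZMod p] MvPolynomial ι (ZMod p),
      (∀ j, (σ (X j)).totalDegree ≤ d) → (jacobian σ).det ^ 2 = 1 →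
      ∃ G, σ G = X i ∧ G.totalDegree ≤ inverseDegreeBound d (Fintype.card ι) := by
  set B := inverseDegreeBound d (Fintype.card ι) with hB
  by_contra hcon
  push Not at hcon
  choose p hp hpN σ hσd hσJ hσ using hcon
  -- Large enough for the images of all monomials of degree at most B; the +1 makes room for X_i
  -- itself.
  let T := exponentsLE ι (d * B + 1)
  have hV : ∀ N, ∃ V : (ι →₀ ℕ) → ZMod (p N), pairing T V (X i) = 1 ∧
      ∀ β ∈ exponentsLE ι B, pairing T V (σ N (monomial β 1)) = 0 := by
    intro N
    let M := (restrictTotalDegree ι (ZMod (p N)) B).map (σ N).toLinearMap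
    have hM : (X i : MvPolynomial ι (ZMod (p N))) ∉ M := by
      rintro ⟨G, hG, hGX⟩
      exact absurd ((mem_restrictTotalDegree _ _ _).1 hG) (not_le.2 (hσ N G hGX))
    obtain ⟨V, hV1, hV2⟩ := exists_pairing_of_notMem M hM T
      (support_subset_exponentsLE (by rw [totalDegree_X]; omega))
    refine ⟨V, hV1, fun β hβ => hV2 _ ⟨monomial β 1, ?_, rfl⟩ ?_⟩
    · refine (mem_restrictTotalDegree _ _ _).2 ((totalDegree_monomial_le _ _).trans ?_)
      have := mem_exponentsLE.1 hβ
      rwa [Finsupp.degree_apply] at this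
    · refine support_subset_exponentsLE ((totalDegree_algHom_monomial_le (σ N) (hσd N) _ _).trans ?_)
      have := Nat.mul_le_mul_left d (mem_exponentsLE.1 hβ)
      omega
  choose V hV1 hV2 using hV
  -- The product plays the role of an ultraproduct. Since p_N > N, no positive integer vanishes in
  -- every factor.
  let A := ∀ N, ZMod (p N)
  let a : ι → (ι →₀ ℕ) → A := fun j m N => coeff m (σ N (X j))
  let v : (ι →₀ ℕ) → A := fun m N => V N m
  let gens : Finset A := by
    classical
    exact (Finset.univ ×ˢ exponentsLE ι d).image (fun q => a q.1 q.2) ∪ T.image v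
  let S := Algebra.adjoin ℤ (gens : Set A)
  have hft := finiteType_int_adjoin gens
  have hchar : CharZero A := by
    refine charZero_of_inj_zero fun n hn => ?_
    have h1 := congrFun hn n
    have h2 : ((n : ℕ) : ZMod (p n)) = 0 := h1
    rw [ZMod.natCast_eq_zero_iff] at h2
    by_contra h0
    exact absurd (Nat.le_of_dvd (Nat.pos_of_ne_zero h0) h2) (not_le.2 (hpN n))
  have hcharS : CharZero S := by
    refine charZero_of_inj_zero fun n hn => ?_
    have := congrArg Subtype.val hn
    simpa using this
  have ha : ∀ j, ∀ m ∈ exponentsLE ι d, a j m ∈ S := fun j m hm =>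
    Algebra.subset_adjoin (by
      simp only [gens, Finset.coe_union, Finset.coe_image]
      exact Or.inl ⟨(j, m), by simpa using hm, rfl⟩)
  have hv : ∀ m ∈ T, v m ∈ S := fun m hm =>
    Algebra.subset_adjoin (by
      simp only [gens, Finset.coe_union, Finset.coe_image]
      exact Or.inr ⟨m, hm, rfl⟩)
  classical
  let vS : (ι →₀ ℕ) → S := fun m => if hm : m ∈ T then ⟨v m, hv m hm⟩ else 0
  let σS : MvPolynomial ι S →ₐ[S] MvPolynomial ι S :=
    aeval fun j => ∑ m ∈ (exponentsLE ι d).attach, monomial m.1 ⟨a j m.1, ha j m.1 m.2⟩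
  let f : ∀ N, S →+* ZMod (p N) := fun N => (Pi.evalRingHom _ N).comp S.val.toRingHom
  have hf : ∀ s : S, (∀ N, f N s = 0) → s = 0 := fun s hs =>
    Subtype.ext (_root_.funext fun N => hs N)
  have hfP : ∀ P Q : MvPolynomial ι S,
      (∀ N, MvPolynomial.map (f N) P = MvPolynomial.map (f N) Q) → P = Q := by
    intro P Q h
    ext1 m
    rw [← sub_eq_zero]
    refine hf _ fun N => ?_
    rw [map_sub, ← coeff_map, ← coeff_map, h, sub_self]
  have hbc : ∀ N, baseChange (f N) σS = σ N := by
    intro N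
    refine algHom_ext fun j => ?_
    rw [baseChange_X]
    simp only [σS, aeval_X, map_sum, map_monomial]
    have h1 : ∀ m : {m // m ∈ exponentsLE ι d}, f N ⟨a j m.1, ha j m.1 m.2⟩
        = coeff m.1 (σ N (X j)) := fun m => rfl
    simp only [h1]
    rw [Finset.sum_attach (exponentsLE ι d) fun m => monomial m (coeff m (σ N (X j)))]
    conv_rhs => rw [← support_sum_monomial_coeff (σ N (X j))]
    exact (Finset.sum_subset (support_subset_exponentsLE (hσd N j)) fun m _ hm => by
      rw [notMem_support_iff.1 hm, map_zero]).symm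
  have hvS : ∀ N, ∀ m ∈ T, V N m = f N (vS m) := by
    intro N m hm
    simp only [vS, dif_pos hm]
    rfl
  have hJS : (jacobian σS).det ^ 2 = 1 := by
    refine hfP _ _ fun N => ?_
    rw [map_pow, ← det_jacobian_baseChange, hbc, map_one, hσJ]
  have hX : pairing T vS (X i) = 1 := by
    rw [← sub_eq_zero]
    refine hf _ fun N => ?_
    rw [map_sub, ← pairing_map (f N) T (hvS N), map_X, hV1, map_one, sub_self]
  have hpair : ∀ β ∈ exponentsLE ι B, pairing T vS (σS (monomial β 1)) = 0 := by
    intro β hβ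
    refine hf _ fun N => ?_
    rw [← pairing_map (f N) T (hvS N), ← baseChange_map, hbc, map_monomial, map_one, hV2 N β hβ]
  obtain ⟨k, _, _, hfd, ⟨g⟩⟩ := @exists_hom_to_finite_extension K _ _ S _ hft hcharS
  let σk := baseChange g σS
  have hJk : (jacobian σk).det ^ 2 = 1 := by
    rw [det_jacobian_baseChange, ← map_pow, hJS, map_one]
  have hsurj := JacobianConjecture.surjective_of_finite hJC σk
    (IsUnit.of_pow_eq_one hJk two_ne_zero)
  obtain ⟨G, hG⟩ := hsurj (X i)
  have hdk : ∀ j, (σk (X j)).totalDegree ≤ d := by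
    intro j
    simp only [σk, baseChange_X, σS, aeval_X, map_sum, map_monomial]
    refine totalDegree_finsetSum_le fun m _ => (totalDegree_monomial_le _ _).trans ?_
    have := mem_exponentsLE.1 m.2
    rwa [Finsupp.degree_apply] at this
  -- B depends only on `d` and the number of variables, so the same bound is valid over k.
  have hGd := totalDegree_le_inverseDegreeBound σk
    (RingHom.injective_of_surjective_endo σk.toRingHom hsurj) hdk hG
  have h1 : pairing T (fun m => g (vS m)) (X i) = 1 := by
    rw [← map_X g, pairing_map g T (V := vS) (fun _ _ => rfl), hX, map_one]
  have h0 : pairing T (fun m => g (vS m)) (σk G) = 0 := by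
    rw [← support_sum_monomial_coeff G, map_sum, map_sum]
    refine Finset.sum_eq_zero fun β hβ => ?_
    rw [← mul_one (coeff β G), ← smul_eq_mul (coeff β G), ← smul_monomial, map_smul, map_smul,
      ← map_one g, ← map_monomial, baseChange_map, pairing_map g T (V := vS) (fun _ _ => rfl),
      hpair β (support_subset_exponentsLE hGd hβ), map_zero, smul_zero]
  rw [hG, h1] at h0
  exact one_ne_zero h0

end BoundedInverse

/-! ### Inner derivations dual to a Weyl system -/

section DualDerivationOperators

theorem commutator_pow_of_commutator_eq {R A : Type*} [CommRing R] [Ring A] [Algebra R A] {a b : A}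
    {c : R} (h : b * a - a * b = algebraMap R A c) (k : ℕ) :
    b * a ^ k - a ^ k * b = (k * c) • a ^ (k - 1) := by
  induction k with
  | zero => simp
  | succ k ih =>
    have h1 : b * a ^ (k + 1) - a ^ (k + 1) * b
        = (b * a ^ k - a ^ k * b) * a + a ^ k * (b * a - a * b) := by
      rw [pow_succ]; noncomm_ring
    rw [h1, ih, h, ← Algebra.commutes, ← Algebra.smul_def, smul_mul_assoc, ← pow_succ,
      Nat.add_sub_cancel, Nat.cast_succ, add_mul, one_mul, add_smul]
    rcases k with _ | k
    · simp
    · simp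

/-- The commutator operators dual to a Weyl system `g`: they act as `∂/∂gᵢ`. -/
def dualOp (R : Type*) {A : Type*} [CommRing R] [Ring A] [Algebra R A] {n : ℕ}
    (g : Fin n ⊕ Fin n → A) : Fin n ⊕ Fin n → Module.End R A
  | .inl j => LinearMap.mulLeft R (g (.inr j)) - LinearMap.mulRight R (g (.inr j))
  | .inr j => LinearMap.mulRight R (g (.inl j)) - LinearMap.mulLeft R (g (.inl j))

section

variable {R A : Type*} [CommRing R] [Ring A] [Algebra R A] {n : ℕ} {g : Fin n ⊕ Fin n → A}

theorem dualOp_mul (i : Fin n ⊕ Fin n) (u v : A) :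
    dualOp R g i (u * v) = dualOp R g i u * v + u * dualOp R g i v := by
  rcases i with i | i <;>
    simp only [dualOp, LinearMap.sub_apply, LinearMap.mulLeft_apply, LinearMap.mulRight_apply] <;>
    noncomm_ring

theorem dualOp_apply_self (hg : IsWeylSystem R g) (i j : Fin n ⊕ Fin n) :
    dualOp R g i (g j) = if i = j then 1 else 0 := by
  rcases i with i | i
  · simp only [dualOp, LinearMap.sub_apply, LinearMap.mulLeft_apply, LinearMap.mulRight_apply]
    rw [hg]
    rcases j with j | j
    · simp only [weylForm, Sum.inl.injEq]
      split_ifs <;> simp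
    · simp [weylForm]
  · simp only [dualOp, LinearMap.sub_apply, LinearMap.mulLeft_apply, LinearMap.mulRight_apply]
    rw [hg]
    rcases j with j | j
    · simp [weylForm]
    · simp only [weylForm, Sum.inr.injEq, eq_comm]
      split_ifs <;> simp

theorem dualOp_comm (hg : IsWeylSystem R g) (i j : Fin n ⊕ Fin n) (w : A) :
    dualOp R g i (dualOp R g j w) = dualOp R g j (dualOp R g i w) := by
  have key : ∀ a b, (g a * g b - g b * g a) * w = w * (g a * g b - g b * g a) := fun a b => by
    rw [hg, Algebra.commutes]
  rcases i with i | i <;> rcases j with j | j <;>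
    simp only [dualOp, LinearMap.sub_apply, LinearMap.mulLeft_apply, LinearMap.mulRight_apply,
      mul_sub, sub_mul, mul_assoc]
  · have h := key (.inr i) (.inr j)
    simp only [mul_sub, sub_mul, mul_assoc] at h
    rw [← sub_eq_zero] at h ⊢
    rw [← h]; abel
  · have h := key (.inl j) (.inr i)
    simp only [mul_sub, sub_mul, mul_assoc] at h
    rw [← sub_eq_zero] at h ⊢
    rw [← h]; abel
  · have h := key (.inr j) (.inl i)
    simp only [mul_sub, sub_mul, mul_assoc] at h
    rw [← sub_eq_zero] at h ⊢
    rw [← h]; abel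
  · have h := key (.inl i) (.inl j)
    simp only [mul_sub, sub_mul, mul_assoc] at h
    rw [← sub_eq_zero] at h ⊢
    rw [← h]; abel

theorem dualOp_algHom {B : Type*} [Ring B] [Algebra R B] (φ : A →ₐ[R] B) (i : Fin n ⊕ Fin n)
    (w : A) : dualOp R (fun a => φ (g a)) i (φ w) = φ (dualOp R g i w) := by
  rcases i with i | i <;> simp [dualOp]

theorem dualOp_eq_zero_of_commute {w : A} (h : ∀ a, g a * w = w * g a) (i : Fin n ⊕ Fin n) :
    dualOp R g i w = 0 := by
  rcases i with i | i <;> simp [dualOp, h]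

theorem commute_of_dualOp_eq_zero {w : A} (h : ∀ i, dualOp R g i w = 0) (a : Fin n ⊕ Fin n) :
    g a * w = w * g a := by
  rcases a with a | a
  · have := h (.inr a)
    simp only [dualOp, LinearMap.sub_apply, LinearMap.mulLeft_apply, LinearMap.mulRight_apply,
      sub_eq_zero] at this
    exact this.symm
  · have := h (.inl a)
    simpa only [dualOp, LinearMap.sub_apply, LinearMap.mulLeft_apply, LinearMap.mulRight_apply,
      sub_eq_zero] using this

theorem dualOp_pow_apply_pow_mul (hg : IsWeylSystem R g) (i : Fin n ⊕ Fin n) {v : A}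
    (hv : dualOp R g i v = 0) (k : ℕ) :
    (dualOp R g i ^ k) (g i ^ k * v) = (k.factorial : R) • v := by
  have hp : ∀ k : ℕ, dualOp R g i (g i ^ k) = (k : R) • g i ^ (k - 1) := by
    intro k
    induction k with
    | zero =>
      have h1 := dualOp_mul (R := R) (g := g) i 1 1
      simp only [mul_one, one_mul, left_eq_add] at h1
      simp [h1]
    | succ k ih =>
      rw [pow_succ, dualOp_mul, ih, dualOp_apply_self hg, if_pos rfl, mul_one, smul_mul_assoc,
        ← pow_succ, Nat.add_sub_cancel, Nat.cast_succ, add_smul, one_smul]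
      rcases k with _ | k
      · simp
      · simp
  induction k with
  | zero => simp
  | succ k ih =>
    rw [pow_succ, Module.End.mul_apply, dualOp_mul, hv, mul_zero, add_zero, hp,
      Nat.add_sub_cancel, smul_mul_assoc, map_smul, ih, smul_smul, Nat.factorial_succ, Nat.cast_mul]

/-- Left and right multiplications commute, so in characteristic p the p-th power of their
difference is the difference of multiplications by the central element g_a^p. -/
theorem dualOp_pow_char {p : ℕ} [Fact p.Prime] [CharP A p]
    (hc : ∀ a w, g a ^ p * w = w * g a ^ p) (i : Fin n ⊕ Fin n) : dualOp R g i ^ p = 0 := by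
  have hchar : CharP (Module.End R A) p := by
    have h : Function.Injective (Algebra.lmul R A) := Algebra.lmul_injective
    exact (RingHom.charP_iff (Algebra.lmul R A).toRingHom h p).1 inferInstance
  rcases i with i | i
  · rw [dualOp, sub_pow_char_of_commute _ (LinearMap.commute_mulLeft_right _ _),
      LinearMap.pow_mulLeft, LinearMap.pow_mulRight, sub_eq_zero]
    exact LinearMap.ext fun w => hc _ w
  · rw [dualOp, sub_pow_char_of_commute _ (LinearMap.commute_mulLeft_right _ _).symm,
      LinearMap.pow_mulLeft, LinearMap.pow_mulRight, sub_eq_zero]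
    exact LinearMap.ext fun w => (hc _ w).symm

end

namespace WeylAlgebra

theorem symbol_dualOp {R : Type*} [CommRing R] {n : ℕ} (i : Fin n ⊕ Fin n) (w : WeylAlgebra R n) :
    symbol R n (dualOp R (gen R) i w) = pderiv i (symbol R n w) := by
  rcases i with i | i
  · exact symbol_commutator_d i w
  · exact symbol_commutator_x i w

theorem commute_of_commute_gen {R A : Type*} [CommRing R] [Ring A] [Algebra R A] {n : ℕ}
    (φ : WeylAlgebra R n →ₐ[R] A) {z : A}
    (h : ∀ a, φ (gen R a) * z = z * φ (gen R a)) (w : WeylAlgebra R n) : φ w * z = z * φ w := by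
  induction w using induction_left with
  | h1 => simp
  | hadd a b ha hb => rw [map_add, add_mul, ha, hb, mul_add]
  | hsmul r a ha => rw [map_smul, smul_mul_assoc, ha, mul_smul_comm]
  | hmul i a ha => rw [_root_.map_mul, mul_assoc, ha, ← mul_assoc, h, mul_assoc]

end WeylAlgebra
end DualDerivationOperators

/-! ### The Weyl algebra in characteristic p: its centre and its box basis -/

section CharP

theorem MvPolynomial.exists_expand_of_pderiv_eq_zero {F ι : Type*} [Field F] {p : ℕ}
    [CharP F p] (Q : MvPolynomial ι F) (h : ∀ i, pderiv i Q = 0) :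
    ∃ P, Q = expand p P := by
  have hdvd : ∀ m ∈ Q.support, ∀ i, p ∣ m i := by
    intro m hm i
    by_cases hi : m i = 0
    · rw [hi]; exact dvd_zero _
    have hle : Finsupp.single i 1 ≤ m := by
      rw [Finsupp.single_le_iff]; omega
    have h1 := congrArg (coeff (m - Finsupp.single i 1)) (h i)
    rw [coeff_pderiv, tsub_add_cancel_of_le hle, coeff_zero, mul_eq_zero] at h1
    have h2 := h1.resolve_left (mem_support_iff.1 hm)
    have h3 : (m - Finsupp.single i 1 : ι →₀ ℕ) i + 1 = m i := by
      simp only [Finsupp.tsub_apply, Finsupp.single_eq_same]; omega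
    rw [← Nat.cast_add_one, h3] at h2
    exact (CharP.cast_eq_zero_iff F p _).1 h2
  rw [← support_sum_monomial_coeff Q]
  refine Finset.sum_induction _ (fun R => ∃ P, R = expand p P) ?_ ⟨0, (map_zero _).symm⟩ ?_
  · rintro _ _ ⟨P, rfl⟩ ⟨P', rfl⟩
    exact ⟨P + P', (map_add _ _ _).symm⟩
  · intro m hm
    refine ⟨monomial (m.mapRange (· / p) (Nat.zero_div p)) (coeff m Q), ?_⟩
    rw [expand_monomial]
    refine congrArg (fun k => monomial k (coeff m Q)) (Finsupp.ext fun i => ?_)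
    simp [Nat.mul_div_cancel' (hdvd m hm i)]

/-- Exponents bounded by `p`, as finitely supported functions. -/
noncomputable def boxExponent {ι : Type*} [Finite ι] {p : ℕ} (f : ι → Fin p) : ι →₀ ℕ :=
  Finsupp.equivFunOnFinite.symm fun i => (f i : ℕ)

theorem boxExponent_apply {ι : Type*} [Finite ι] {p : ℕ} (f : ι → Fin p) (i : ι) :
    boxExponent f i = f i := rfl

theorem boxExponent_injective {ι : Type*} [Finite ι] {p : ℕ} :
    Function.Injective (boxExponent (ι := ι) (p := p)) := fun _ _ h =>
  _root_.funext fun i => Fin.ext (DFunLike.congr_fun h i)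

theorem MvPolynomial.exists_eq_sum_expand_mul {F ι : Type*} [Field F] [Fintype ι] [DecidableEq ι]
    {p : ℕ} (hp : 0 < p) (Q : MvPolynomial ι F) :
    ∃ P : (ι → Fin p) → MvPolynomial ι F,
      Q = ∑ f, expand p (P f) * monomial (boxExponent f) 1 := by
  induction Q using MvPolynomial.induction_on' with
  | monomial m c =>
    let f₀ : ι → Fin p := fun i => ⟨m i % p, Nat.mod_lt _ hp⟩
    refine ⟨fun f => if f = f₀ then monomial (m.mapRange (· / p) (Nat.zero_div p)) c else 0, ?_⟩
    rw [Finset.sum_eq_single f₀]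
    · simp only [if_true]
      rw [expand_monomial, monomial_mul, mul_one]
      refine congrArg (fun k => monomial k c) (Finsupp.ext fun i => ?_)
      simp [f₀, boxExponent_apply, Nat.div_add_mod]
    · intro f _ hf
      simp only [if_neg hf, map_zero, zero_mul]
    · simp
  | add Q Q' hQ hQ' =>
    obtain ⟨P, rfl⟩ := hQ
    obtain ⟨P', rfl⟩ := hQ'
    refine ⟨P + P', ?_⟩
    rw [← Finset.sum_add_distrib]
    exact Finset.sum_congr rfl fun f _ => by rw [Pi.add_apply, map_add, add_mul]

namespace WeylAlgebra

variable {F : Type*} [Field F] {p : ℕ} [Fact p.Prime] [CharP F p] {n : ℕ}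

theorem charP_weylAlgebra (F : Type*) [Field F] (p : ℕ) [CharP F p] (n : ℕ) :
    CharP (WeylAlgebra F n) p := by
  have : Nontrivial (WeylAlgebra F n) := (symbol F n).toEquiv.nontrivial
  exact charP_of_injective_algebraMap (algebraMap F (WeylAlgebra F n)).injective p

omit [Fact p.Prime] in
theorem gen_pow_char_commute {A : Type*} [Ring A] [Algebra F A] (φ : WeylAlgebra F n →ₐ[F] A)
    (a : Fin n ⊕ Fin n) (w : WeylAlgebra F n) :
    φ (gen F a) ^ p * φ w = φ w * φ (gen F a) ^ p := by
  rw [← map_pow, ← _root_.map_mul, ← _root_.map_mul]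
  congr 1
  refine (commute_of_commute_gen (AlgHom.id F _) (fun b => ?_) w).symm
  have h := commutator_pow_of_commutator_eq (gen_isWeylSystem (R := F) b a) p
  rwa [CharP.cast_eq_zero, zero_mul, zero_smul, sub_eq_zero] at h

/-- A commutator with g_a^p carries the factor p, so p-th powers are central. Being central, ∂_i^p
may be moved to the right, where it multiplies symbols by y_i^p without correction terms. -/
theorem exists_frobeniusCenter (F : Type*) [Field F] (p : ℕ) [Fact p.Prime] [CharP F p] (n : ℕ) :
    ∃ j : MvPolynomial (Fin n ⊕ Fin n) F →ₐ[F] WeylAlgebra F n,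
      (∀ a, j (X a) = gen F a ^ p) ∧ (∀ P w, j P * w = w * j P) ∧
      ∀ P w, symbol F n (j P * w) = expand p P * symbol F n w := by
  have hcen : ∀ (a : Fin n ⊕ Fin n) w, gen F a ^ p * w = w * gen F a ^ p := fun a w =>
    gen_pow_char_commute (p := p) (AlgHom.id F _) a w
  obtain ⟨j, hj⟩ := exists_algHom_of_commute (R := F) (fun a : Fin n ⊕ Fin n => gen F a ^ p)
    fun a b => hcen a _
  have hl : ∀ i w (k : ℕ), symbol F n (gen F (.inl i) ^ k * w) = X (.inl i) ^ k * symbol F n w := by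
    intro i w k
    induction k with
    | zero => simp
    | succ k ih => rw [pow_succ', mul_assoc, symbol_x_mul, ih]; ring
  have hr : ∀ i w (k : ℕ), symbol F n (w * gen F (.inr i) ^ k) = X (.inr i) ^ k * symbol F n w := by
    intro i w k
    induction k with
    | zero => simp
    | succ k ih => rw [pow_succ, ← mul_assoc, symbol_mul_d, ih]; ring
  refine ⟨j, hj, fun P w => ?_, fun P w => ?_⟩
  · induction P using MvPolynomial.induction_on with
    | C c => rw [MvPolynomial.algHom_C]; exact Algebra.commutes c w
    | add P Q hP hQ => rw [map_add, add_mul, hP, hQ, mul_add]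
    | mul_X P i hP => rw [_root_.map_mul, hj, mul_assoc, hcen, ← mul_assoc, hP, mul_assoc]
  · induction P using MvPolynomial.induction_on generalizing w with
    | C c =>
      rw [MvPolynomial.algHom_C, ← Algebra.smul_def, map_smul, expand_C, MvPolynomial.smul_eq_C_mul]
    | add P Q hP hQ => rw [map_add, add_mul, map_add, hP, hQ, map_add, add_mul]
    | mul_X P i hP =>
      rw [_root_.map_mul j, hj, mul_assoc, hP, _root_.map_mul (expand p), expand_X, mul_assoc]
      congr 1
      rcases i with i | i
      · exact hl i w p
      · rw [hcen, hr]

/-- The embedding of the polynomial ring onto the centre of the Weyl algebra in characteristic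
`p`, with `xᵢ ↦ xᵢ^p` and `yᵢ ↦ ∂ᵢ^p`. -/
noncomputable def frobCenter (F : Type*) [Field F] (p : ℕ) [Fact p.Prime] [CharP F p] (n : ℕ) :
    MvPolynomial (Fin n ⊕ Fin n) F →ₐ[F] WeylAlgebra F n :=
  (exists_frobeniusCenter F p n).choose

theorem frobCenter_X (a : Fin n ⊕ Fin n) : frobCenter F p n (X a) = gen F a ^ p :=
  (exists_frobeniusCenter F p n).choose_spec.1 a

theorem frobCenter_commute (P : MvPolynomial (Fin n ⊕ Fin n) F) (w : WeylAlgebra F n) :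
    frobCenter F p n P * w = w * frobCenter F p n P :=
  (exists_frobeniusCenter F p n).choose_spec.2.1 P w

theorem symbol_frobCenter_mul (P : MvPolynomial (Fin n ⊕ Fin n) F) (w : WeylAlgebra F n) :
    symbol F n (frobCenter F p n P * w) = expand p P * symbol F n w :=
  (exists_frobeniusCenter F p n).choose_spec.2.2 P w

theorem symbol_frobCenter (P : MvPolynomial (Fin n ⊕ Fin n) F) :
    symbol F n (frobCenter F p n P) = expand p P := by
  have := symbol_frobCenter_mul (p := p) P 1
  rwa [mul_one, symbol_one, mul_one] at this

theorem frobCenter_injective : Function.Injective (frobCenter F p n) := fun P Q h => by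
  apply expand_injective (Nat.Prime.pos (Fact.out : p.Prime))
  rw [← symbol_frobCenter, h, symbol_frobCenter]

/-- All partial derivatives of the symbol vanish, so its exponents are divisible by p. -/
theorem exists_frobCenter_of_commute {z : WeylAlgebra F n} (h : ∀ a, gen F a * z = z * gen F a) :
    ∃ P, z = frobCenter F p n P := by
  obtain ⟨P, hP⟩ := exists_expand_of_pderiv_eq_zero (p := p) (symbol F n z) fun i => by
    rw [← symbol_dualOp, dualOp_eq_zero_of_commute h, map_zero]
  exact ⟨P, (symbol F n).injective (by rw [hP, symbol_frobCenter])⟩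

/-- The element `x^α ∂^β` of the Weyl algebra. -/
noncomputable def basisElt (R : Type*) [CommRing R] {n : ℕ} (m : Fin n ⊕ Fin n →₀ ℕ) :
    WeylAlgebra R n := (symbol R n).symm (monomial m 1)

theorem basisElt_zero {R : Type*} [CommRing R] : basisElt R (0 : Fin n ⊕ Fin n →₀ ℕ) = 1 := by
  rw [basisElt, LinearEquiv.symm_apply_eq, symbol_one]; rfl

theorem dualOp_basisElt {R : Type*} [CommRing R] (i : Fin n ⊕ Fin n) (m : Fin n ⊕ Fin n →₀ ℕ) :
    dualOp R (gen R) i (basisElt R m) = (m i : R) • basisElt R (m - Finsupp.single i 1) := by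
  apply (symbol R n).injective
  rw [symbol_dualOp, map_smul, basisElt, basisElt, LinearEquiv.apply_symm_apply,
    LinearEquiv.apply_symm_apply, pderiv_monomial, smul_monomial, one_mul, smul_eq_mul, mul_one]

theorem exists_eq_sum_frobCenter_mul (w : WeylAlgebra F n) :
    ∃ P : (Fin n ⊕ Fin n → Fin p) → MvPolynomial (Fin n ⊕ Fin n) F,
      w = ∑ f, frobCenter F p n (P f) * basisElt F (boxExponent f) := by
  obtain ⟨P, hP⟩ := exists_eq_sum_expand_mul (p := p) (Nat.Prime.pos Fact.out) (symbol F n w)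
  refine ⟨P, (symbol F n).injective ?_⟩
  rw [hP, map_sum]
  exact Finset.sum_congr rfl fun f _ => by
    rw [symbol_frobCenter_mul, basisElt, LinearEquiv.apply_symm_apply]

omit [Fact p.Prime] in
/-- The elements `φ(x^α ∂^β)` with exponents less than `p` are linearly independent over the
centralizer of the image of `φ`. -/
theorem eq_zero_of_sum_mul_eq_zero {A : Type*} [Ring A] [Algebra F A]
    (φ : WeylAlgebra F n →ₐ[F] A) (D : ℕ)
    (s : Finset (Fin n ⊕ Fin n →₀ ℕ)) (hs : ∀ m ∈ s, m.degree < D ∧ ∀ i, m i < p)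
    (c : (Fin n ⊕ Fin n →₀ ℕ) → A) (hc : ∀ m w, φ w * c m = c m * φ w)
    (h : ∑ m ∈ s, c m * φ (basisElt F m) = 0) : ∀ m ∈ s, c m = 0 := by
  classical
  induction D generalizing s c with
  | zero => intro m hm; exact absurd (hs m hm).1 (Nat.not_lt_zero _)
  | succ D ih =>
    -- The i-th dual operator kills the coefficients and lowers exponents, leaving a relation of
    -- smaller degree with coefficients m_i c_m; the integer m_i is invertible because 0 < m_i < p.
    have hne : ∀ m ∈ s, ∀ i, m i ≠ 0 → c m = 0 := by
      intro m hm i hi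
      let s' := (s.filter fun m => m i ≠ 0).image fun m => m - Finsupp.single i 1
      let c' : (Fin n ⊕ Fin n →₀ ℕ) → A := fun m =>
        ((m i + 1 : ℕ) : F) • c (m + Finsupp.single i 1)
      have hcancel : ∀ m : Fin n ⊕ Fin n →₀ ℕ, m i ≠ 0 →
          m - Finsupp.single i 1 + Finsupp.single i 1 = m := fun m hm =>
        tsub_add_cancel_of_le (by rw [Finsupp.single_le_iff]; omega)
      have hcast : ∀ m : Fin n ⊕ Fin n →₀ ℕ, m i ≠ 0 →
          (m - Finsupp.single i 1 : Fin n ⊕ Fin n →₀ ℕ) i + 1 = m i := fun m hm => by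
        simp only [Finsupp.tsub_apply, Finsupp.single_eq_same]; omega
      have hsum : ∑ m ∈ s', c' m * φ (basisElt F m) = 0 := by
        rw [Finset.sum_image]
        · have h1 := congrArg (dualOp F (fun a => φ (gen F a)) i) h
          rw [map_sum, map_zero, ← Finset.sum_filter_add_sum_filter_not s (fun m => m i ≠ 0)] at h1
          have hterm : ∀ m, dualOp F (fun a => φ (gen F a)) i (c m * φ (basisElt F m))
              = (m i : F) • (c m * φ (basisElt F (m - Finsupp.single i 1))) := by
            intro m
            rw [dualOp_mul, dualOp_eq_zero_of_commute (fun a => hc m _), zero_mul, zero_add,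
              dualOp_algHom, dualOp_basisElt, map_smul, mul_smul_comm]
          rw [Finset.sum_eq_zero (s := s.filter fun m => ¬ m i ≠ 0), add_zero] at h1
          · rw [← h1]
            refine Finset.sum_congr rfl fun m hm => ?_
            have hm' := (Finset.mem_filter.1 hm).2
            rw [hterm]
            simp only [c']
            rw [hcancel m hm', hcast m hm', smul_mul_assoc]
          · intro m hm
            have hm' := (Finset.mem_filter.1 hm).2
            push Not at hm'
            rw [hterm, hm', Nat.cast_zero, zero_smul]
        · intro m hm m' hm' hmm
          have h1 := (Finset.mem_filter.1 hm).2
          have h2 := (Finset.mem_filter.1 hm').2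
          rw [← hcancel m h1, ← hcancel m' h2]
          exact congrArg (· + Finsupp.single i 1) hmm
      have h2 := ih s' (by
        intro m' hm'
        obtain ⟨m, hm, rfl⟩ := Finset.mem_image.1 hm'
        obtain ⟨hms, hmi⟩ := Finset.mem_filter.1 hm
        refine ⟨?_, fun k => lt_of_le_of_lt ?_ ((hs m hms).2 k)⟩
        · have h3 := congrArg Finsupp.degree (hcancel m hmi)
          rw [map_add, Finsupp.degree_single] at h3
          have := (hs m hms).1
          omega
        · simp [Finsupp.tsub_apply]) c' (by
        intro m w
        simp only [c']
        rw [mul_smul_comm, hc, smul_mul_assoc]) hsum (m - Finsupp.single i 1)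
        (Finset.mem_image.2 ⟨m, Finset.mem_filter.2 ⟨hm, hi⟩, rfl⟩)
      simp only [c'] at h2
      rw [hcancel m hi, hcast m hi] at h2
      have hmi : ((m i : ℕ) : F) ≠ 0 := by
        rw [Ne, CharP.cast_eq_zero_iff F p]
        exact Nat.not_dvd_of_pos_of_lt (Nat.pos_of_ne_zero hi) ((hs m hm).2 i)
      exact (smul_eq_zero_iff_right hmi).1 h2
    intro m hm
    by_cases hm0 : m = 0
    · rw [Finset.sum_eq_single m] at h
      · subst hm0
        rwa [basisElt_zero, map_one, mul_one] at h
      · intro m' hm' hne'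
        obtain ⟨i, hi⟩ : ∃ i, m' i ≠ 0 := by
          by_contra hcon
          push Not at hcon
          exact hne' ((Finsupp.ext hcon : m' = 0).trans hm0.symm)
        rw [hne m' hm' i hi, zero_mul]
      · exact fun h => absurd hm h
    · obtain ⟨i, hi⟩ : ∃ i, m i ≠ 0 := by
        by_contra hcon
        push Not at hcon
        exact hm0 (Finsupp.ext hcon)
      exact hne m hm i hi

omit [Fact p.Prime] in
theorem eq_zero_of_sum_box_mul_eq_zero {A : Type*} [Ring A] [Algebra F A]
    (φ : WeylAlgebra F n →ₐ[F] A) (c : (Fin n ⊕ Fin n → Fin p) → A)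
    (hc : ∀ f w, φ w * c f = c f * φ w)
    (h : ∑ f, c f * φ (basisElt F (boxExponent f)) = 0) : c = 0 := by
  classical
  let c' : (Fin n ⊕ Fin n →₀ ℕ) → A := Function.extend boxExponent c 0
  have hc' : ∀ f, c' (boxExponent f) = c f := fun f => boxExponent_injective.extend_apply c 0 f
  let s : Finset (Fin n ⊕ Fin n →₀ ℕ) := Finset.univ.image (boxExponent (p := p))
  have key := eq_zero_of_sum_mul_eq_zero (p := p) φ ((s.sup Finsupp.degree) + 1) s (by
    intro m hm
    refine ⟨Nat.lt_succ_of_le (Finset.le_sup (f := Finsupp.degree) hm), fun i => ?_⟩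
    obtain ⟨f, -, rfl⟩ := Finset.mem_image.1 hm
    exact (f i).2) c' (by
    intro m w
    by_cases hm : ∃ f, boxExponent (p := p) f = m
    · obtain ⟨f, rfl⟩ := hm
      rw [hc', hc]
    · simp only [c']
      rw [Function.extend_apply' _ _ _ hm]
      simp) (by
    rw [Finset.sum_image (fun f _ g _ hfg => boxExponent_injective hfg), ← h]
    exact Finset.sum_congr rfl fun f _ => by rw [hc'])
  funext f
  rw [← hc']
  exact key _ (Finset.mem_image_of_mem _ (Finset.mem_univ f))

end WeylAlgebra
end CharP

/-! ### Endomorphisms in characteristic p and the maps they induce on the centre -/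

section CharPEndomorphisms

theorem mul_commutator_eq_zero {A : Type*} [Ring A] {a z c w : A} (h : a + z * c = 0)
    (ha : a * w = w * a) (hz : z * w = w * z) : z * (c * w - w * c) = 0 := by
  have h3 : z * c = -a := eq_neg_of_add_eq_zero_right h
  rw [mul_sub, ← mul_assoc, h3, ← mul_assoc, hz, mul_assoc, h3, neg_mul, mul_neg, ha, sub_self]

namespace WeylAlgebra

variable {F : Type*} [Field F] {p : ℕ} [Fact p.Prime] [CharP F p] {n : ℕ}

/-- The centralizer of the image of an endomorphism is the centre. -/
theorem commute_of_commute_algHom (φ : WeylAlgebra F n →ₐ[F] WeylAlgebra F n) (p : ℕ)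
    [Fact p.Prime] [CharP F p] {c : WeylAlgebra F n} (hc : ∀ w, φ w * c = c * φ w)
    (w : WeylAlgebra F n) : c * w = w * c := by
  classical
  -- One element more than the p^{2n} that span the algebra over its centre, hence a nontrivial
  -- central relation.
  let v : Option (Fin n ⊕ Fin n → Fin p) → WeylAlgebra F n := fun j =>
    j.elim c fun f => φ (basisElt F (boxExponent f))
  choose P hP using fun j => exists_eq_sum_frobCenter_mul (p := p) (v j)
  have hdep : ¬ LinearIndependent (MvPolynomial (Fin n ⊕ Fin n) F) P := by
    intro h
    have := h.fintype_card_le_finrank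
    rw [Module.finrank_fintype_fun_eq_card, Fintype.card_option] at this
    omega
  obtain ⟨z, hz, j₀, hj₀⟩ := Fintype.not_linearIndependent_iff.1 hdep
  have hsum : ∑ j, frobCenter F p n (z j) * v j = 0 := by
    have h1 : ∀ j, frobCenter F p n (z j) * v j
        = ∑ f, frobCenter F p n (z j * P j f) * basisElt F (boxExponent f) := fun j => by
      conv_lhs => rw [hP j, Finset.mul_sum]
      exact Finset.sum_congr rfl fun f _ => by rw [_root_.map_mul, mul_assoc]
    simp only [h1]
    rw [Finset.sum_comm]
    refine Finset.sum_eq_zero fun f _ => ?_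
    rw [← Finset.sum_mul, ← map_sum]
    have h2 := congrFun hz f
    simp only [Finset.sum_apply, Pi.smul_apply, smul_eq_mul, Pi.zero_apply] at h2
    rw [h2, map_zero, zero_mul]
  rw [Fintype.sum_option] at hsum
  let f₀ : Fin n ⊕ Fin n → Fin p := fun _ => ⟨0, Nat.Prime.pos Fact.out⟩
  have hf₀ : boxExponent f₀ = 0 := Finsupp.ext fun _ => rfl
  -- Since φ(1) = 1, the term with c joins the coefficient of the zero exponent. Independence over
  -- the centralizer then leaves z₀ + z·c = 0 with z ≠ 0 central, and z is not a zero divisor.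
  let c' : (Fin n ⊕ Fin n → Fin p) → WeylAlgebra F n := fun f =>
    frobCenter F p n (z (some f)) + if f = f₀ then frobCenter F p n (z none) * c else 0
  have hc' : c' = 0 := by
    refine eq_zero_of_sum_box_mul_eq_zero φ c' (fun f u => ?_) ?_
    · simp only [c']
      rw [mul_add, add_mul, frobCenter_commute _ (φ u)]
      refine congrArg₂ _ rfl ?_
      split_ifs
      · rw [← mul_assoc, ← frobCenter_commute, mul_assoc, hc, mul_assoc]
      · simp
    · rw [← hsum, add_comm]
      simp only [c', add_mul, ite_mul, zero_mul]
      rw [Finset.sum_add_distrib, Finset.sum_ite_eq' Finset.univ f₀, if_pos (Finset.mem_univ _),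
        hf₀, basisElt_zero, map_one, mul_one]
      rfl
  have h0 : frobCenter F p n (z (some f₀)) + frobCenter F p n (z none) * c = 0 := by
    simpa [c'] using congrFun hc' f₀
  have hne : ∀ f, f ≠ f₀ → z (some f) = 0 := fun f hf => by
    have h1 : frobCenter F p n (z (some f)) = 0 := by simpa [c', hf] using congrFun hc' f
    exact frobCenter_injective (h1.trans (map_zero _).symm)
  have hz0 : z none ≠ 0 := by
    intro h
    rw [h, map_zero, zero_mul, add_zero] at h0
    have h1 : z (some f₀) = 0 := frobCenter_injective (h0.trans (map_zero _).symm)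
    refine hj₀ ?_
    rcases j₀ with _ | f
    · exact h
    · by_cases hf : f = f₀
      · rw [hf, h1]
      · exact hne f hf
  have h2 := mul_commutator_eq_zero h0 (frobCenter_commute _ w) (frobCenter_commute _ w)
  have h4 := congrArg (symbol F n) h2
  rw [symbol_frobCenter_mul, map_zero, mul_eq_zero] at h4
  rcases h4 with h4 | h4
  · refine absurd (expand_injective (Nat.Prime.pos (Fact.out : p.Prime)) ?_) hz0
    rw [h4, map_zero]
  · rw [← sub_eq_zero]
    exact (symbol F n).injective (h4.trans (map_zero _).symm)

/-- An endomorphism of the Weyl algebra in characteristic `p` preserves the centre. -/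
theorem exists_frobCenter_algHom (φ : WeylAlgebra F n →ₐ[F] WeylAlgebra F n) :
    ∃ σ : MvPolynomial (Fin n ⊕ Fin n) F →ₐ[F] MvPolynomial (Fin n ⊕ Fin n) F,
      ∀ P, φ (frobCenter F p n P) = frobCenter F p n (σ P) := by
  have h : ∀ a, ∃ P, φ (gen F a) ^ p = frobCenter F p n P := fun a =>
    exists_frobCenter_of_commute fun b =>
      (commute_of_commute_algHom φ p (fun w => (gen_pow_char_commute φ a w).symm) _).symm
  choose G hG using h
  refine ⟨aeval G, fun P => ?_⟩
  have : φ.comp (frobCenter F p n) = (frobCenter F p n).comp (aeval G) :=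
    MvPolynomial.algHom_ext fun a => by simp [frobCenter_X, hG]
  exact DFunLike.congr_fun this P

/-- An element killed by all dual operators of the φ(g_a) centralises the image, so it is central
and is reached because σ is onto. General elements follow by releasing one operator at a time: each
is nilpotent, and Taylor expansion in φ(g_i) reduces to elements it kills. -/
theorem surjective_of_frobCenter_surjective (φ : WeylAlgebra F n →ₐ[F] WeylAlgebra F n)
    {σ : MvPolynomial (Fin n ⊕ Fin n) F →ₐ[F] MvPolynomial (Fin n ⊕ Fin n) F}
    (hσ : ∀ P, φ (frobCenter F p n P) = frobCenter F p n (σ P)) (hs : Function.Surjective σ) :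
    Function.Surjective φ := by
  classical
  have := charP_weylAlgebra F p n
  let g : Fin n ⊕ Fin n → WeylAlgebra F n := fun a => φ (gen F a)
  have hg : IsWeylSystem F g := fun a b => by
    simp only [g]
    rw [← _root_.map_mul, ← _root_.map_mul, ← map_sub, gen_isWeylSystem, AlgHom.commutes]
  have hcen : ∀ a w, g a ^ p * w = w * g a ^ p := fun a w => by
    simp only [g]
    rw [← map_pow, ← frobCenter_X, hσ, frobCenter_commute]
  suffices key : ∀ s : Finset (Fin n ⊕ Fin n), ∀ w, (∀ i, i ∉ s → dualOp F g i w = 0) →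
      w ∈ φ.range from fun w => key Finset.univ w fun i hi => absurd (Finset.mem_univ i) hi
  intro s
  induction s using Finset.induction_on with
  | empty =>
    intro w hw
    have h1 : ∀ a, g a * w = w * g a := commute_of_dualOp_eq_zero fun i => hw i (by simp)
    obtain ⟨P, rfl⟩ := exists_frobCenter_of_commute (p := p) fun a =>
      (commute_of_commute_algHom φ p (commute_of_commute_gen φ h1) (gen F a)).symm
    obtain ⟨Q, rfl⟩ := hs P
    exact ⟨frobCenter F p n Q, hσ Q⟩
  | insert i s his ih =>
    have key : ∀ k ≤ p, ∀ w, (∀ j, j ∉ insert i s → dualOp F g j w = 0) →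
        (dualOp F g i ^ k) w = 0 → w ∈ φ.range := by
      intro k
      induction k with
      | zero =>
        intro _ w _ hk
        have : w = 0 := hk
        rw [this]; exact zero_mem _
      | succ k ihk =>
        intro hkp w hw hk
        have hv : (dualOp F g i ^ k) w ∈ φ.range := by
          refine ih _ fun j hj => ?_
          by_cases hji : j = i
          · rw [hji, ← Module.End.mul_apply, ← pow_succ', hk]
          · have hcomm : Commute (dualOp F g j) (dualOp F g i) :=
              LinearMap.ext fun w => dualOp_comm hg j i w
            rw [← Module.End.mul_apply, (hcomm.pow_right k).eq, Module.End.mul_apply,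
              hw j (by simp [hji, hj]), map_zero]
        have hfac : ((k.factorial : ℕ) : F) ≠ 0 := by
          rw [Ne, CharP.cast_eq_zero_iff F p, (Fact.out : p.Prime).dvd_factorial]
          omega
        have hv0 : dualOp F g i ((dualOp F g i ^ k) w) = 0 := by
          rw [← Module.End.mul_apply, ← pow_succ', hk]
        -- Subtracting the Taylor term g_i^k D^k(w)/k! leaves something killed by D^k; k! is
        -- invertible since k < p.
        have hdiff := ihk (by omega)
          (w - (k.factorial : F)⁻¹ • (g i ^ k * (dualOp F g i ^ k) w)) (fun j hj => ?_) ?_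
        · have := add_mem hdiff (φ.range.smul_mem (mul_mem (pow_mem (show g i ∈ φ.range from ⟨gen F i, rfl⟩) k) hv)
            (k.factorial : F)⁻¹)
          rwa [sub_add_cancel] at this
        · have hji : j ≠ i := fun h => hj (by simp [h])
          have hcomm : Commute (dualOp F g j) (dualOp F g i) :=
            LinearMap.ext fun w => dualOp_comm hg j i w
          have h1 : dualOp F g j ((dualOp F g i ^ k) w) = 0 := by
            rw [← Module.End.mul_apply, (hcomm.pow_right k).eq, Module.End.mul_apply, hw j hj,
              map_zero]
          have h2 : ∀ m : ℕ, dualOp F g j (g i ^ m) = 0 := by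
            intro m
            induction m with
            | zero =>
              exact dualOp_eq_zero_of_commute (fun a => by simp) j
            | succ m ihm =>
              rw [pow_succ, dualOp_mul, ihm, dualOp_apply_self hg, if_neg hji, zero_mul, mul_zero,
                add_zero]
          rw [map_sub, hw j hj, map_smul, dualOp_mul, h1, h2, zero_mul, mul_zero, add_zero,
            smul_zero, sub_zero]
        · rw [map_sub, map_smul, dualOp_pow_apply_pow_mul hg i hv0, smul_smul,
            inv_mul_cancel₀ hfac, one_smul, sub_self]
    intro w hw
    exact key p le_rfl w hw (by rw [dualOp_pow_char hcen i]; rfl)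

theorem injective_of_frobCenter_injective (φ : WeylAlgebra F n →ₐ[F] WeylAlgebra F n)
    {σ : MvPolynomial (Fin n ⊕ Fin n) F →ₐ[F] MvPolynomial (Fin n ⊕ Fin n) F}
    (hσ : ∀ P, φ (frobCenter F p n P) = frobCenter F p n (σ P)) (hi : Function.Injective σ) :
    Function.Injective φ := by
  refine (injective_iff_map_eq_zero φ).2 fun w hw => ?_
  obtain ⟨P, rfl⟩ := exists_eq_sum_frobCenter_mul (p := p) w
  simp only [map_sum, _root_.map_mul, hσ] at hw
  have h := eq_zero_of_sum_box_mul_eq_zero φ (fun f => frobCenter F p n (σ (P f)))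
    (fun f w => (frobCenter_commute _ _).symm) hw
  refine Finset.sum_eq_zero fun f _ => ?_
  have h1 : P f = 0 := hi (frobCenter_injective (by rw [congrFun h f]; simp))
  rw [h1, map_zero, zero_mul]

end WeylAlgebra
end CharPEndomorphisms

/-! ### The Poisson bracket on the centre from commutators of lifts -/

section Deformation

/-- Left multiplication by d is ad d plus right multiplication by d. The two commute, so the
binomial theorem applies. -/
theorem pow_mul_pow_of_commutator_eq_one {A : Type*} [Ring A] {x d : A} (h : d * x - x * d = 1)
    (m l : ℕ) : d ^ m * x ^ l = ∑ k ∈ Finset.range (m + 1),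
      (m.choose k * l.descFactorial k) • (x ^ (l - k) * d ^ (m - k)) := by
  let D : Module.End ℤ A := LinearMap.mulLeft ℤ d - LinearMap.mulRight ℤ d
  have hD : ∀ k, (D ^ k) (x ^ l) = l.descFactorial k • x ^ (l - k) := by
    intro k
    induction k with
    | zero => simp
    | succ k ih =>
      have h1 := commutator_pow_of_commutator_eq (R := ℤ) (c := 1) (h.trans (map_one _).symm) (l - k)
      rw [pow_succ', Module.End.mul_apply, ih, map_nsmul]
      have h2 : D (x ^ (l - k)) = (l - k) • x ^ (l - (k + 1)) := by
        refine h1.trans ?_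
        rw [mul_one, Nat.cast_smul_eq_nsmul, Nat.sub_sub]
      rw [h2, ← mul_nsmul, Nat.descFactorial_succ]
  have hc : Commute D (LinearMap.mulRight ℤ d) :=
    (LinearMap.commute_mulLeft_right d d).sub_left (Commute.refl _)
  have h3 : LinearMap.mulLeft ℤ d = D + LinearMap.mulRight ℤ d := by simp [D]
  have h4 : d ^ m * x ^ l = (LinearMap.mulLeft ℤ d ^ m) (x ^ l) := by
    rw [LinearMap.pow_mulLeft, LinearMap.mulLeft_apply]
  rw [h4, h3, hc.add_pow, LinearMap.sum_apply]
  refine Finset.sum_congr rfl fun k _ => ?_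
  rw [(hc.pow_pow k (m - k)).eq, ← nsmul_eq_mul', LinearMap.smul_apply, Module.End.mul_apply, hD,
    LinearMap.pow_mulRight, LinearMap.mulRight_apply, smul_mul_assoc, mul_nsmul']

theorem commutator_eq_add_commutators {A : Type*} [Ring A] (a a' a₁ a₁' : A) :
    a₁ * a₁' - a₁' * a₁ = (a * a' - a' * a) + (a * (a₁' - a') - (a₁' - a') * a)
      + ((a₁ - a) * a₁' - a₁' * (a₁ - a)) := by
  noncomm_ring

theorem commutator_mul_right {A : Type*} [Ring A] (a u v : A) :
    a * (u * v) - u * v * a = (a * u - u * a) * v + u * (a * v - v * a) := by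
  noncomm_ring

theorem commutator_add_right {A : Type*} [Ring A] (a u v : A) :
    a * (u + v) - (u + v) * a = (a * u - u * a) + (a * v - v * a) := by
  noncomm_ring

namespace WeylAlgebra

variable {R : Type*} [CommRing R] {p : ℕ} [Fact p.Prime] {n : ℕ} {f : R →+* ZMod p}

/-- In the expansion of [∂^p, x^p] every term is divisible by p. After division by p, the terms with
0 < k < p keep a factor p from the binomial coefficient, and k = p leaves (p - 1)! ≡ -1 by Wilson's
theorem. This is the source of the minus sign in `LiftsBracket`. -/
theorem exists_commutator_gen_pow (f : R →+* ZMod p) (a b : Fin n ⊕ Fin n) :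
    ∃ c : WeylAlgebra R n, gen R a ^ p * gen R b ^ p - gen R b ^ p * gen R a ^ p = (p : R) • c ∧
      map f n c = - algebraMap (ZMod p) _ (weylForm (ZMod p) a b) := by
  have hpos : 0 < p := Nat.Prime.pos Fact.out
  have key : ∀ i : Fin n, ∃ c : WeylAlgebra R n, gen R (.inr i) ^ p * gen R (.inl i) ^ p
      - gen R (.inl i) ^ p * gen R (.inr i) ^ p = (p : R) • c ∧ map f n c = -1 := by
    intro i
    have h1 : gen R (Sum.inr i) * gen R (Sum.inl i) - gen R (Sum.inl i) * gen R (Sum.inr i)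
        = 1 := by
      rw [gen_isWeylSystem]; simp [weylForm]
    obtain ⟨q, rfl⟩ : ∃ q, p = q + 1 := ⟨p - 1, by omega⟩
    refine ⟨∑ k ∈ Finset.range (q + 1), ((q + 1).choose (k + 1) * q.descFactorial k) •
      (gen R (.inl i) ^ (q + 1 - (k + 1)) * gen R (.inr i) ^ (q + 1 - (k + 1))), ?_, ?_⟩
    · rw [pow_mul_pow_of_commutator_eq_one h1, Finset.sum_range_succ', Nat.choose_zero_right,
        Nat.descFactorial_zero, mul_one, one_smul, Nat.sub_zero, add_sub_cancel_right,
        Nat.cast_smul_eq_nsmul, Finset.smul_sum]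
      refine Finset.sum_congr rfl fun k _ => ?_
      rw [smul_smul, Nat.succ_descFactorial_succ]
      congr 1
      ring
    · have := charP_weylAlgebra (ZMod (q + 1)) (q + 1) n
      rw [map_sum, Finset.sum_range_succ, Finset.sum_eq_zero, zero_add]
      · rw [map_nsmul, Nat.sub_self, pow_zero, pow_zero, mul_one, map_one, Nat.choose_self, one_mul,
          Nat.descFactorial_self, nsmul_one, ← map_natCast (algebraMap (ZMod (q + 1)) _)]
        have := ZMod.wilsons_lemma (q + 1)
        rw [Nat.add_sub_cancel] at this
        rw [this, map_neg, map_one]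
      · intro k hk
        have hk' := Finset.mem_range.1 hk
        obtain ⟨e, he⟩ := (Fact.out : (q + 1).Prime).dvd_choose_self (k := k + 1) (by omega)
          (by omega)
        rw [he, mul_assoc, mul_nsmul', map_nsmul, nsmul_eq_mul, CharP.cast_eq_zero, zero_mul]
  have hzero : weylForm R a b = 0 → weylForm (ZMod p) a b = 0 →
      ∃ c : WeylAlgebra R n, gen R a ^ p * gen R b ^ p - gen R b ^ p * gen R a ^ p = (p : R) • c ∧
      map f n c = - algebraMap (ZMod p) _ (weylForm (ZMod p) a b) := by
    intro h h'
    have h1 := gen_isWeylSystem (R := R) a b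
    rw [h, map_zero, sub_eq_zero] at h1
    refine ⟨0, ?_, by simp [h']⟩
    have h2 : Commute (gen R a) (gen R b) := h1
    rw [smul_zero, (h2.pow_pow p p).eq, sub_self]
  rcases a with i | i <;> rcases b with j | j
  · exact hzero rfl rfl
  · by_cases hij : i = j
    · subst hij
      obtain ⟨c, hc1, hc2⟩ := key i
      refine ⟨-c, ?_, ?_⟩
      · rw [smul_neg, ← hc1, neg_sub]
      · rw [map_neg, hc2]; simp [weylForm]
    · exact hzero (if_neg hij) (if_neg hij)
  · by_cases hij : i = j
    · subst hij
      obtain ⟨c, hc1, hc2⟩ := key i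
      exact ⟨c, hc1, by rw [hc2]; simp [weylForm]⟩
    · exact hzero (if_neg hij) (if_neg hij)
  · exact hzero rfl rfl

theorem eq_smul_of_map_eq_zero (hker : ∀ r, f r = 0 → ∃ s, r = p * s) {w : WeylAlgebra R n}
    (hw : map f n w = 0) : ∃ u, w = (p : R) • u := by
  have h1 : ∀ m, ∃ s, coeff m (symbol R n w) = p * s := fun m => hker _ (by
    rw [← coeff_map, ← symbol_map, hw, map_zero, coeff_zero])
  choose s hs using h1
  refine ⟨(symbol R n).symm (∑ m ∈ (symbol R n w).support, monomial m (s m)), ?_⟩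
  rw [← map_smul, LinearEquiv.eq_symm_apply, Finset.smul_sum]
  conv_lhs => rw [← support_sum_monomial_coeff (symbol R n w)]
  exact Finset.sum_congr rfl fun m _ => by rw [smul_monomial, smul_eq_mul, hs]

omit [Fact p.Prime] in
theorem smul_prime_injective (htf : ∀ r : R, p * r = 0 → r = 0) {u v : WeylAlgebra R n}
    (h : (p : R) • u = (p : R) • v) : u = v := by
  apply (symbol R n).injective
  ext m
  rw [← sub_eq_zero]
  apply htf
  have h1 := congrArg (fun w => coeff m (symbol R n w)) h
  simp only [map_smul, coeff_smul, smul_eq_mul] at h1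
  rw [mul_sub, h1, sub_self]

/-- The commutator of lifts of central elements reduces to minus their Poisson bracket. -/
def LiftsBracket (f : R →+* ZMod p) (z z' : MvPolynomial (Fin n ⊕ Fin n) (ZMod p)) : Prop :=
  ∀ a a', map f n a = frobCenter (ZMod p) p n z → map f n a' = frobCenter (ZMod p) p n z' →
    ∃ b, a * a' - a' * a = (p : R) • b ∧
      map f n b = frobCenter (ZMod p) p n (-poissonBracket z z')

/-- Independence of the lifts: changing them by multiples of p alters the divided commutator by
commutators that involve, modulo p, a central element. -/
theorem liftsBracket_of_exists (hker : ∀ r, f r = 0 → ∃ s, r = p * s)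
    {z z' : MvPolynomial (Fin n ⊕ Fin n) (ZMod p)} {a a' b : WeylAlgebra R n}
    (ha : map f n a = frobCenter (ZMod p) p n z) (ha' : map f n a' = frobCenter (ZMod p) p n z')
    (hb : a * a' - a' * a = (p : R) • b)
    (hb' : map f n b = frobCenter (ZMod p) p n (-poissonBracket z z')) : LiftsBracket f z z' := by
  intro a₁ a₁' ha₁ ha₁'
  obtain ⟨u, hu⟩ := eq_smul_of_map_eq_zero hker (w := a₁ - a) (by rw [map_sub, ha, ha₁, sub_self])
  obtain ⟨u', hu'⟩ := eq_smul_of_map_eq_zero hker (w := a₁' - a')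
    (by rw [map_sub, ha', ha₁', sub_self])
  have := charP_weylAlgebra (ZMod p) p n
  refine ⟨b + (a * u' - u' * a) + (u * a₁' - a₁' * u), ?_, ?_⟩
  · rw [commutator_eq_add_commutators a a' a₁ a₁', hu, hu', hb]
    simp only [mul_smul_comm, smul_mul_assoc, smul_add, smul_sub]
  · simp only [map_add, map_sub, _root_.map_mul, ha, ha₁', frobCenter_commute _ (map f n u'),
      frobCenter_commute _ (map f n u)]
    rw [sub_self, sub_self, add_zero, add_zero, hb']

theorem LiftsBracket.swap {z z' : MvPolynomial (Fin n ⊕ Fin n) (ZMod p)}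
    (h : LiftsBracket f z z') : LiftsBracket f z' z := by
  intro a a' ha ha'
  obtain ⟨b, hb, hb'⟩ := h a' a ha' ha
  refine ⟨-b, ?_, ?_⟩
  · rw [smul_neg, ← hb, neg_sub]
  · rw [map_neg, hb', ← map_neg, poissonBracket_swap z z']

/-- Both the divided commutator and the bracket are derivations in the second argument, so agreement
on variables suffices. -/
theorem liftsBracket_of_forall_X (hf : Function.Surjective f)
    (hker : ∀ r, f r = 0 → ∃ s, r = p * s) {z : MvPolynomial (Fin n ⊕ Fin n) (ZMod p)}
    (h : ∀ b, LiftsBracket f z (X b)) (z' : MvPolynomial (Fin n ⊕ Fin n) (ZMod p)) :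
    LiftsBracket f z z' := by
  obtain ⟨a, ha⟩ := map_surjective (n := n) f hf (frobCenter (ZMod p) p n z)
  induction z' using MvPolynomial.induction_on with
  | C c =>
    obtain ⟨r, rfl⟩ := hf c
    refine liftsBracket_of_exists hker (b := 0) ha (a' := algebraMap R _ r) ?_ ?_ ?_
    · rw [map_algebraMap, MvPolynomial.algHom_C]
    · rw [← Algebra.commutes, sub_self, smul_zero]
    · rw [poissonBracket_C_right, neg_zero, map_zero, map_zero]
  | add P Q hP hQ =>
    obtain ⟨u, hu⟩ := map_surjective (n := n) f hf (frobCenter (ZMod p) p n P)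
    obtain ⟨v, hv⟩ := map_surjective (n := n) f hf (frobCenter (ZMod p) p n Q)
    obtain ⟨b, hb, hb'⟩ := hP a u ha hu
    obtain ⟨c, hc, hc'⟩ := hQ a v ha hv
    refine liftsBracket_of_exists hker (b := b + c) ha (a' := u + v) ?_ ?_ ?_
    · rw [map_add, hu, hv, map_add]
    · rw [smul_add, ← hb, ← hc, commutator_add_right]
    · rw [map_add, hb', hc', ← map_add, poissonBracket_add_right, neg_add]
  | mul_X P j hP =>
    obtain ⟨u, hu⟩ := map_surjective (n := n) f hf (frobCenter (ZMod p) p n P)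
    obtain ⟨v, hv⟩ := map_surjective (n := n) f hf (frobCenter (ZMod p) p n (X j))
    obtain ⟨b, hb, hb'⟩ := hP a u ha hu
    obtain ⟨c, hc, hc'⟩ := h j a v ha hv
    refine liftsBracket_of_exists hker (b := b * v + u * c) ha (a' := u * v) ?_ ?_ ?_
    · rw [_root_.map_mul, hu, hv, _root_.map_mul]
    · rw [smul_add, ← smul_mul_assoc, ← mul_smul_comm, ← hb, ← hc, commutator_mul_right]
    · rw [map_add, _root_.map_mul, _root_.map_mul, hb', hc', hu, hv, ← _root_.map_mul,
        ← _root_.map_mul, ← map_add, poissonBracket_mul_right]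
      congr 1
      ring

theorem liftsBracket (hf : Function.Surjective f) (hker : ∀ r, f r = 0 → ∃ s, r = p * s)
    (z z' : MvPolynomial (Fin n ⊕ Fin n) (ZMod p)) : LiftsBracket f z z' := by
  refine liftsBracket_of_forall_X hf hker (fun b => LiftsBracket.swap ?_) z'
  refine liftsBracket_of_forall_X hf hker (fun a => ?_) z
  obtain ⟨c, hc, hc'⟩ := exists_commutator_gen_pow f b a
  refine liftsBracket_of_exists hker (a := gen R b ^ p) (a' := gen R a ^ p) ?_ ?_ hc ?_
  · rw [map_pow, map_gen, frobCenter_X]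
  · rw [map_pow, map_gen, frobCenter_X]
  · rw [hc', poissonBracket_X_X, map_neg, MvPolynomial.algHom_C]

/-- The endomorphism induced on the centre by the reduction of an endomorphism preserves the
Poisson bracket. -/
theorem poissonBracket_of_lift (hf : Function.Surjective f) (hker : ∀ r, f r = 0 → ∃ s, r = p * s)
    (htf : ∀ r : R, p * r = 0 → r = 0) (Φ : WeylAlgebra R n →ₐ[R] WeylAlgebra R n)
    (φ : WeylAlgebra (ZMod p) n →ₐ[ZMod p] WeylAlgebra (ZMod p) n)
    (hφ : ∀ w, map f n (Φ w) = φ (map f n w))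
    {σ : MvPolynomial (Fin n ⊕ Fin n) (ZMod p) →ₐ[ZMod p] MvPolynomial (Fin n ⊕ Fin n) (ZMod p)}
    (hσ : ∀ P, φ (frobCenter (ZMod p) p n P) = frobCenter (ZMod p) p n (σ P))
    (a b : Fin n ⊕ Fin n) :
    poissonBracket (σ (X a)) (σ (X b)) = C (weylForm (ZMod p) a b) := by
  obtain ⟨c, hc, hc'⟩ := exists_commutator_gen_pow f a b
  have hlift : ∀ a, map f n (Φ (gen R a ^ p)) = frobCenter (ZMod p) p n (σ (X a)) := fun a => by
    rw [hφ, map_pow, map_gen, ← frobCenter_X, hσ]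
  obtain ⟨e, he, he'⟩ := liftsBracket hf hker _ _ _ _ (hlift a) (hlift b)
  -- Φ carries [g_a^p, g_b^p] = p·c to the commutator of lifts of σ(x_a) and σ(x_b);
  -- torsion-freeness allows division by p.
  have h1 : e = Φ c := smul_prime_injective htf (by
    rw [← he, ← map_smul, ← hc, map_sub, _root_.map_mul Φ, _root_.map_mul Φ])
  rw [h1, hφ, hc', map_neg, map_neg, neg_inj, AlgHom.commutes] at he'
  apply frobCenter_injective (F := ZMod p) (p := p)
  rw [← he', MvPolynomial.algHom_C]

end WeylAlgebra
end Deformation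

/-! ### JC in all dimensions implies DC -/

section JacobianImpliesDixmier

theorem MvPolynomial.totalDegree_map_le {R S ι : Type*} [CommRing R] [CommRing S] (f : R →+* S)
    (P : MvPolynomial ι R) : (MvPolynomial.map f P).totalDegree ≤ P.totalDegree :=
  Finset.sup_mono (support_map_subset f P)

theorem MvPolynomial.totalDegree_map_of_injective {R S ι : Type*} [CommRing R] [CommRing S]
    {f : R →+* S} (hf : Function.Injective f) (P : MvPolynomial ι R) :
    (MvPolynomial.map f P).totalDegree = P.totalDegree := by
  rw [totalDegree, totalDegree, support_map_of_injective P hf]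

namespace WeylAlgebra

theorem map_algHom_of_map_gen {R S : Type*} [CommRing R] [CommRing S] {f : R →+* S} {n : ℕ}
    {φ : WeylAlgebra R n →ₐ[R] WeylAlgebra R n} {ψ : WeylAlgebra S n →ₐ[S] WeylAlgebra S n}
    (h : ∀ a, map f n (φ (gen R a)) = ψ (gen S a)) (w : WeylAlgebra R n) :
    map f n (φ w) = ψ (map f n w) := by
  induction w using induction_left with
  | h1 => simp
  | hadd a b ha hb => simp only [map_add, ha, hb]
  | hsmul r a ha =>
    rw [map_smul, Algebra.smul_def, Algebra.smul_def, _root_.map_mul, _root_.map_mul, ha,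
      map_algebraMap, _root_.map_mul, AlgHom.commutes]
  | hmul i a ha => simp only [_root_.map_mul, ha, h, map_gen]

theorem exists_baseChange {R S : Type*} [CommRing R] [CommRing S] (f : R →+* S) {n : ℕ}
    (φ : WeylAlgebra R n →ₐ[R] WeylAlgebra R n) :
    ∃ ψ : WeylAlgebra S n →ₐ[S] WeylAlgebra S n, ∀ w, map f n (φ w) = ψ (map f n w) := by
  obtain ⟨ψ, hψ⟩ := exists_lift (R := S) (g := fun a => map f n (φ (gen R a))) (fun a b => by
    dsimp only
    rw [← _root_.map_mul (map f n), ← _root_.map_mul (map f n), ← map_sub, ← _root_.map_mul φ,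
      ← _root_.map_mul φ,
      ← map_sub, gen_isWeylSystem, AlgHom.commutes, map_algebraMap, map_weylForm])
  exact ⟨ψ, map_algHom_of_map_gen fun a => (hψ a).symm⟩

theorem exists_restrictScalars {R S : Type*} [CommRing R] [CommRing S] {f : R →+* S}
    (hf : Function.Injective f) {n : ℕ} (ψ : WeylAlgebra S n →ₐ[S] WeylAlgebra S n)
    (h : ∀ a, ψ (gen S a) ∈ Set.range (map f n)) :
    ∃ φ : WeylAlgebra R n →ₐ[R] WeylAlgebra R n, ∀ w, map f n (φ w) = ψ (map f n w) := by
  choose g hg using h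
  obtain ⟨φ, hφ⟩ := exists_lift (R := R) (g := g) (fun a b => by
    apply map_injective (n := n) f hf
    rw [map_sub, _root_.map_mul, _root_.map_mul, hg, hg, ← _root_.map_mul, ← _root_.map_mul,
      ← map_sub, gen_isWeylSystem, AlgHom.commutes, map_algebraMap, map_weylForm])
  exact ⟨φ, map_algHom_of_map_gen fun a => by rw [hφ, hg]⟩

theorem mem_range_map_of_coeffs {R S : Type*} [CommRing R] [CommRing S] {f : R →+* S} {n : ℕ}
    {w : WeylAlgebra S n} (h : ∀ c ∈ (symbol S n w).coeffs, c ∈ Set.range f) :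
    w ∈ Set.range (map f n) := by
  obtain ⟨P, hP⟩ := mem_range_map_iff_coeffs_subset.2 h
  exact ⟨(symbol R n).symm P, (symbol S n).injective (by
    rw [symbol_map, LinearEquiv.apply_symm_apply, hP])⟩

theorem map_basisElt {R S : Type*} [CommRing R] [CommRing S] (f : R →+* S) {n : ℕ}
    (m : Fin n ⊕ Fin n →₀ ℕ) : map f n (basisElt R m) = basisElt S m := by
  apply (symbol S n).injective
  rw [symbol_map, basisElt, basisElt, LinearEquiv.apply_symm_apply, LinearEquiv.apply_symm_apply,
    map_monomial, map_one]

theorem eq_sum_basisElt {R : Type*} [CommRing R] {n : ℕ} (w : WeylAlgebra R n) :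
    w = ∑ m ∈ (symbol R n w).support, coeff m (symbol R n w) • basisElt R m := by
  apply (symbol R n).injective
  rw [map_sum]
  conv_lhs => rw [← support_sum_monomial_coeff (symbol R n w)]
  exact Finset.sum_congr rfl fun m _ => by
    rw [map_smul, basisElt, LinearEquiv.apply_symm_apply, smul_monomial, smul_eq_mul, mul_one]

/-- Every generator is the image of an element of bounded degree, for the reduction modulo a large
prime of an endomorphism of the Weyl algebra over the `p`-adic integers. -/
theorem exists_bounded_preimage {p : ℕ} [Fact p.Prime] {n d B : ℕ}
    (hp : ∀ i, ∀ σ : MvPolynomial (Fin n ⊕ Fin n) (ZMod p) →ₐ[ZMod p]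
        MvPolynomial (Fin n ⊕ Fin n) (ZMod p),
      (∀ j, (σ (X j)).totalDegree ≤ d) → (jacobian σ).det ^ 2 = 1 →
      ∃ G, σ G = X i ∧ G.totalDegree ≤ B)
    (Φ : WeylAlgebra ℤ_[p] n →ₐ[ℤ_[p]] WeylAlgebra ℤ_[p] n)
    (φ : WeylAlgebra (ZMod p) n →ₐ[ZMod p] WeylAlgebra (ZMod p) n)
    (hφ : ∀ w, map PadicInt.toZMod n (Φ w) = φ (map PadicInt.toZMod n w))
    (hd : ∀ a, (symbol (ZMod p) n (φ (gen (ZMod p) a))).totalDegree ≤ d) (i : Fin n ⊕ Fin n) :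
    ∃ a, φ a = gen (ZMod p) i ∧ (symbol (ZMod p) n a).totalDegree ≤ B := by
  have hpos : 0 < p := Nat.Prime.pos Fact.out
  obtain ⟨σ, hσ⟩ := exists_frobCenter_algHom (p := p) φ
  have hdet : (jacobian σ).det ^ 2 = 1 := det_jacobian_sq_eq_one σ <|
    poissonBracket_of_lift (ZMod.ringHom_surjective PadicInt.toZMod) (fun r hr => by
      have h1 : r ∈ RingHom.ker (PadicInt.toZMod (p := p)) := hr
      rw [PadicInt.ker_toZMod, PadicInt.maximalIdeal_eq_span_p, Ideal.mem_span_singleton] at h1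
      exact h1) (fun r hr => (mul_eq_zero.1 hr).resolve_left PadicInt.prime_p.ne_zero) Φ φ hφ hσ
  have hσd : ∀ j, (σ (X j)).totalDegree ≤ d := by
    intro j
    -- The element φ(g_j)^p corresponds to σ(x_j) in the centre; both descriptions multiply the
    -- degree by p, so σ inherits the degree bound of φ independently of p.
    have h1 : (symbol (ZMod p) n (φ (gen (ZMod p) j) ^ p)).totalDegree
        = (σ (X j)).totalDegree * p := by
      rw [← map_pow, ← frobCenter_X, hσ, symbol_frobCenter, totalDegree_expand]
    rw [totalDegree_symbol_pow _ _ hpos.ne', mul_comm] at h1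
    rw [← Nat.eq_of_mul_eq_mul_right hpos h1]
    exact hd j
  choose G hG hGB using fun i => hp i σ hσd hdet
  have hs : Function.Surjective σ := algHom_surjective_of_X_mem_range σ fun i => ⟨G i, hG i⟩
  obtain ⟨a, ha⟩ := surjective_of_frobCenter_surjective φ hσ hs (gen (ZMod p) i)
  refine ⟨a, ha, ?_⟩
  -- Both sides have image g_i^p under the injective φ; comparing degrees, `a` has the degree of `G
  -- i`.
  have h2 : a ^ p = frobCenter (ZMod p) p n (G i) := by
    apply injective_of_frobCenter_injective φ hσ
      (RingHom.injective_of_surjective_endo σ.toRingHom hs)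
    rw [map_pow, ha, hσ, hG, frobCenter_X]
  have h3 := totalDegree_symbol_pow a p hpos.ne'
  rw [h2, symbol_frobCenter, totalDegree_expand, mul_comm] at h3
  rw [← Nat.eq_of_mul_eq_mul_left hpos h3]
  exact hGB i

end WeylAlgebra

open WeylAlgebra in
-- If a generator is missed, a functional on finitely many monomials separates its symbol from the
-- symbols of the images of all basis elements of degree at most B. Reduced modulo a large p, this
-- contradicts the preimage of degree at most B that exists there.
theorem DixmierConjecture.of_jacobianConjecture {K : Type*} [Field K] [CharZero K]
    (hJC : ∀ m, JacobianConjecture K m) (n : ℕ) : DixmierConjecture K n := by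
  classical
  intro φ
  have : Nontrivial (WeylAlgebra K n) := (symbol K n).toEquiv.nontrivial
  refine AlgHom.isUnit_of_bijective φ ⟨algHom_injective φ, ?_⟩
  by_contra hsurj
  obtain ⟨i, hi⟩ : ∃ i, gen K i ∉ φ.range := by
    by_contra hcon
    push Not at hcon
    refine hsurj ((AlgHom.range_eq_top φ).1 (eq_top_iff.2 ?_))
    rw [← adjoin_range_gen]
    exact Algebra.adjoin_le (by rintro _ ⟨i, rfl⟩; exact hcon i)
  let d := Finset.univ.sup fun a => (symbol K n (φ (gen K a))).totalDegree
  let B := inverseDegreeBound d (Fintype.card (Fin n ⊕ Fin n))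
  let M := (LinearMap.range φ.toLinearMap).map (symbol K n).toLinearMap
  have hM : (X i : MvPolynomial (Fin n ⊕ Fin n) K) ∉ M := by
    rintro ⟨_, ⟨w, rfl⟩, hw⟩
    refine hi ⟨w, (symbol K n).injective ?_⟩
    rw [symbol_gen]
    exact hw
  -- Only preimages of degree at most B need to be excluded, so finitely many monomials, hence
  -- finitely many scalars, carry the certificate.
  let T := ((exponentsLE (Fin n ⊕ Fin n) B).biUnion fun β =>
    (symbol K n (φ (basisElt K β))).support) ∪ (X i : MvPolynomial (Fin n ⊕ Fin n) K).support
  obtain ⟨V, hV1, hV2⟩ := exists_pairing_of_notMem M hM T Finset.subset_union_right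
  let gens : Finset K :=
    (Finset.univ.biUnion fun a => (symbol K n (φ (gen K a))).coeffs) ∪ T.image V
  let S := Algebra.adjoin ℤ (gens : Set K)
  have hft := finiteType_int_adjoin gens
  have hcharS : CharZero S := by
    refine charZero_of_inj_zero fun n hn => ?_
    have := congrArg Subtype.val hn
    simpa using this
  let ι : S →+* K := S.val.toRingHom
  have hι : Function.Injective ι := Subtype.val_injective
  have hgen : ∀ a, φ (gen K a) ∈ Set.range (WeylAlgebra.map ι n) := fun a =>
    mem_range_map_of_coeffs fun c hc => ⟨⟨c, Algebra.subset_adjoin (by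
      simp only [gens, Finset.coe_union]
      exact Or.inl (Finset.mem_biUnion.2 ⟨a, Finset.mem_univ a, hc⟩))⟩, rfl⟩
  obtain ⟨φS, hφS⟩ := exists_restrictScalars hι φ hgen
  have hv : ∀ m ∈ T, V m ∈ S := fun m hm => Algebra.subset_adjoin (by
    simp only [gens, Finset.coe_union]
    exact Or.inr (Finset.mem_image_of_mem V hm))
  let vS : (Fin n ⊕ Fin n →₀ ℕ) → S := fun m => if hm : m ∈ T then ⟨V m, hv m hm⟩ else 0
  have hvS : ∀ m ∈ T, V m = ι (vS m) := by
    intro m hm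
    simp only [vS, dif_pos hm]
    rfl
  have hX : pairing T vS (X i) = 1 := hι (by
    rw [← pairing_map ι T hvS, map_X, hV1, map_one])
  have hpair : ∀ β ∈ exponentsLE (Fin n ⊕ Fin n) B,
      pairing T vS (symbol S n (φS (basisElt S β))) = 0 := fun β hβ => hι (by
    rw [← pairing_map ι T hvS, ← symbol_map, hφS, map_basisElt, map_zero]
    refine hV2 _ ⟨_, ⟨basisElt K β, rfl⟩, rfl⟩ (Finset.Subset.trans ?_ Finset.subset_union_left)
    exact Finset.subset_biUnion_of_mem (fun β => (symbol K n (φ (basisElt K β))).support) hβ)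
  choose N hN using JacobianConjecture.exists_bounded_preimage (ι := Fin n ⊕ Fin n) hJC d
  -- Passing through ℤ_p, not directly to F_p, keeps a p-torsion-free lift, without which the map on
  -- the centre need not be Poisson.
  obtain ⟨p, hp, hpN, ⟨g⟩⟩ := @exists_hom_to_padicInt S _ hft hcharS (Finset.univ.sup N)
  obtain ⟨Φ, hΦ⟩ := exists_baseChange g φS
  obtain ⟨φp, hφp⟩ := exists_baseChange (PadicInt.toZMod (p := p)) Φ
  have hdeg : ∀ a, (symbol (ZMod p) n (φp (gen (ZMod p) a))).totalDegree ≤ d := by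
    intro a
    rw [← map_gen PadicInt.toZMod, ← hφp, ← map_gen g, ← hΦ, symbol_map, symbol_map]
    refine (totalDegree_map_le _ _).trans ((totalDegree_map_le _ _).trans ?_)
    rw [← totalDegree_map_of_injective hι, ← symbol_map, hφS, map_gen]
    exact Finset.le_sup (f := fun a => (symbol K n (φ (gen K a))).totalDegree) (Finset.mem_univ a)
  obtain ⟨a, ha, haB⟩ := exists_bounded_preimage
    (fun j => hN j p (lt_of_le_of_lt (Finset.le_sup (Finset.mem_univ j)) hpN)) Φ φp hφp hdeg i
  let v : (Fin n ⊕ Fin n →₀ ℕ) → ZMod p := fun m => PadicInt.toZMod (g (vS m))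
  have hv_map : ∀ P : MvPolynomial (Fin n ⊕ Fin n) S,
      pairing T v (MvPolynomial.map PadicInt.toZMod (MvPolynomial.map g P))
        = PadicInt.toZMod (g (pairing T vS P)) := fun P => by
    rw [pairing_map PadicInt.toZMod T (V := fun m => g (vS m)) (fun _ _ => rfl),
      pairing_map g T (V := vS) (fun _ _ => rfl)]
  have h1 : pairing T v (symbol (ZMod p) n (φp a)) = 1 := by
    have := hv_map (X i)
    rwa [hX, map_X, map_X, map_one, map_one, ← symbol_gen, ← ha] at this
  have h0 : pairing T v (symbol (ZMod p) n (φp a)) = 0 := by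
    rw [eq_sum_basisElt a, map_sum, map_sum, map_sum]
    refine Finset.sum_eq_zero fun β hβ => ?_
    rw [map_smul, map_smul, map_smul, ← map_basisElt PadicInt.toZMod, ← hφp, ← map_basisElt g,
      ← hΦ, symbol_map, symbol_map, hv_map, hpair β (support_subset_exponentsLE haB hβ), map_zero,
      map_zero, smul_zero]
  exact one_ne_zero (h1.symm.trans h0)

end JacobianImpliesDixmier

theorem mainTheorem4 (K : Type*) [Field K] [CharZero K] :
    (∀ n : ℕ, JacobianConjecture K (2 * n) → PoissonConjecture K n) ∧
    (∀ n : ℕ, DixmierConjecture K (2 * n) → PoissonConjecture K n) ∧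
    (∀ n : ℕ, PoissonConjecture K n → JacobianConjecture K n) ∧
    ((∀ n : ℕ, JacobianConjecture K n) ↔ (∀ n : ℕ, PoissonConjecture K n)) ∧
    (((∀ n : ℕ, JacobianConjecture K n) ↔ (∀ n : ℕ, DixmierConjecture K n)) ∧
      ((∀ n : ℕ, DixmierConjecture K n) ↔ (∀ n : ℕ, PoissonConjecture K n))) := by
  have hJP : (∀ n, JacobianConjecture K n) ↔ ∀ n, PoissonConjecture K n :=
    ⟨fun h n => PoissonConjecture.of_jacobianConjecture (h (2 * n)),
      fun h n => JacobianConjecture.of_poissonConjecture (h n)⟩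
  have hJD : (∀ n, JacobianConjecture K n) ↔ ∀ n, DixmierConjecture K n :=
    ⟨DixmierConjecture.of_jacobianConjecture,
      fun h n => JacobianConjecture.of_dixmierConjecture (h n)⟩
  exact ⟨fun n h => PoissonConjecture.of_jacobianConjecture h,
    -- DC_{2n} ⇒ JC_{2n} ⇒ PC_{2n}, without change of dimension in the first step.
    fun n h => PoissonConjecture.of_jacobianConjecture (JacobianConjecture.of_dixmierConjecture h),
    fun n h => JacobianConjecture.of_poissonConjecture h, hJP, hJD, hJD.symm.trans hJP⟩
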